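/- **Setting.** Let $\pi:Y\to X$ be a fibration (surjective submersion of smooth manifolds) with $\dim X=n\ge 1$, $\dim Y=n+m$. All identities below are identities of differential forms over the domain of an arbitrary fibred chart $(x^i,y^\sigma)$, with jet coordinates $y^\sigma_I$ ($I$ a symmetric multi-index); forms on $J^kY$ are identified with their pull-backs to higher jet prolongations. Let $d_i$ be the $i$-th formal (total) derivative, acting on functions and forms, $\omega^\sigma_I=dy^\sigma_I-y^\sigma_{Ii}dx^i$, and let $p_l\eta$ be the $l$-contact component of $\eta$, so that $(\pi_{k+1,k})^*\eta=p_0\eta+p_1\eta+\dots+p_q\eta$ for a $q$-form $\eta$ on $J^kY$; put $h=p_0$ and $d_H\eta=\sum_l p_l\,d\,p_l\eta$. For an $(n+1)$-form $\eta$ on $J^kY$ put $\Psi^I_\sigma=\frac{\partial}{\partial y^\sigma_I}\rfloor p_1\eta$ and $$\mathcal I(\eta)=\omega^\sigma\wedge\sum_{|I|\le k}(-1)^{|I|}d_I\Psi^I_\sigma,\qquad \zeta^I_\sigma=\sum_{|J|\le k-|I|}(-1)^{|J|}\binom{I+J}{J}d_J\Psi^{I+J}_\sigma,$$ $$\mathcal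 R(\eta)=-\sum_{|I|\le k-1}\sum_j\frac{I_j+1}{|I|+1}\,d_I\Big(\omega^\sigma\wedge\big(\tfrac{\partial}{\partial x^j}\rfloor\zeta^{Ij}_\sigma\big)\Big)$$ (interior Euler operator and local residual operator; repeated $\sigma$ is summed, $\binom{I+J}{J}=\prod_i\binom{I_i+J_i}{J_i}$, and $Ij$ is $I$ with the index $j$ added). For a projectable vector field $\psi$ on $Y$ let $J^k\psi$ be its prolongation, $\psi_H=\psi^id_i$ and $\psi_V=J^k\psi-\psi_H$ its horizontal and vertical parts (vector fields along $\pi_{k+1,k}$), and for a horizontal $n$-form $\lambda$ let $$\epsilon_\psi(\lambda)=-\,\psi_V\rfloor p_1\mathcal R(d\lambda)+\psi_H\rfloor\lambda$$ be the (local) Noether current of $\lambda$ associated with $\psi$. **Theorem 3.4.** Let $\rho$ be a smooth $n$-form on $J^rY$, let $l\ge1$ and let $\psi_1,\dots,\psi_l$ be smooth projectable vector fields on $Y$. Put $r_0=r$, $r_i=2r_{i-1}+1$, and $$A_0=h\rho,\qquad A_j=\psi_{j,V}\rfloor\mathcal I\,d(A_{j-1})\quad(1\le j\le l).$$ Then each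 of the $l+1$ forms $A_l$ and $d_H\epsilon_{\psi_l}\big(d_H\epsilon_{\psi_{l-1}}(\cdots d_H\epsilon_{\psi_{j+1}}(A_j)\cdots)\big)$, $0\le j<l$, is (the pull-back of) a smooth form of order $r_l$, and on the $r_l$-jets $$(\pi_{r_l,r+1})^*\big(L_{J^{r+1}\psi_l}\cdots L_{J^{r+1}\psi_1}h\rho\big)=A_l+\sum_{j=0}^{l-1}d_H\epsilon_{\psi_l}\big(d_H\epsilon_{\psi_{l-1}}(\cdots d_H\epsilon_{\psi_{j+1}}(A_j)\cdots)\big).$$ -/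

import Mathlib

open scoped Manifold ContDiff Topology

noncomputable section

namespace JetVar

/-! ### Multi-indices and coordinate jet spaces -/

/-- The standard fibre `ℝ^N`, as a model for manifolds and for values of coordinates. -/
abbrev Vec (N : ℕ) : Type := Fin N → ℝ

/-- The length `|I|` of a symmetric multi-index `I ∈ ℕ^N`
(an ordered tuple `(i₁, …, i_s)` up to rearrangement, `I i` being the number of occurrences
of `i`). -/
def len {N : ℕ} (I : Fin N → ℕ) : ℕ := ∑ i, I i

/-- The multi-index consisting of the single index `i`; thus `I + ix i` is the multi-index `Ii`. -/
def ix {N : ℕ} (i : Fin N) : Fin N → ℕ := Pi.single i 1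

/-- Multi-indices of length at most `k`. -/
def MI (N k : ℕ) : Type := {I : Fin N → ℕ // len I ≤ k}

theorem MI.le_of {N k : ℕ} (I : MI N k) (i : Fin N) : I.1 i < k + 1 :=
  Nat.lt_succ_of_le ((Finset.single_le_sum (fun j _ => Nat.zero_le (I.1 j))
    (Finset.mem_univ i)).trans I.2)

instance (N k : ℕ) : Finite (MI N k) :=
  Finite.of_injective (β := Fin N → Fin (k + 1)) (fun I i => ⟨I.1 i, I.le_of i⟩) (by
    intro I J h
    apply Subtype.ext
    funext i
    have := congrFun h i
    simpa using this)

instance (N k : ℕ) : Fintype (MI N k) := Fintype.ofFinite _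

instance (N k : ℕ) : DecidableEq (MI N k) := Classical.decEq _

/-- A nondecreasing list of indices representing the multi-index `I`. -/
def toL {N : ℕ} (I : Fin N → ℕ) : List (Fin N) :=
  (List.finRange N).flatMap fun i => List.replicate (I i) i

/-- The multi-index represented by a list of indices. -/
def ofL {N : ℕ} (L : List (Fin N)) : Fin N → ℕ := fun i => L.count i

/-- The space of jet coordinates `(x^i, y^σ_I)`, `|I| ≤ k`, of order `k`
for a fibration with `N`-dimensional base and `m`-dimensional fibres. -/
abbrev Jet (N m k : ℕ) : Type := Vec N × (MI N k → Vec m)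

variable {N m : ℕ}

/-- The coordinate `u ↦ (y^σ_I)_σ` on `J^k`. For `|I| > k` there is no such coordinate and the
value is `0` by convention. -/
def crd (k : ℕ) (I : Fin N → ℕ) : Jet N m k →L[ℝ] Vec m :=
  if h : len I ≤ k then
    (ContinuousLinearMap.proj (R := ℝ) (φ := fun _ : MI N k => Vec m) ⟨I, h⟩).comp
      (ContinuousLinearMap.snd ℝ (Vec N) (MI N k → Vec m))
  else 0

/-- The projection `π_{k,k'} : J^k → J^{k'}`, which forgets the coordinates of order `> k'`;
it is meant for `k' ≤ k`. -/
def jproj (k k' : ℕ) : Jet N m k →L[ℝ] Jet N m k' :=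
  (ContinuousLinearMap.fst ℝ (Vec N) (MI N k → Vec m)).prod
    (ContinuousLinearMap.pi fun I : MI N k' => crd k I.1)

/-- The point `(x, y)` of the total space under a jet. -/
def base {k : ℕ} (u : Jet N m k) : Vec N × Vec m := (u.1, crd k 0 u)

/-- The part of the coordinate jet space of order `k` over a subset of the total space. -/
def jetsOver (k : ℕ) (W : Set (Vec N × Vec m)) : Set (Jet N m k) := {u | base u ∈ W}

/-- The coordinate vector `∂/∂x^i` on `J^k`. -/
def ddx (k : ℕ) (i : Fin N) : Jet N m k := (Pi.single i 1, 0)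

/-- The coordinate vector `∂/∂y^σ_I` on `J^k` (zero if `|I| > k`). -/
def ddy (k : ℕ) (σ : Fin m) (I : Fin N → ℕ) : Jet N m k :=
  (0, fun J => if J.1 = I then Pi.single σ 1 else 0)

/-- The formal derivative `d_i = ∂/∂x^i + ∑ y^σ_{Ii} ∂/∂y^σ_I` as a vector field along
`π_{k+1,k}`. -/
def formalD (k : ℕ) (i : Fin N) (u : Jet N m (k + 1)) : Jet N m k :=
  (Pi.single i 1, fun I => crd (k + 1) (I.1 + ix i) u)

/-- The formal derivative of a function on `J^k`, a function on `J^{k+1}`. -/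
def totalD {G : Type*} [NormedAddCommGroup G] [NormedSpace ℝ G] {k : ℕ} (i : Fin N)
    (f : Jet N m k → G) : Jet N m (k + 1) → G :=
  fun u => fderiv ℝ f (jproj (k + 1) k u) (formalD k i u)

/-- The horizontal part of tangent vectors: `T J^{k+1} → T J^k`, `v ↦ v^i d_i`. -/
def horL {k : ℕ} (u : Jet N m (k + 1)) : Jet N m (k + 1) →L[ℝ] Jet N m k :=
  ∑ i, ((ContinuousLinearMap.proj (R := ℝ) (φ := fun _ : Fin N => ℝ) i).comp
    (ContinuousLinearMap.fst ℝ (Vec N) (MI N (k + 1) → Vec m))).smulRight (formalD k i u)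

/-- The contact (vertical) part of tangent vectors: `v ↦ Tπ_{k+1,k} v - v^i d_i`. -/
def conL {k : ℕ} (u : Jet N m (k + 1)) : Jet N m (k + 1) →L[ℝ] Jet N m k :=
  jproj (k + 1) k - horL u

/-! ### Differential forms on coordinate jet spaces -/

/-- Multilinear algebra: `∑_S η(w_1, …, w_q)`, the sum being over the `l`-element sets `S` of
slots, with `w_i = A v_i` for `i ∈ S` and `w_i = B v_i` for `i ∉ S`. -/
def mix {E E' : Type*} [NormedAddCommGroup E] [NormedSpace ℝ E] [NormedAddCommGroup E']
    [NormedSpace ℝ E'] {q : ℕ} (l : ℕ) (A B : E' →L[ℝ] E) (η : E [⋀^Fin q]→L[ℝ] ℝ) :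
    E' [⋀^Fin q]→L[ℝ] ℝ :=
  { (∑ S ∈ (Finset.univ : Finset (Fin q)).powersetCard l,
      η.toContinuousMultilinearMap.compContinuousLinearMap
        (fun i => if i ∈ S then A else B)) with
    map_eq_zero_of_eq' := fun v i j hv hij => by
      have key : ∀ S : Finset (Fin q),
          (η fun a => (if a ∈ S.map (Equiv.swap i j).toEmbedding then A else B) (v a))
            = - η fun a => (if a ∈ S then A else B) (v a) := by
        intro S
        change η.toAlternatingMap _ = - η.toAlternatingMap _
        rw [← η.toAlternatingMap.map_swap _ hij]
        congr 1
        funext a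
        have hva : v (Equiv.swap i j a) = v a := by
          rcases eq_or_ne a i with rfl | hai
          · rw [Equiv.swap_apply_left, hv]
          · rcases eq_or_ne a j with rfl | haj
            · rw [Equiv.swap_apply_right, hv]
            · rw [Equiv.swap_apply_of_ne_of_ne hai haj]
        simp only [Function.comp_apply, Finset.mem_map_equiv, Equiv.symm_swap, hva]
      have h : ∑ S ∈ (Finset.univ : Finset (Fin q)).powersetCard l,
          (η fun a => (if a ∈ S then A else B) (v a)) = 0 := by
        refine Finset.sum_involution (fun S _ => S.map (Equiv.swap i j).toEmbedding)
          (fun S _ => ?_) (fun S _ hS hSS => hS ?_) (fun S hS => ?_) (fun S _ => ?_)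
        · rw [key, add_neg_cancel]
        · have := key S
          rw [hSS] at this
          linarith
        · rw [Finset.mem_powersetCard] at hS ⊢
          exact ⟨Finset.subset_univ _, by rw [Finset.card_map, hS.2]⟩
        · ext a
          simp [Finset.mem_map_equiv]
      simpa [sum_apply] using h }

/-- Differential `q`-forms on (open subsets of) the coordinate jet space of order `k`. -/
abbrev Form (N m k q : ℕ) : Type := Jet N m k → Jet N m k [⋀^Fin q]→L[ℝ] ℝ

/-- Smoothness over a subset of the total space. -/
def SmoothOver {k q : ℕ} (W : Set (Vec N × Vec m)) (η : Form N m k q) : Prop :=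
  ContDiffOn ℝ ∞ η (jetsOver k W)

/-- The pull-back `(π_{k',k})^* η`. -/
def pull {k q : ℕ} (k' : ℕ) (η : Form N m k q) : Form N m k' q :=
  fun u => (η (jproj k' k u)).compContinuousLinearMap (jproj k' k)

/-- The contact components `p_l η` in `(π_{k+1,k})^* η = p_0 η + p_1 η + ⋯ + p_q η`:
in exactly `l` slots the contact part of the argument is inserted, in the others the horizontal
part. In particular `p 0` is the horizontalization `h`. -/
def p {k q : ℕ} (l : ℕ) (η : Form N m k q) : Form N m (k + 1) q :=
  fun u => mix l (conL u) (horL u) (η (jproj (k + 1) k u))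

/-- The horizontal differential `d_H η = ∑_l p_l d p_l η`. -/
def dH {k q : ℕ} (η : Form N m k q) : Form N m (k + 2) (q + 1) :=
  ∑ l ∈ Finset.range (q + 1), p l (extDeriv (p l η))

/-- The contraction `ξ ⌋ η`, pulled back to `J^{k'}`, with a vector field `ξ` along
`π_{k',k} : J^{k'} → J^k`. -/
def contr {k k' q : ℕ} (ξ : Jet N m k' → Jet N m k) (η : Form N m k (q + 1)) :
    Form N m k' q :=
  fun u => ((η (jproj k' k u)).curryLeft (ξ u)).compContinuousLinearMap (jproj k' k)

/-- The Lie derivative of forms with respect to a vector field `ξ` along `π_{k',k}`: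
`(L_ξ η)(v_1, …, v_q) = (D_ξ η)(v_1, …, v_q) + ∑_i η(v_1, …, D_{v_i} ξ, …, v_q)`. For `k' = k`,
this is the usual Lie derivative. -/
def lie {k k' q : ℕ} (ξ : Jet N m k' → Jet N m k) (η : Form N m k q) : Form N m k' q :=
  fun u => (fderiv ℝ η (jproj k' k u) (ξ u)).compContinuousLinearMap (jproj k' k)
    + mix 1 (fderiv ℝ ξ u) (jproj k' k) (η (jproj k' k u))

/-- The formal derivative `d_i` of forms: it is the total derivative on functions, commutes with
the exterior derivative and satisfies the Leibniz rule. -/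
def formD {k q : ℕ} (i : Fin N) (η : Form N m k q) : Form N m (k + 1) q :=
  lie (formalD k i) η

/-- Iterated formal derivatives `d_{i_1} ⋯ d_{i_s}` of forms. -/
def formDL {k q : ℕ} : (L : List (Fin N)) → Form N m k q → Form N m (k + L.length) q
  | [], η => η
  | i :: L, η => formD i (formDL L η)

/-- The iterated formal derivative `d_I`, pulled back to `J^{k'}` (with `k + |I| ≤ k'`). -/
def dI {k q : ℕ} (k' : ℕ) (I : Fin N → ℕ) (η : Form N m k q) : Form N m k' q :=
  pull k' (formDL (toL I) η)

/-- The contact `1`-form `ω^σ = dy^σ - y^σ_i dx^i` on `J^k`, `k ≥ 1`. -/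
def contactForm (k : ℕ) (σ : Fin m) (u : Jet N m k) : Jet N m k →L[ℝ] ℝ :=
  (ContinuousLinearMap.proj (R := ℝ) (φ := fun _ : Fin m => ℝ) σ).comp (crd k 0)
    - ∑ i, (crd k (ix i) u σ) •
      (ContinuousLinearMap.proj (R := ℝ) (φ := fun _ : Fin N => ℝ) i).comp
        (ContinuousLinearMap.fst ℝ (Vec N) (MI N k → Vec m))

/-- The wedge product `α ∧ β` of a `1`-form with a `q`-form. -/
def wedge {k q : ℕ} (α : Jet N m k → Jet N m k →L[ℝ] ℝ) (β : Form N m k q) :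
    Form N m k (q + 1) :=
  fun u => ContinuousAlternatingMap.alternatizeUncurryFin ((α u).smulRight (β u))

/-- `Ψ^I_σ = ∂/∂y^σ_I ⌋ p_1 ρ`. -/
def Psi {k q : ℕ} (ρ : Form N m k (q + 1)) (σ : Fin m) (I : Fin N → ℕ) : Form N m (k + 1) q :=
  contr (fun _ => ddy (k + 1) σ I) (p 1 ρ)

/-- The interior Euler operator on forms of degree `dim X + 1`,
`𝓘(ρ) = ω^σ ∧ ∑_{|I| ≤ k} (-1)^{|I|} d_I (∂/∂y^σ_I ⌋ p_1 ρ)`. -/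
def intEuler {n k : ℕ} (ρ : Form (n + 1) m k (n + 2)) : Form (n + 1) m (2 * k + 1) (n + 2) :=
  ∑ σ, wedge (contactForm (2 * k + 1) σ)
    (∑ I : MI (n + 1) k, (-1 : ℝ) ^ len I.1 • dI (2 * k + 1) I.1 (Psi ρ σ I.1))

/-- The horizontal forms `ζ^I_σ = ∑_{|J| ≤ k - |I|} (-1)^{|J|} binom(I+J, J) d_J Ψ^{JI}_σ` in the
integration by parts `p_1 ρ = ∑_I ω^σ_I ∧ Ψ^I_σ = ∑_I d_I (ω^σ ∧ ζ^I_σ)`. With symmetric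
multi-indices the coefficient is the multi-index binomial `∏_i binom(I_i + J_i, J_i)`. -/
def zeta {n k : ℕ} (ρ : Form (n + 1) m k (n + 2)) (σ : Fin m) (I : Fin (n + 1) → ℕ) :
    Form (n + 1) m (2 * k + 1) (n + 1) :=
  ∑ J : MI (n + 1) (k - len I),
    ((-1 : ℝ) ^ len J.1 * ∏ i, ((I i + J.1 i).choose (J.1 i) : ℝ)) •
      dI (2 * k + 1) J.1 (Psi ρ σ (J.1 + I))

/-- The local residual operator on forms of degree `dim X + 1`:
`R(ρ) = - ∑_{|I| ≤ k-1} ∑_j d_I (Φ^{Ij} ∧ ds_j)` with `Φ^{Ij} ∧ ds = ω^σ ∧ ζ^{Ij}_σ`, so that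
`Φ^{Ij} ∧ ds_j = ω^σ ∧ (∂/∂x^j ⌋ ζ^{Ij}_σ)`. The factor `(I_j + 1) / (|I| + 1)` converts the sum
over tuples `(i_1, …, i_s, j)` to a sum over symmetric multi-indices: it is the
proportion of the orderings of the multi-index `Ij` that end in `j`. -/
def residual {n k : ℕ} (ρ : Form (n + 1) m k (n + 2)) : Form (n + 1) m (3 * k + 1) (n + 1) :=
  - ∑ I : MI (n + 1) k with len I.1 < k, ∑ j, ∑ σ,
    (((I.1 j + 1 : ℕ) : ℝ) / ((len I.1 + 1 : ℕ) : ℝ)) •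
      dI (3 * k + 1) I.1
        (wedge (contactForm (2 * k + 1) σ)
          (contr (fun _ => ddx (2 * k + 1) j) (zeta ρ σ (I.1 + ix j))))

/-! ### Prolongations of projectable vector fields -/

/-- The coefficient `ψ^σ_I` of the prolongation of a projectable vector field
`ψ = ψ^i ∂/∂x^i + ψ^σ ∂/∂y^σ`, by the recursion
`ψ^σ_{Ii} = d_i ψ^σ_I - y^σ_{Ij} d_i ψ^j`. -/
def prolCoeff (ψ : Vec N × Vec m → Vec N × Vec m) :
    (L : List (Fin N)) → Jet N m L.length → Vec m
  | [], u => (ψ (base u)).2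
  | i :: L, u => totalD i (prolCoeff ψ L) u
      - ∑ j, totalD (k := 0) i (fun w => (ψ (base w)).1 j) (jproj (L.length + 1) 1 u) •
          crd (L.length + 1) (ofL L + ix j) u

/-- The prolongation `J^k ψ` of a projectable vector field. -/
def prol (k : ℕ) (ψ : Vec N × Vec m → Vec N × Vec m) (u : Jet N m k) : Jet N m k :=
  ((ψ (base u)).1, fun I => prolCoeff ψ (toL I.1) (jproj k (toL I.1).length u))

/-- The horizontal part `J^k ψ_H = ψ^i d_i` of the prolongation, along `π_{k+1,k}`. -/
def prolH (k : ℕ) (ψ : Vec N × Vec m → Vec N × Vec m) (u : Jet N m (k + 1)) : Jet N m k :=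
  horL u (prol (k + 1) ψ u)

/-- The vertical (contact) part `J^k ψ_V = J^k ψ - J^k ψ_H` of the prolongation, along
`π_{k+1,k}`. -/
def prolV (k : ℕ) (ψ : Vec N × Vec m → Vec N × Vec m) (u : Jet N m (k + 1)) : Jet N m k :=
  conL u (prol (k + 1) ψ u)

/-! ### Variations and currents of Lagrangians -/

/-- `ψ_V ⌋ 𝓘 d λ` for a Lagrangian `λ` of order `s`. -/
def eulerContr {n s : ℕ} (ψ : Vec (n + 1) × Vec m → Vec (n + 1) × Vec m)
    (lam : Form (n + 1) m s (n + 1)) : Form (n + 1) m (2 * s + 2) (n + 1) :=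
  contr (prolV (2 * s + 1) ψ) (intEuler (extDeriv lam))

/-- The local generalized momentum `p_{d_V λ} = - p_1 R(d λ)`. -/
def momentum {n s : ℕ} (lam : Form (n + 1) m s (n + 1)) : Form (n + 1) m (3 * s + 2) (n + 1) :=
  - p 1 (residual (extDeriv lam))

/-- The Noether current `ε_ψ(λ) = Jψ_V ⌋ p_{d_V λ} + ψ_H ⌋ λ`. -/
def noether {n s : ℕ} (ψ : Vec (n + 1) × Vec m → Vec (n + 1) × Vec m)
    (lam : Form (n + 1) m s (n + 1)) : Form (n + 1) m (3 * s + 3) n :=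
  contr (prolV (3 * s + 2) ψ) (momentum lam) + pull (3 * s + 3) (contr (prolH s ψ) lam)

/-- The iterated Lie derivative `L_{J^s ψ_l} ⋯ L_{J^s ψ_1} λ` of a form on `J^s`. -/
def iterLie {s q : ℕ} (ψ : ℕ → Vec N × Vec m → Vec N × Vec m) (lam : Form N m s q) :
    ℕ → Form N m s q
  | 0 => lam
  | l + 1 => lie (prol s (ψ (l + 1))) (iterLie ψ lam l)

/-- An upper bound for the order of jets on which the terms of the `l`-th variation of a Lagrangian
of order `s` are written. -/
def bigOrder (s : ℕ) : ℕ → ℕ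
  | 0 => s
  | l + 1 => 3 * bigOrder s l + 5

/-- The `j`-th term of the `l`-th variation, `j ≤ l`: with
`A_j = ψ_{j,V} ⌋ 𝓘 d(⋯ ψ_{1,V} ⌋ 𝓘 d λ ⋯)`, it is
`d_H ε_{ψ_l}(d_H ε_{ψ_{l-1}}(⋯ d_H ε_{ψ_{j+1}}(A_j) ⋯))`, which is `A_l` for `j = l`. -/
def varTerm {n s : ℕ} (ψ : ℕ → Vec (n + 1) × Vec m → Vec (n + 1) × Vec m)
    (lam : Form (n + 1) m s (n + 1)) (j : ℕ) :
    (l : ℕ) → Form (n + 1) m (bigOrder s l) (n + 1)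
  | 0 => lam
  | l + 1 =>
      if l + 1 ≤ j then pull (3 * bigOrder s l + 5) (eulerContr (ψ (l + 1)) (varTerm ψ lam j l))
      else dH (noether (ψ (l + 1)) (varTerm ψ lam j l))

/-- The orders `r_l`: `r_0 = r`, `r_{l+1} = 2 r_l + 1`. -/
def ord (r : ℕ) : ℕ → ℕ
  | 0 => r
  | l + 1 => 2 * ord r l + 1

/-! ### Fibred manifolds -/

section Fibred

variable {X Y : Type*} [TopologicalSpace X] [ChartedSpace (Vec N) X]
  [TopologicalSpace Y] [ChartedSpace (Vec N × Vec m) Y]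

/-- Fibred coordinates `(x^i, y^σ)` on an open subset of `Y`, over coordinates `(x^i)` on an open
subset of `X`. -/
structure FibredChart (π : Y → X) where
  /-- the coordinates `(x^i, y^σ)` -/
  chart : OpenPartialHomeomorph Y (Vec N × Vec m)
  /-- the coordinates `(x^i)` of the base -/
  baseChart : OpenPartialHomeomorph X (Vec N)
  chart_mem : chart ∈ IsManifold.maximalAtlas 𝓘(ℝ, Vec N × Vec m) ∞ Y
  baseChart_mem : baseChart ∈ IsManifold.maximalAtlas 𝓘(ℝ, Vec N) ∞ X
  mapsTo : ∀ y ∈ chart.source, π y ∈ baseChart.source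
  fst_eq : ∀ y ∈ chart.source, (chart y).1 = baseChart (π y)

variable {π : Y → X}

/-- The iterated partial derivative `∂_I s`. -/
def partialD (I : Fin N → ℕ) (s : Vec N → Vec m) : Vec N → Vec m :=
  (toL I).foldr (fun i f x => fderiv ℝ f x (Pi.single i 1)) s

/-- The coordinates of the `k`-jet at `x` of the local section `x ↦ (x, s x)`. -/
def jetOf (k : ℕ) (s : Vec N → Vec m) (x : Vec N) : Jet N m k :=
  (x, fun I => partialD I.1 s x)

/-- The polynomial section whose `k`-jet at `u.1` is `u`. -/
def taylor {k : ℕ} (u : Jet N m k) : Vec N → Vec m :=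
  fun z => ∑ I : MI N k, (∏ i, (z i - u.1 i) ^ I.1 i / (Nat.factorial (I.1 i) : ℝ)) • u.2 I

/-- The change of jet coordinates from the fibred chart `e` to the fibred chart `e'`:
the jet of a section is sent to the jet of the same section, written in the coordinates `e'`. -/
def jetTransition (k : ℕ) (e e' : FibredChart (N := N) (m := m) π) (u : Jet N m k) :
    Jet N m k :=
  jetOf k
    (fun z =>
      let x := e.baseChart (e'.baseChart.symm z)
      (e'.chart (e.chart.symm (x, taylor u x))).2)
    (e'.baseChart (e.baseChart.symm u.1))

/-- A smooth differential `q`-form on `J^k Y`, given by its expressions in all fibred charts,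
which are smooth and transform into each other by pull-back along the changes of jet
coordinates. Only the values of `form e` over the domain of the chart `e` matter. -/
structure JetForm (π : Y → X) (k q : ℕ) where
  /-- the expression of the form in a fibred chart -/
  form : FibredChart (N := N) (m := m) π → Form N m k q
  smooth : ∀ e, SmoothOver e.chart.target (form e)
  compat : ∀ e e' : FibredChart (N := N) (m := m) π, ∀ u ∈ jetsOver k e.chart.target,
    e.chart.symm (base u) ∈ e'.chart.source →
      form e u = (form e' (jetTransition k e e' u)).compContinuousLinearMap
        (fderiv ℝ (jetTransition k e e') u)

/-- A smooth `π`-projectable vector field on `Y`. -/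
structure ProjField [IsManifold 𝓘(ℝ, Vec N) ∞ X] [IsManifold 𝓘(ℝ, Vec N × Vec m) ∞ Y]
    (π : Y → X) where
  /-- the vector field on `Y` -/
  field : ∀ y : Y, TangentSpace 𝓘(ℝ, Vec N × Vec m) y
  smooth : ContMDiff 𝓘(ℝ, Vec N × Vec m) (𝓘(ℝ, Vec N × Vec m)).tangent ∞
    (fun y => (⟨y, field y⟩ : TangentBundle 𝓘(ℝ, Vec N × Vec m) Y))
  projectable : ∃ field₀ : ∀ x : X, TangentSpace 𝓘(ℝ, Vec N) x,
    ∀ y, mfderiv 𝓘(ℝ, Vec N × Vec m) 𝓘(ℝ, Vec N) π y (field y) = field₀ (π y)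

/-- The components `(ψ^i, ψ^σ)` of a vector field in a fibred chart, as functions of the
coordinates. -/
def ProjField.comp [IsManifold 𝓘(ℝ, Vec N) ∞ X] [IsManifold 𝓘(ℝ, Vec N × Vec m) ∞ Y]
    (ψ : ProjField (N := N) (m := m) π) (e : FibredChart (N := N) (m := m) π)
    (z : Vec N × Vec m) : Vec N × Vec m :=
  mfderiv 𝓘(ℝ, Vec N × Vec m) 𝓘(ℝ, Vec N × Vec m) e.chart (e.chart.symm z)
    (ψ.field (e.chart.symm z))

end Fibred

end JetVar

end

open scoped Manifold ContDiff Topology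

noncomputable section

namespace JetVar

variable {N m : ℕ}

/-! ### Multi-indices -/

/-! Everything is tested along sections. A horizontal form of top degree (a Lagrangian) is
determined by its coefficient, and every jet is the jet of a global polynomial section
(`exists_section`), so two Lagrangians agree once their coefficients agree along the prolongations
of all smooth sections (`Lag.eqOn_of_sec`). Along a prolonged section the formal derivative becomes
an ordinary partial derivative, also for forms evaluated on fields `jfield` (`formD_jfield`), and
the vertical part of a prolongation becomes the tuple of derivatives `∂_I χ` of the characteristic
`χ = ψ^σ - y^σ_j ψ^j` (`prolV_jetOf`). The theorem thus reduces to identities between functions on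
`ℝ^N`.

The first pillar is the first variation formula `L_{Jψ} λ = ψ_V ⌋ 𝓘 dλ + d_H ε_ψ(λ)`
(`sec_dH_noether`). With `L` the coefficient of `λ`, the Lie derivative has the coefficient `∑
(∂L/∂y_I) ∂_I χ + ∂_j(ψ^j L)` along a section (`Lag.sec_lie`). Integration by parts
(`sum_pd_mul_sum`) rewrites the first sum as `∑_K ∂_K(χ ζ^K)`. The summand `K = 0` is the
Euler–Lagrange term, and the others form the divergence of the momentum part of the current.

The second pillar is `𝓘 d hρ = 𝓘 dρ`, in the form `EL_extDeriv_p_zero`. The coefficients `Ψ_I` of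
the two sides differ by terms of the type `∂_i g_i^I + g_i^{I-i}`, and these telescope in the
alternating sum `∑ (-1)^{|I|} ∂_I Ψ_I`. Since the current is horizontal, `d_H ε = h d h ε`. Hence `𝓘
d d_H ε = 0` follows from `d² = 0` (`EL_dH_noether`).

The decomposition follows by induction on `l` (`sec_iterLie`). A term with `j < l` is already a
horizontal differential, so its Lie derivative is just `d_H ε` of it. The term `A_l` splits into
`d_H ε(A_l)` and `A_{l+1}`.

For the orders (`hasOrder_varTerm`), the Euler–Lagrange expressions of a Lagrangian of order `k`
have order `2k+1`, and contraction with `ψ_V` only involves the characteristic, of order `1`. A term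
`d_H ε(κ)` equals `L_{Jψ} κ - ψ_V ⌋ 𝓘 dκ`, so it has the same order bound although `ε` is written on
much higher jets. At the first step `𝓘 d hρ = 𝓘 dρ` gives `2r+1` instead of `2(r+1)+1`. -/

theorem len_add (I J : Fin N → ℕ) : len (I + J) = len I + len J :=
  Finset.sum_add_distrib

theorem len_ix (i : Fin N) : len (ix i) = 1 := by
  simp [len, ix]

theorem len_zero : len (0 : Fin N → ℕ) = 0 := by
  simp [len]

theorem len_add_ix (I : Fin N → ℕ) (i : Fin N) : len (I + ix i) = len I + 1 := by
  rw [len_add, len_ix]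

theorem count_toL (I : Fin N → ℕ) (i : Fin N) : (toL I).count i = I i := by
  have h : ∀ l : List (Fin N), l.Nodup →
      (l.flatMap fun j => List.replicate (I j) j).count i = if i ∈ l then I i else 0 := by
    intro l
    induction l with
    | nil => simp
    | cons a l ih =>
      intro hl
      rw [List.nodup_cons] at hl
      rw [List.flatMap_cons, List.count_append, ih hl.2, List.count_replicate]
      by_cases hai : a = i
      · subst hai
        simp [hl.1]
      · have : i ≠ a := fun h => hai h.symm
        simp [hai, this]
  rw [toL, h _ (List.nodup_finRange N)]
  simp

theorem ofL_toL (I : Fin N → ℕ) : ofL (toL I) = I := funext (count_toL I)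

theorem length_toL (I : Fin N → ℕ) : (toL I).length = len I := by
  simp [toL, len, List.length_flatMap, List.sum_ofFn, ← List.ofFn_eq_map]

theorem toL_zero : toL (0 : Fin N → ℕ) = [] := by
  rw [← List.length_eq_zero_iff, length_toL, len_zero]

theorem ofL_cons (i : Fin N) (L : List (Fin N)) : ofL (i :: L) = ofL L + ix i := by
  funext j
  rw [ofL, List.count_cons, Pi.add_apply, ix, Pi.single_apply]
  by_cases h : i = j
  · simp [h, ofL]
  · simp [h, Ne.symm h, ofL]

theorem len_ofL (L : List (Fin N)) : len (ofL L) = L.length := by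
  induction L with
  | nil => simp [ofL, len]
  | cons i L ih => rw [ofL_cons, len_add_ix, ih, List.length_cons]

theorem toL_ofL_perm (L : List (Fin N)) : (toL (ofL L)).Perm L :=
  List.perm_iff_count.2 fun i => by rw [count_toL]; rfl

/-- Only a permutation: `toL` lists its entries in nondecreasing order, so the new index need not
come first. Symmetry of mixed partial derivatives makes the difference harmless. -/
theorem toL_add_ix_perm (I : Fin N → ℕ) (i : Fin N) : (toL (I + ix i)).Perm (i :: toL I) := by
  have h := toL_ofL_perm (i :: toL I)
  rwa [ofL_cons, ofL_toL] at h

/-! ### Jet coordinates -/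

theorem crd_of_le {k : ℕ} {I : Fin N → ℕ} (h : len I ≤ k) (u : Jet N m k) :
    crd k I u = u.2 ⟨I, h⟩ := by
  rw [crd, dif_pos h]; rfl

theorem crd_of_lt {k : ℕ} {I : Fin N → ℕ} (h : k < len I) : crd (m := m) k I = 0 := by
  simp [crd, not_le.2 h]

@[simp]
theorem jproj_fst (k k' : ℕ) (u : Jet N m k) : (jproj k k' u).1 = u.1 := rfl

theorem crd_jproj {k k' : ℕ} {I : Fin N → ℕ} (h : len I ≤ k') (u : Jet N m k) :
    crd k' I (jproj k k' u) = crd k I u := by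
  rw [crd_of_le h]; rfl

theorem jproj_jproj {k k' k'' : ℕ} (h : k'' ≤ k') (u : Jet N m k) :
    jproj k' k'' (jproj k k' u) = jproj k k'' u :=
  Prod.ext rfl (funext fun I => crd_jproj (I.2.trans h) u)

@[simp]
theorem jproj_self (k : ℕ) (u : Jet N m k) : jproj k k u = u :=
  Prod.ext rfl (funext fun I => crd_of_le I.2 u)

@[simp]
theorem base_jproj (k k' : ℕ) (u : Jet N m k) : base (jproj k k' u) = base u :=
  Prod.ext rfl (crd_jproj (by simp [len_zero]) u)

theorem jproj_mem_jetsOver {W : Set (Vec N × Vec m)} {k k' : ℕ} {u : Jet N m k}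
    (hu : u ∈ jetsOver k W) : jproj k k' u ∈ jetsOver k' W := by
  change base (jproj k k' u) ∈ W
  rw [base_jproj]
  exact hu

theorem contDiff_base (k : ℕ) : ContDiff ℝ ∞ (base (N := N) (m := m) (k := k)) :=
  contDiff_fst.prodMk (crd k 0).contDiff

theorem isOpen_jetsOver {W : Set (Vec N × Vec m)} (hW : IsOpen W) (k : ℕ) :
    IsOpen (jetsOver k W) :=
  hW.preimage (contDiff_base k).continuous

theorem jetsOver_mem_nhds {W : Set (Vec N × Vec m)} (hW : IsOpen W) {k : ℕ} {u : Jet N m k}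
    (hu : u ∈ jetsOver k W) : jetsOver k W ∈ 𝓝 u :=
  (isOpen_jetsOver hW k).mem_nhds hu

theorem contDiff_formalD (k : ℕ) (i : Fin N) :
    ContDiff ℝ ∞ (formalD (m := m) k i) :=
  contDiff_const.prodMk (contDiff_pi.2 fun I => (crd (k + 1) (I.1 + ix i)).contDiff)

/-- The components of `formalD` are constants and linear coordinates, so its derivative is vertical
and the same at every point. Both facts are used later. -/
theorem fderiv_formalD (k : ℕ) (i : Fin N) (u v : Jet N m (k + 1)) :
    fderiv ℝ (formalD k i) u v = (0, fun I => crd (k + 1) (I.1 + ix i) v) := by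
  have h : HasFDerivAt (formalD (m := m) k i)
      ((0 : Jet N m (k + 1) →L[ℝ] Vec N).prod
        (ContinuousLinearMap.pi fun I : MI N k => crd (k + 1) (I.1 + ix i))) u := by
    refine (hasFDerivAt_const _ u).prodMk ?_
    exact hasFDerivAt_pi.2 fun I => (crd (k + 1) (I.1 + ix i)).hasFDerivAt
  rw [h.fderiv]
  rfl

@[simp]
theorem formalD_fst (k : ℕ) (i : Fin N) (u : Jet N m (k + 1)) :
    (formalD k i u).1 = Pi.single i 1 := rfl

theorem jproj_formalD {k k' : ℕ} (h : k' ≤ k) (i : Fin N) (u : Jet N m (k + 1)) :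
    jproj k k' (formalD k i u) = formalD k' i (jproj (k + 1) (k' + 1) u) := by
  refine Prod.ext rfl (funext fun I => ?_)
  have hI : len I.1 ≤ k := I.2.trans h
  change crd k I.1 (formalD k i u) = crd (k' + 1) (I.1 + ix i) (jproj (k + 1) (k' + 1) u)
  rw [crd_of_le hI, crd_jproj (by rw [len_add_ix]; exact Nat.succ_le_succ I.2)]
  rfl

theorem horL_apply {k : ℕ} (u v : Jet N m (k + 1)) :
    horL u v = ∑ i, v.1 i • formalD k i u := by
  simp [horL, sum_apply]

@[simp]
theorem horL_fst {k : ℕ} (u v : Jet N m (k + 1)) : (horL u v).1 = v.1 := by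
  rw [horL_apply, Prod.fst_sum]
  ext j
  simp [Finset.sum_apply, Pi.single_apply]

@[simp]
theorem conL_fst {k : ℕ} (u v : Jet N m (k + 1)) : (conL u v).1 = 0 := by
  simp [conL]

/-! ### Iterated partial derivatives -/

section Partial

variable {G : Type*} [NormedAddCommGroup G] [NormedSpace ℝ G]

/-- The partial derivative `∂_i f`. -/
def pder (i : Fin N) (f : Vec N → G) : Vec N → G := fun x => fderiv ℝ f x (Pi.single i 1)

/-- The iterated partial derivative `∂_{i₁} ⋯ ∂_{i_s} f`. -/
def pderL (L : List (Fin N)) (f : Vec N → G) : Vec N → G := L.foldr pder f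

/-- The iterated partial derivative `∂_I f`. -/
def pd (I : Fin N → ℕ) (f : Vec N → G) : Vec N → G := pderL (toL I) f

@[simp]
theorem pderL_nil (f : Vec N → G) : pderL [] f = f := rfl

@[simp]
theorem pderL_cons (i : Fin N) (L : List (Fin N)) (f : Vec N → G) :
    pderL (i :: L) f = pder i (pderL L f) := rfl

@[simp]
theorem pd_zero (f : Vec N → G) : pd 0 f = f := by
  rw [pd, toL_zero, pderL_nil]

variable {U : Set (Vec N)} {f g : Vec N → G}

theorem pder_eqOn (hU : IsOpen U) (h : Set.EqOn f g U) (i : Fin N) :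
    Set.EqOn (pder i f) (pder i g) U := fun x hx => by
  rw [pder, pder, (h.eventuallyEq_of_mem (hU.mem_nhds hx)).fderiv_eq]

theorem pderL_eqOn (hU : IsOpen U) (h : Set.EqOn f g U) (L : List (Fin N)) :
    Set.EqOn (pderL L f) (pderL L g) U := by
  induction L with
  | nil => exact h
  | cons i L ih => exact pder_eqOn hU ih i

theorem pd_eqOn (hU : IsOpen U) (h : Set.EqOn f g U) (I : Fin N → ℕ) :
    Set.EqOn (pd I f) (pd I g) U := pderL_eqOn hU h _

theorem contDiffOn_pder (hU : IsOpen U) (hf : ContDiffOn ℝ ∞ f U) (i : Fin N) :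
    ContDiffOn ℝ ∞ (pder i f) U :=
  (hf.fderiv_of_isOpen hU (by simp)).clm_apply contDiffOn_const

theorem contDiffOn_pderL (hU : IsOpen U) (hf : ContDiffOn ℝ ∞ f U) (L : List (Fin N)) :
    ContDiffOn ℝ ∞ (pderL L f) U := by
  induction L with
  | nil => exact hf
  | cons i L ih => exact contDiffOn_pder hU ih i

theorem contDiffOn_pd (hU : IsOpen U) (hf : ContDiffOn ℝ ∞ f U) (I : Fin N → ℕ) :
    ContDiffOn ℝ ∞ (pd I f) U := contDiffOn_pderL hU hf _

theorem contDiff_pd (hf : ContDiff ℝ ∞ f) (I : Fin N → ℕ) : ContDiff ℝ ∞ (pd I f) := by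
  rw [← contDiffOn_univ] at hf ⊢
  exact contDiffOn_pd isOpen_univ hf I

theorem differentiableAt_of_contDiffOn {E : Type*} [NormedAddCommGroup E] [NormedSpace ℝ E]
    {f : E → G} {U : Set E} (hU : IsOpen U) (hf : ContDiffOn ℝ ∞ f U)
    {x : E} (hx : x ∈ U) : DifferentiableAt ℝ f x :=
  (hf.contDiffAt (hU.mem_nhds hx)).differentiableAt (by simp)

theorem pder_comm (hU : IsOpen U) (hf : ContDiffOn ℝ ∞ f U) (i j : Fin N) :
    Set.EqOn (pder i (pder j f)) (pder j (pder i f)) U := fun x hx => by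
  have h2 : ContDiffAt ℝ ∞ f x := hf.contDiffAt (hU.mem_nhds hx)
  have hd : DifferentiableAt ℝ (fderiv ℝ f) x :=
    differentiableAt_of_contDiffOn hU (hf.fderiv_of_isOpen hU (by simp)) hx
  have key : ∀ a b : Fin N, pder a (pder b f) x
      = fderiv ℝ (fderiv ℝ f) x (Pi.single a 1) (Pi.single b 1) := by
    intro a b
    change fderiv ℝ (fun y => fderiv ℝ f y (Pi.single b 1)) x (Pi.single a 1) = _
    rw [fderiv_clm_apply hd (differentiableAt_const _)]
    simp
  rw [key, key]
  refine (h2.isSymmSndFDerivAt ?_).eq _ _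
  rw [minSmoothness_of_isRCLikeNormedField]
  exact WithTop.coe_le_coe.2 le_top

/-- Iterated partial derivatives of smooth functions depend only on the multi-index, by Schwarz's
theorem applied to adjacent transpositions. -/
theorem pderL_perm (hU : IsOpen U) (hf : ContDiffOn ℝ ∞ f U) {L L' : List (Fin N)}
    (h : L.Perm L') : Set.EqOn (pderL L f) (pderL L' f) U := by
  induction h with
  | nil => exact fun _ _ => rfl
  | cons i _ ih => exact pder_eqOn hU ih i
  | swap i j L => exact pder_comm hU (contDiffOn_pderL hU hf L) j i
  | trans _ _ ih ih' => exact ih.trans ih'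

theorem pd_add_ix (hU : IsOpen U) (hf : ContDiffOn ℝ ∞ f U) (I : Fin N → ℕ) (i : Fin N) :
    Set.EqOn (pd (I + ix i) f) (pder i (pd I f)) U :=
  pderL_perm hU hf (toL_add_ix_perm I i)

theorem pder_pd_comm (hU : IsOpen U) (hf : ContDiffOn ℝ ∞ f U) (I : Fin N → ℕ) (i : Fin N) :
    Set.EqOn (pder i (pd I f)) (pd I (pder i f)) U := by
  have h : ∀ L : List (Fin N), Set.EqOn (pder i (pderL L f)) (pderL L (pder i f)) U := by
    intro L
    induction L with
    | nil => exact fun _ _ => rfl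
    | cons j L ih =>
      exact (pder_comm hU (contDiffOn_pderL hU hf L) i j).trans (pder_eqOn hU ih j)
  exact h _

theorem pder_sum (hU : IsOpen U) {ι : Type*} (t : Finset ι) {F : ι → Vec N → G}
    (hF : ∀ a ∈ t, ContDiffOn ℝ ∞ (F a) U) (i : Fin N) :
    Set.EqOn (pder i (fun x => ∑ a ∈ t, F a x)) (fun x => ∑ a ∈ t, pder i (F a) x) U :=
  fun x hx => by
    change fderiv ℝ (fun x => ∑ a ∈ t, F a x) x _ = _
    rw [fderiv_fun_sum fun a ha => differentiableAt_of_contDiffOn hU (hF a ha) hx]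
    simp [pder]

theorem pderL_sum (hU : IsOpen U) {ι : Type*} (t : Finset ι) {F : ι → Vec N → G}
    (hF : ∀ a ∈ t, ContDiffOn ℝ ∞ (F a) U) (L : List (Fin N)) :
    Set.EqOn (pderL L (fun x => ∑ a ∈ t, F a x)) (fun x => ∑ a ∈ t, pderL L (F a) x) U := by
  induction L with
  | nil => exact fun _ _ => rfl
  | cons i L ih =>
    exact (pder_eqOn hU ih i).trans
      (pder_sum hU t (fun a ha => contDiffOn_pderL hU (hF a ha) L) i)

theorem pder_mul (hU : IsOpen U) {f g : Vec N → ℝ} (hf : ContDiffOn ℝ ∞ f U)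
    (hg : ContDiffOn ℝ ∞ g U) (i : Fin N) :
    Set.EqOn (pder i fun x => f x * g x) (fun x => f x * pder i g x + pder i f x * g x) U :=
  fun x hx => by
    change fderiv ℝ (fun x => f x * g x) x _ = _
    rw [fderiv_fun_mul (differentiableAt_of_contDiffOn hU hf hx)
      (differentiableAt_of_contDiffOn hU hg hx)]
    simp [pder, mul_comm]

theorem pder_clm_comp {G' : Type*} [NormedAddCommGroup G'] [NormedSpace ℝ G'] (A : G →L[ℝ] G')
    (hU : IsOpen U) (hf : ContDiffOn ℝ ∞ f U) (i : Fin N) :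
    Set.EqOn (pder i fun x => A (f x)) (fun x => A (pder i f x)) U := fun x hx => by
  change fderiv ℝ (A ∘ f) x _ = _
  rw [(A.hasFDerivAt.comp x (differentiableAt_of_contDiffOn hU hf hx).hasFDerivAt).fderiv]
  rfl

theorem pd_clm_comp {G' : Type*} [NormedAddCommGroup G'] [NormedSpace ℝ G'] (A : G →L[ℝ] G')
    (hU : IsOpen U) (hf : ContDiffOn ℝ ∞ f U) (I : Fin N → ℕ) :
    Set.EqOn (pd I fun x => A (f x)) (fun x => A (pd I f x)) U := by
  have h : ∀ L : List (Fin N), Set.EqOn (pderL L fun x => A (f x)) (fun x => A (pderL L f x)) U := by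
    intro L
    induction L with
    | nil => exact fun _ _ => rfl
    | cons j L ih =>
      exact (pder_eqOn hU ih j).trans (pder_clm_comp A hU (contDiffOn_pderL hU hf L) j)
  exact h _

end Partial

/-! ### Jets of sections -/

/-- The vector field `c^i ∂/∂x^i + ∂_I χ^σ ∂/∂y^σ_I` along a section of a jet space. -/
def jfield (k : ℕ) (c : Vec N) (χ : Vec N → Vec m) (x : Vec N) : Jet N m k :=
  (c, fun I => pd I.1 χ x)

@[simp]
theorem jfield_fst (k : ℕ) (c : Vec N) (χ : Vec N → Vec m) (x : Vec N) :
    (jfield k c χ x).1 = c := rfl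

theorem crd_jfield {k : ℕ} {I : Fin N → ℕ} (h : len I ≤ k) (c : Vec N) (χ : Vec N → Vec m)
    (x : Vec N) : crd k I (jfield k c χ x) = pd I χ x := by
  rw [crd_of_le h]; rfl

theorem jproj_jfield {k k' : ℕ} (h : k' ≤ k) (c : Vec N) (χ : Vec N → Vec m) (x : Vec N) :
    jproj k k' (jfield k c χ x) = jfield k' c χ x :=
  Prod.ext rfl (funext fun I => crd_jfield (I.2.trans h) c χ x)

theorem crd_jetOf {k : ℕ} {I : Fin N → ℕ} (h : len I ≤ k) (s : Vec N → Vec m) (x : Vec N) :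
    crd k I (jetOf k s x) = pd I s x := crd_jfield h x s x

theorem jproj_jetOf {k k' : ℕ} (h : k' ≤ k) (s : Vec N → Vec m) (x : Vec N) :
    jproj k k' (jetOf k s x) = jetOf k' s x := jproj_jfield h x s x

@[simp]
theorem base_jetOf (k : ℕ) (s : Vec N → Vec m) (x : Vec N) : base (jetOf k s x) = (x, s x) :=
  Prod.ext rfl (by
    change crd k 0 (jetOf k s x) = s x
    rw [crd_jetOf (by simp [len_zero]), pd_zero])

theorem jetOf_mem {W : Set (Vec N × Vec m)} {k : ℕ} {s : Vec N → Vec m} {x : Vec N} :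
    jetOf k s x ∈ jetsOver k W ↔ (x, s x) ∈ W := by
  rw [jetsOver, Set.mem_ofPred_eq, base_jetOf]

theorem contDiff_jetOf (k : ℕ) {s : Vec N → Vec m} (hs : ContDiff ℝ ∞ s) :
    ContDiff ℝ ∞ (jetOf k s) :=
  contDiff_id.prodMk (contDiff_pi.2 fun I => contDiff_pd hs I.1)

theorem contDiffOn_jfield (k : ℕ) {U : Set (Vec N)} (hU : IsOpen U) (c : Vec N)
    {χ : Vec N → Vec m} (hχ : ContDiffOn ℝ ∞ χ U) : ContDiffOn ℝ ∞ (jfield k c χ) U :=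
  contDiffOn_const.prodMk (contDiffOn_pi.2 fun I => contDiffOn_pd hU hχ I.1)

theorem pder_jfield (k : ℕ) {U : Set (Vec N)} (hU : IsOpen U) (c : Vec N)
    {χ : Vec N → Vec m} (hχ : ContDiffOn ℝ ∞ χ U) (i : Fin N) {x : Vec N} (hx : x ∈ U) :
    pder i (jfield k c χ) x = (0, fun I => pd (I.1 + ix i) χ x) := by
  have h : HasFDerivAt (jfield k c χ) ((0 : Vec N →L[ℝ] Vec N).prod
      (ContinuousLinearMap.pi fun I : MI N k => fderiv ℝ (pd I.1 χ) x)) x :=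
    (hasFDerivAt_const _ x).prodMk (hasFDerivAt_pi.2 fun I =>
      (differentiableAt_of_contDiffOn hU (contDiffOn_pd hU hχ I.1) hx).hasFDerivAt)
  rw [pder, h.fderiv]
  refine Prod.ext rfl (funext fun I => ?_)
  exact (pd_add_ix hU hχ I.1 i hx).symm

/-- Differentiating `formalD` in the direction of `jfield` shifts `∂_I χ` to `∂_{I+i} χ`, and so
does differentiating the field along the base, because its base component `c` is constant. This
matches the correction terms of `lie` with those of the Leibniz rule. -/
theorem fderiv_formalD_jfield (k : ℕ) {U : Set (Vec N)} (hU : IsOpen U) (c : Vec N)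
    {χ : Vec N → Vec m} (hχ : ContDiffOn ℝ ∞ χ U) (i : Fin N) {x : Vec N} (hx : x ∈ U)
    (u : Jet N m (k + 1)) :
    fderiv ℝ (formalD k i) u (jfield (k + 1) c χ x) = pder i (jfield k c χ) x := by
  rw [fderiv_formalD, pder_jfield k hU c hχ i hx]
  refine Prod.ext rfl (funext fun I => ?_)
  exact crd_jfield (by rw [len_add_ix]; exact Nat.succ_le_succ I.2) c χ x

/-- Total derivative vectors along a section are themselves of the type `jfield`, with variation
`∂_i s`, so horizontal and vertical arguments can be treated alike. -/
theorem formalD_jetOf (k : ℕ) {s : Vec N → Vec m} (hs : ContDiff ℝ ∞ s) (i : Fin N) (x : Vec N) :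
    formalD k i (jetOf (k + 1) s x) = jfield k (Pi.single i 1) (pder i s) x := by
  refine Prod.ext rfl (funext fun I => ?_)
  change crd (k + 1) (I.1 + ix i) (jetOf (k + 1) s x) = pd I.1 (pder i s) x
  rw [crd_jetOf (by rw [len_add_ix]; exact Nat.succ_le_succ I.2),
    pd_add_ix isOpen_univ hs.contDiffOn I.1 i (Set.mem_univ x),
    pder_pd_comm isOpen_univ hs.contDiffOn I.1 i (Set.mem_univ x)]

/-- The vector `d_i` is tangent to the prolonged section. By the chain rule, total derivatives of
functions then become partial derivatives along it. -/
theorem pder_jetOf (k : ℕ) {s : Vec N → Vec m} (hs : ContDiff ℝ ∞ s) (i : Fin N) (x : Vec N) :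
    pder i (jetOf k s) x = formalD k i (jetOf (k + 1) s x) := by
  have h : HasFDerivAt (jetOf k s) ((ContinuousLinearMap.id ℝ (Vec N)).prod
      (ContinuousLinearMap.pi fun I : MI N k => fderiv ℝ (pd I.1 s) x)) x :=
    (hasFDerivAt_id x).prodMk (hasFDerivAt_pi.2 fun I =>
      ((contDiff_pd hs I.1).differentiable (by simp) x).hasFDerivAt)
  rw [pder, h.fderiv]
  refine Prod.ext rfl (funext fun I => ?_)
  change pder i (pd I.1 s) x = crd (k + 1) (I.1 + ix i) (jetOf (k + 1) s x)
  rw [crd_jetOf (by rw [len_add_ix]; exact Nat.succ_le_succ I.2),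
    pd_add_ix isOpen_univ hs.contDiffOn I.1 i (Set.mem_univ x)]

theorem jfield_sum (k : ℕ) {s : Vec N → Vec m} (hs : ContDiff ℝ ∞ s) (c : Vec N) (x : Vec N) :
    ∑ i, c i • jfield k (Pi.single i 1) (pder i s) x
      = jfield k c (fun z => ∑ i, c i • pder i s z) x := by
  refine Prod.ext ?_ (funext fun I => ?_)
  · rw [Prod.fst_sum]
    ext j
    simp [Finset.sum_apply, Pi.single_apply]
  · have h1 : ∀ i, ContDiffOn ℝ ∞ (pder i s) Set.univ := fun i =>
      contDiffOn_pder isOpen_univ hs.contDiffOn i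
    have h := pderL_sum isOpen_univ Finset.univ (F := fun i z => c i • pder i s z)
      (fun i _ => (h1 i).const_smul (c i)) (toL I.1) (Set.mem_univ x)
    change _ = pd I.1 (fun z => ∑ i, c i • pder i s z) x
    rw [pd, h, Prod.snd_sum, Finset.sum_apply]
    refine Finset.sum_congr rfl fun i _ => ?_
    exact (pd_clm_comp (c i • ContinuousLinearMap.id ℝ (Vec m)) isOpen_univ (h1 i) I.1
      (Set.mem_univ x)).symm

/-- The monomial `(z - a)^J / J!`. -/
def taylorMon (a : Vec N) (J : Fin N → ℕ) (z : Vec N) : ℝ :=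
  ∏ i, (z i - a i) ^ J i / (Nat.factorial (J i) : ℝ)

theorem contDiff_taylorMon (a : Vec N) (J : Fin N → ℕ) : ContDiff ℝ ∞ (taylorMon a J) :=
  contDiff_prod fun i _ => (((contDiff_apply ℝ ℝ i).sub contDiff_const).pow _).div_const _

theorem taylorMon_self (a : Vec N) (J : Fin N → ℕ) :
    taylorMon a J a = if J = 0 then 1 else 0 := by
  split_ifs with h
  · simp [taylorMon, h]
  · obtain ⟨i, hi⟩ := Function.ne_iff.1 h
    exact Finset.prod_eq_zero (Finset.mem_univ i) (by simp [zero_pow hi])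

theorem pder_taylorMon (a : Vec N) (J : Fin N → ℕ) (i : Fin N) :
    pder i (taylorMon a J) = if J i = 0 then 0 else taylorMon a (J - ix i) := by
  funext z
  have hd : DifferentiableAt ℝ (taylorMon a J) z :=
    (contDiff_taylorMon a J).differentiable (by simp) z
  -- Along the line in direction `i` only the `i`-th factor varies, so this is a derivative in one
  -- real variable.
  rw [pder, ← hd.lineDeriv_eq_fderiv, lineDeriv]
  set C : ℝ := ∏ j ∈ Finset.univ.erase i, (z j - a j) ^ J j / (Nat.factorial (J j) : ℝ) with hC
  have h : (fun t : ℝ => taylorMon a J (z + t • Pi.single i 1))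
      = fun t => ((t + (z i - a i)) ^ J i / (Nat.factorial (J i) : ℝ)) * C := by
    funext t
    rw [taylorMon, ← Finset.mul_prod_erase _ _ (Finset.mem_univ i), hC]
    congr 1
    · simp only [Pi.add_apply, Pi.smul_apply, Pi.single_eq_same, smul_eq_mul, mul_one]
      congr 2
      ring
    · refine Finset.prod_congr rfl fun j hj => ?_
      simp [Pi.single_eq_of_ne (Finset.ne_of_mem_erase hj)]
  have hder : HasDerivAt (fun t : ℝ => ((t + (z i - a i)) ^ J i / (Nat.factorial (J i) : ℝ)) * C)
      (((J i : ℝ) * (0 + (z i - a i)) ^ (J i - 1) * 1 / (Nat.factorial (J i) : ℝ)) * C) 0 :=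
    ((((hasDerivAt_id (0 : ℝ)).add_const (z i - a i)).pow (J i)).div_const _).mul_const C
  rw [h, hder.deriv]
  by_cases h0 : J i = 0
  · simp [h0]
  · rw [if_neg h0, taylorMon, ← Finset.mul_prod_erase _ _ (Finset.mem_univ i), hC]
    congr 1
    · obtain ⟨q, hq⟩ := Nat.exists_eq_succ_of_ne_zero h0
      have hq' : (J - ix i) i = q := by simp [ix, hq]
      rw [hq', hq, Nat.factorial_succ]
      have : (Nat.factorial q : ℝ) ≠ 0 := by exact_mod_cast Nat.factorial_ne_zero q
      push_cast
      have h2 : (q : ℝ) + 1 ≠ 0 := by positivity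
      simp only [zero_add, mul_one]
      field_simp
    · refine Finset.prod_congr rfl fun j hj => ?_
      have : (J - ix i) j = J j := by simp [ix, Pi.single_eq_of_ne (Finset.ne_of_mem_erase hj)]
      rw [this]

open Classical in
theorem pderL_taylorMon (a : Vec N) (J : Fin N → ℕ) (L : List (Fin N)) :
    pderL L (taylorMon a J) = if ofL L ≤ J then taylorMon a (J - ofL L) else 0 := by
  induction L with
  | nil =>
    have h : ofL ([] : List (Fin N)) = 0 := by funext i; simp [ofL]
    simp [h]
  | cons i L ih =>
    rw [pderL_cons, ih, ofL_cons]
    by_cases h : ofL L ≤ J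
    · rw [if_pos h, pder_taylorMon]
      have hi := h i
      by_cases h0 : (J - ofL L) i = 0
      · rw [if_pos h0, if_neg]
        intro h'
        have := h' i
        simp [ix] at this h0
        omega
      · rw [if_neg h0, if_pos, tsub_tsub]
        intro j
        have hj := h j
        rw [Pi.add_apply, ix, Pi.single_apply]
        rw [Pi.sub_apply] at h0
        split_ifs with hji
        · subst hji
          have : 1 ≤ J j - ofL L j := Nat.one_le_iff_ne_zero.2 h0
          change ofL L j + 1 ≤ J j
          omega
        · exact hj
    · rw [if_neg h, if_neg]
      · funext x
        change fderiv ℝ (fun _ => (0 : ℝ)) x _ = 0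
        simp
      · exact fun h' => h (le_trans (fun j => Nat.le_add_right _ _) h')

/-- The section is the Taylor polynomial with the prescribed derivatives. Being defined on all of
`ℝ^N`, it needs no shrinking of domains; only its values near the base point have to lie over `W`.
-/
theorem exists_section {k : ℕ} (u : Jet N m k) :
    ∃ s : Vec N → Vec m, ContDiff ℝ ∞ s ∧ jetOf k s u.1 = u := by
  have hs : ∀ J : MI N k, ContDiff ℝ ∞ fun z => taylorMon u.1 J.1 z • u.2 J := fun J =>
    (contDiff_taylorMon u.1 J.1).smul contDiff_const
  refine ⟨fun z => ∑ J : MI N k, taylorMon u.1 J.1 z • u.2 J,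
    ContDiff.sum fun J _ => hs J, Prod.ext rfl (funext fun I => ?_)⟩
  change pderL (toL I.1) _ u.1 = _
  rw [pderL_sum isOpen_univ _ (fun J _ => (hs J).contDiffOn) _ (Set.mem_univ _)]
  -- At the centre, `∂_I` of the monomial `(z - a)^J / J!` is `1` for `I = J` and `0` otherwise.
  have key : ∀ J : MI N k, pderL (toL I.1) (fun z => taylorMon u.1 J.1 z • u.2 J) u.1
      = if J = I then u.2 J else 0 := by
    intro J
    have h := pd_clm_comp ((ContinuousLinearMap.id ℝ ℝ).smulRight (u.2 J)) isOpen_univ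
      (contDiff_taylorMon u.1 J.1).contDiffOn I.1 (Set.mem_univ u.1)
    change pderL (toL I.1) (fun z => taylorMon u.1 J.1 z • u.2 J) u.1
      = pderL (toL I.1) (taylorMon u.1 J.1) u.1 • u.2 J at h
    rw [h, pderL_taylorMon, ofL_toL]
    by_cases hJ : J = I
    · subst hJ
      simp [taylorMon_self]
    · rw [if_neg hJ]
      split_ifs with hle
      · rw [taylorMon_self, if_neg, zero_smul]
        intro h0
        exact hJ (Subtype.ext (le_antisymm (tsub_eq_zero_iff_le.1 h0) hle))
      · simp
  simp only [key]
  simp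

/-! ### Alternating forms -/

section Alternating

variable {E E' F G : Type*} [NormedAddCommGroup E] [NormedSpace ℝ E] [NormedAddCommGroup E']
  [NormedSpace ℝ E'] [NormedAddCommGroup F] [NormedSpace ℝ F]

theorem mix_apply {q : ℕ} (l : ℕ) (A B : E' →L[ℝ] E) (η : E [⋀^Fin q]→L[ℝ] ℝ)
    (v : Fin q → E') :
    mix l A B η v = ∑ S ∈ (Finset.univ : Finset (Fin q)).powersetCard l,
      η fun a => (if a ∈ S then A else B) (v a) := by
  change (∑ S ∈ (Finset.univ : Finset (Fin q)).powersetCard l,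
      η.toContinuousMultilinearMap.compContinuousLinearMap
        (fun i => if i ∈ S then A else B)) v = _
  rw [sum_apply]
  rfl

theorem mix_zero_apply {q : ℕ} (A B : E' →L[ℝ] E) (η : E [⋀^Fin q]→L[ℝ] ℝ) (v : Fin q → E') :
    mix 0 A B η v = η fun a => B (v a) := by
  simp [mix_apply]

theorem mix_one_apply {q : ℕ} (A B : E' →L[ℝ] E) (η : E [⋀^Fin q]→L[ℝ] ℝ) (v : Fin q → E') :
    mix 1 A B η v = ∑ a, η (Function.update (fun b => B (v b)) a (A (v a))) := by
  rw [mix_apply, Finset.powersetCard_one, Finset.sum_map]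
  refine Finset.sum_congr rfl fun a _ => congrArg η (funext fun b => ?_)
  by_cases h : b = a
  · subst h; simp
  · simp [h]

/-- A map into a space of alternating forms on a finite-dimensional space is smooth as soon as its
values on all tuples of vectors are. -/
theorem contDiffOn_alternating [FiniteDimensional ℝ F] {q : ℕ} {S : Set E}
    {f : E → F [⋀^Fin q]→L[ℝ] ℝ} (h : ∀ v, ContDiffOn ℝ ∞ (fun x => f x v) S) :
    ContDiffOn ℝ ∞ f S := by
  let b := Module.finBasis ℝ F
  -- Evaluation on tuples of basis vectors is linear and injective into a finite-dimensional space;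
  -- a linear left inverse recovers `f` smoothly from its values.
  let T : (F [⋀^Fin q]→L[ℝ] ℝ) →ₗ[ℝ] ((Fin q → Fin (Module.finrank ℝ F)) → ℝ) :=
    { toFun := fun η w => η fun a => b (w a)
      map_add' := fun _ _ => rfl
      map_smul' := fun _ _ => rfl }
  have hT : LinearMap.ker T = ⊥ := by
    rw [LinearMap.ker_eq_bot]
    intro η η' hη
    apply ContinuousAlternatingMap.toAlternatingMap_injective
    exact b.ext_alternating fun w _ => congrFun hη w
  obtain ⟨R, hR⟩ := T.exists_leftInverse_of_injective hT
  have hf : f = fun x => R.toContinuousLinearMap (T (f x)) := by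
    funext x
    exact (LinearMap.congr_fun hR (f x)).symm
  rw [hf]
  exact R.toContinuousLinearMap.contDiff.comp_contDiffOn
    (contDiffOn_pi.2 fun w => h fun a => b (w a))

/-- Expanding the arguments in a basis turns the value into a polynomial in their coordinates, with
values of `f` on fixed tuples as coefficients. -/
theorem contDiffOn_alternating_apply [FiniteDimensional ℝ F] {q : ℕ} {S : Set E}
    {f : E → F [⋀^Fin q]→L[ℝ] ℝ} {w : E → Fin q → F} (hf : ContDiffOn ℝ ∞ f S)
    (hw : ∀ a, ContDiffOn ℝ ∞ (fun x => w x a) S) : ContDiffOn ℝ ∞ (fun x => f x (w x)) S := by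
  let b := Module.finBasis ℝ F
  have h : ∀ x, f x (w x) = ∑ r : Fin q → Fin (Module.finrank ℝ F),
      (∏ a, b.repr (w x a) (r a)) * f x (fun a => b (r a)) := by
    intro x
    have h1 : w x = fun a => ∑ i, b.repr (w x a) i • b i :=
      funext fun a => (b.sum_repr (w x a)).symm
    conv_lhs => rw [h1]
    change (f x).toMultilinearMap _ = _
    rw [MultilinearMap.map_sum]
    refine Finset.sum_congr rfl fun r _ => ?_
    rw [MultilinearMap.map_smul_univ]
    rfl
  simp only [h]
  refine ContDiffOn.sum fun r _ => ContDiffOn.mul (contDiffOn_prod fun a _ => ?_) ?_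
  · exact (LinearMap.toContinuousLinearMap
      (b.coord (r a))).contDiff.comp_contDiffOn (hw a)
  · have : ContDiffOn ℝ ∞ (fun x => ContinuousAlternatingMap.apply ℝ F ℝ (fun a => b (r a)) (f x)) S :=
      (ContinuousLinearMap.contDiff _).comp_contDiffOn hf
    exact this

/-- The standard volume form on `ℝ^N`. -/
def vol (N : ℕ) : Vec N [⋀^Fin N]→L[ℝ] ℝ :=
  { (Matrix.detRowAlternating : Vec N [⋀^Fin N]→ₗ[ℝ] ℝ) with
    cont := by
      change Continuous fun v : Fin N → Vec N => Matrix.det (Matrix.of v)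
      exact Continuous.matrix_det continuous_id }

theorem vol_apply (v : Fin N → Vec N) : vol N v = Matrix.det (Matrix.of v) := rfl

/-- The standard basis of `ℝ^N`. -/
def stdVec (N : ℕ) (i : Fin N) : Vec N := Pi.single i 1

theorem vol_stdVec : vol N (stdVec N) = 1 := by
  rw [vol_apply]
  have : Matrix.of (stdVec N) = (1 : Matrix (Fin N) (Fin N) ℝ) := by
    ext i j
    simp [stdVec, Matrix.one_apply, Pi.single_apply, eq_comm]
  rw [this, Matrix.det_one]

/-- It suffices to compare both sides on injective tuples of basis vectors. These are permutations
of the standard basis, on which both sides change by the same sign. -/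
theorem alternating_eq_vol (η : Vec N [⋀^Fin N]→L[ℝ] ℝ) : η = η (stdVec N) • vol N := by
  apply ContinuousAlternatingMap.toAlternatingMap_injective
  refine (Pi.basisFun ℝ (Fin N)).ext_alternating fun w hw => ?_
  let e : Equiv.Perm (Fin N) := Equiv.ofBijective w (Finite.injective_iff_bijective.1 hw)
  have h : (fun i => (Pi.basisFun ℝ (Fin N)) (w i)) = stdVec N ∘ e := by
    funext i
    simp [stdVec, e]
  rw [h]
  have h1 := η.toAlternatingMap.map_perm (stdVec N) e
  have h2 := (vol N).toAlternatingMap.map_perm (stdVec N) e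
  rw [h1]
  change _ = η (stdVec N) • (vol N).toAlternatingMap (stdVec N ∘ e)
  rw [h2]
  change Equiv.Perm.sign e • η (stdVec N) = η (stdVec N) • (Equiv.Perm.sign e • vol N (stdVec N))
  rw [vol_stdVec, smul_comm]
  simp

theorem vol_update_stdVec (a : Fin N) (w : Vec N) :
    vol N (Function.update (stdVec N) a w) = w a := by
  have hw : w = ∑ i, w i • stdVec N i := by
    ext j
    simp [stdVec, Finset.sum_apply, Pi.single_apply]
  have h1 : vol N (Function.update (stdVec N) a w)
      = ∑ i, w i • vol N (Function.update (stdVec N) a (stdVec N i)) := by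
    conv_lhs => rw [hw]
    change (vol N).toMultilinearMap _ = _
    rw [MultilinearMap.map_update_sum]
    refine Finset.sum_congr rfl fun i _ => ?_
    rw [MultilinearMap.map_update_smul]
    rfl
  rw [h1, Finset.sum_eq_single a]
  · rw [Function.update_eq_self, vol_stdVec, smul_eq_mul, mul_one]
  · intro i _ hia
    rw [(vol N).map_eq_zero_of_eq _ (i := i) (j := a) ?_ hia, smul_zero]
    simp [hia]
  · simp

theorem vol_cons_removeNth {n : ℕ} (i : Fin (n + 1)) :
    vol (n + 1) (Fin.cons (stdVec (n + 1) i) (i.removeNth (stdVec (n + 1)))) = (-1) ^ (i : ℕ) := by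
  have h := (vol (n + 1)).neg_one_pow_smul_map_insertNth i (stdVec (n + 1) i)
    (i.removeNth (stdVec (n + 1)))
  rw [Fin.insertNth_self_removeNth, vol_stdVec] at h
  change _ = vol (n + 1) (Fin.cons (stdVec (n + 1) i) (i.removeNth (stdVec (n + 1)))) at h
  rw [← h]
  simp

theorem vol_cons_removeNth_of_ne {n : ℕ} {i j : Fin (n + 1)} (h : i ≠ j) :
    vol (n + 1) (Fin.cons (stdVec (n + 1) j) (i.removeNth (stdVec (n + 1)))) = 0 := by
  obtain ⟨a, ha⟩ := Fin.exists_succAbove_eq h.symm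
  refine (vol (n + 1)).map_eq_zero_of_eq _ (i := 0) (j := a.succ) ?_ (Fin.succ_ne_zero a).symm
  simp [Fin.removeNth, ha]

end Alternating

/-! ### Values of the operators on forms -/

section Values

variable {k k' q : ℕ}

theorem pull_apply (η : Form N m k q) (u : Jet N m k') (v : Fin q → Jet N m k') :
    pull k' η u v = η (jproj k' k u) fun a => jproj k' k (v a) := rfl

theorem p_apply (l : ℕ) (η : Form N m k q) (u : Jet N m (k + 1)) (v : Fin q → Jet N m (k + 1)) :
    p l η u v = ∑ S ∈ (Finset.univ : Finset (Fin q)).powersetCard l,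
      η (jproj (k + 1) k u) fun a => (if a ∈ S then conL u else horL u) (v a) :=
  mix_apply _ _ _ _ _

theorem p_zero_apply (η : Form N m k q) (u : Jet N m (k + 1)) (v : Fin q → Jet N m (k + 1)) :
    p 0 η u v = η (jproj (k + 1) k u) fun a => horL u (v a) :=
  mix_zero_apply _ _ _ _

theorem p_one_apply (η : Form N m k q) (u : Jet N m (k + 1)) (v : Fin q → Jet N m (k + 1)) :
    p 1 η u v = ∑ a, η (jproj (k + 1) k u)
      (Function.update (fun b => horL u (v b)) a (conL u (v a))) :=
  mix_one_apply _ _ _ _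

theorem contr_apply (ξ : Jet N m k' → Jet N m k) (η : Form N m k (q + 1)) (u : Jet N m k')
    (v : Fin q → Jet N m k') :
    contr ξ η u v = η (jproj k' k u) (Fin.cons (ξ u) fun a => jproj k' k (v a)) := rfl

theorem lie_apply (ξ : Jet N m k' → Jet N m k) (η : Form N m k q) (u : Jet N m k')
    (v : Fin q → Jet N m k') :
    lie ξ η u v = fderiv ℝ η (jproj k' k u) (ξ u) (fun a => jproj k' k (v a))
      + ∑ a, η (jproj k' k u)
        (Function.update (fun b => jproj k' k (v b)) a (fderiv ℝ ξ u (v a))) := by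
  rw [← mix_one_apply]
  rfl

theorem wedge_apply (α : Jet N m k → Jet N m k →L[ℝ] ℝ) (β : Form N m k q) (u : Jet N m k)
    (v : Fin (q + 1) → Jet N m k) :
    wedge α β u v = ∑ i : Fin (q + 1), (-1) ^ (i : ℕ) * (α u (v i) * β u (i.removeNth v)) := by
  rw [wedge, ContinuousAlternatingMap.alternatizeUncurryFin_apply]
  refine Finset.sum_congr rfl fun i _ => ?_
  simp

theorem extDeriv_apply' (η : Form N m k q) (u : Jet N m k) (v : Fin (q + 1) → Jet N m k) :
    extDeriv η u v = ∑ i : Fin (q + 1), (-1) ^ (i : ℕ) * fderiv ℝ η u (v i) (i.removeNth v) := by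
  rw [extDeriv, ContinuousAlternatingMap.alternatizeUncurryFin_apply]
  refine Finset.sum_congr rfl fun i _ => ?_
  simp

end Values

/-! ### Smoothness of the operators on forms -/

section Smooth

variable {W : Set (Vec N × Vec m)} {k k' q : ℕ}

theorem contDiffOn_comp_jproj {G : Type*} [NormedAddCommGroup G] [NormedSpace ℝ G]
    {f : Jet N m k → G} (hf : ContDiffOn ℝ ∞ f (jetsOver k W)) (k' : ℕ) :
    ContDiffOn ℝ ∞ (fun u => f (jproj k' k u)) (jetsOver k' W) :=
  hf.comp (jproj k' k).contDiff.contDiffOn fun _ hu => jproj_mem_jetsOver hu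

theorem contDiff_horL_apply (k : ℕ) (v : Jet N m (k + 1)) :
    ContDiff ℝ ∞ fun u : Jet N m (k + 1) => horL u v := by
  simp only [horL_apply]
  exact ContDiff.sum fun i _ => (contDiff_formalD k i).const_smul (v.1 i)

theorem contDiff_conL_apply (k : ℕ) (v : Jet N m (k + 1)) :
    ContDiff ℝ ∞ fun u : Jet N m (k + 1) => conL u v :=
  contDiff_const.sub (contDiff_horL_apply k v)

theorem SmoothOver.pull {η : Form N m k q} (hη : SmoothOver W η) (k' : ℕ) :
    SmoothOver W (pull k' η) := by
  refine contDiffOn_alternating fun v => ?_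
  simp only [pull_apply]
  exact contDiffOn_alternating_apply (contDiffOn_comp_jproj hη k') fun _ => contDiffOn_const

theorem SmoothOver.p {η : Form N m k q} (hη : SmoothOver W η) (l : ℕ) :
    SmoothOver W (p l η) := by
  refine contDiffOn_alternating fun v => ?_
  simp only [p_apply]
  refine ContDiffOn.sum fun S _ => contDiffOn_alternating_apply
    (contDiffOn_comp_jproj hη (k + 1)) fun a => ?_
  split_ifs
  · exact (contDiff_conL_apply k (v a)).contDiffOn
  · exact (contDiff_horL_apply k (v a)).contDiffOn

theorem SmoothOver.contr {η : Form N m k (q + 1)} (hη : SmoothOver W η)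
    {ξ : Jet N m k' → Jet N m k} (hξ : ContDiffOn ℝ ∞ ξ (jetsOver k' W)) :
    SmoothOver W (contr ξ η) := by
  refine contDiffOn_alternating fun v => ?_
  simp only [contr_apply]
  refine contDiffOn_alternating_apply (contDiffOn_comp_jproj hη k') fun a => ?_
  refine Fin.cases ?_ (fun b => ?_) a
  · exact hξ
  · exact contDiffOn_const

theorem contDiffOn_fderiv_comp_jproj (hW : IsOpen W) {G : Type*} [NormedAddCommGroup G]
    [NormedSpace ℝ G] {f : Jet N m k → G} (hf : ContDiffOn ℝ ∞ f (jetsOver k W))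
    {ξ : Jet N m k' → Jet N m k} (hξ : ContDiffOn ℝ ∞ ξ (jetsOver k' W)) :
    ContDiffOn ℝ ∞ (fun u => fderiv ℝ f (jproj k' k u) (ξ u)) (jetsOver k' W) :=
  (contDiffOn_comp_jproj (hf.fderiv_of_isOpen (isOpen_jetsOver hW k) (by simp)) k').clm_apply hξ

theorem SmoothOver.lie (hW : IsOpen W) {η : Form N m k q} (hη : SmoothOver W η)
    {ξ : Jet N m k' → Jet N m k} (hξ : ContDiffOn ℝ ∞ ξ (jetsOver k' W)) :
    SmoothOver W (lie ξ η) := by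
  refine contDiffOn_alternating fun v => ?_
  simp only [lie_apply]
  have h : ContDiffOn ℝ ∞ (fun u => fderiv ℝ η (jproj k' k u) (ξ u) fun a => jproj k' k (v a))
      (jetsOver k' W) :=
    contDiffOn_alternating_apply (contDiffOn_fderiv_comp_jproj hW hη hξ) fun _ => contDiffOn_const
  refine h.add (ContDiffOn.sum fun a _ => ?_)
  refine contDiffOn_alternating_apply (contDiffOn_comp_jproj hη k') fun b => ?_
  by_cases h : b = a
  · subst h
    simp only [Function.update_self]
    exact (hξ.fderiv_of_isOpen (isOpen_jetsOver hW k') (by simp)).clm_apply contDiffOn_const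
  · simp only [Function.update_of_ne h]
    exact contDiffOn_const

theorem SmoothOver.formD (hW : IsOpen W) {η : Form N m k q} (hη : SmoothOver W η) (i : Fin N) :
    SmoothOver W (formD i η) :=
  hη.lie hW (contDiff_formalD k i).contDiffOn

theorem SmoothOver.formDL (hW : IsOpen W) {η : Form N m k q} (hη : SmoothOver W η) :
    ∀ L : List (Fin N), SmoothOver W (formDL L η)
  | [] => hη
  | i :: L => (SmoothOver.formDL hW hη L).formD hW i

theorem SmoothOver.dI (hW : IsOpen W) {η : Form N m k q} (hη : SmoothOver W η) (k' : ℕ)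
    (I : Fin N → ℕ) : SmoothOver W (dI k' I η) :=
  (hη.formDL hW (toL I)).pull k'

theorem SmoothOver.extDeriv (hW : IsOpen W) {η : Form N m k q} (hη : SmoothOver W η) :
    SmoothOver W (extDeriv η) := by
  refine contDiffOn_alternating fun v => ?_
  simp only [extDeriv_apply']
  have h1 : ContDiffOn ℝ ∞ (fderiv ℝ η) (jetsOver k W) :=
    ContDiffOn.fderiv_of_isOpen hη (isOpen_jetsOver hW k) (by simp)
  exact ContDiffOn.sum fun i _ => contDiffOn_const.mul
    (contDiffOn_alternating_apply (h1.clm_apply contDiffOn_const) fun _ => contDiffOn_const)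

theorem SmoothOver.wedge {β : Form N m k q} (hβ : SmoothOver W β)
    {α : Jet N m k → Jet N m k →L[ℝ] ℝ}
    (hα : ∀ v, ContDiffOn ℝ ∞ (fun u => α u v) (jetsOver k W)) : SmoothOver W (wedge α β) := by
  refine contDiffOn_alternating fun v => ?_
  simp only [wedge_apply]
  exact ContDiffOn.sum fun i _ => contDiffOn_const.mul ((hα _).mul
    (contDiffOn_alternating_apply hβ fun _ => contDiffOn_const))

theorem SmoothOver.add {η η' : Form N m k q} (hη : SmoothOver W η) (hη' : SmoothOver W η') :
    SmoothOver W (η + η') :=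
  ContDiffOn.add hη hη'

theorem SmoothOver.neg {η : Form N m k q} (hη : SmoothOver W η) : SmoothOver W (-η) :=
  ContDiffOn.neg hη

theorem SmoothOver.const_smul {η : Form N m k q} (hη : SmoothOver W η) (c : ℝ) :
    SmoothOver W (c • η) :=
  ContDiffOn.const_smul c hη

theorem SmoothOver.sum {ι : Type*} {t : Finset ι} {η : ι → Form N m k q}
    (hη : ∀ a ∈ t, SmoothOver W (η a)) : SmoothOver W (∑ a ∈ t, η a) := by
  have h : (∑ a ∈ t, η a) = fun u => ∑ a ∈ t, η a u := by
    funext u; simp [Finset.sum_apply]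
  rw [SmoothOver, h]
  exact ContDiffOn.sum hη

theorem contDiff_contactForm_apply (k : ℕ) (σ : Fin m) (v : Jet N m k) :
    ContDiff ℝ ∞ fun u => contactForm k σ u v := by
  have h : (fun u => contactForm k σ u v)
      = fun u => crd k 0 v σ - ∑ i, crd k (ix i) u σ * v.1 i := by
    funext u
    simp [contactForm, sum_apply]
  rw [h]
  refine contDiff_const.sub (ContDiff.sum fun i _ => ContDiff.mul ?_ contDiff_const)
  exact (contDiff_apply ℝ ℝ σ).comp (crd k (ix i)).contDiff

theorem contactForm_apply (k : ℕ) (σ : Fin m) (u v : Jet N m k) :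
    contactForm k σ u v = crd k 0 v σ - ∑ i, crd k (ix i) u σ * v.1 i := by
  simp [contactForm, sum_apply]

theorem SmoothOver.Psi {η : Form N m k (q + 1)} (hη : SmoothOver W η) (σ : Fin m)
    (I : Fin N → ℕ) : SmoothOver W (Psi η σ I) :=
  (hη.p 1).contr contDiffOn_const

end Smooth

/-! ### Locality -/

section Locality

variable {W : Set (Vec N × Vec m)} {k k' q : ℕ}

theorem SmoothOver.congr {η η' : Form N m k q} (hη : SmoothOver W η)
    (h : Set.EqOn η η' (jetsOver k W)) : SmoothOver W η' :=
  ContDiffOn.congr hη fun _ hu => (h hu).symm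

theorem fderiv_congr_over (hW : IsOpen W) {G : Type*} [NormedAddCommGroup G] [NormedSpace ℝ G]
    {f g : Jet N m k → G} (h : Set.EqOn f g (jetsOver k W)) :
    Set.EqOn (fderiv ℝ f) (fderiv ℝ g) (jetsOver k W) := fun _ hu =>
  (h.eventuallyEq_of_mem (jetsOver_mem_nhds hW hu)).fderiv_eq

theorem extDeriv_congr_over (hW : IsOpen W) {η η' : Form N m k q}
    (h : Set.EqOn η η' (jetsOver k W)) :
    Set.EqOn (extDeriv η) (extDeriv η') (jetsOver k W) := fun u hu => by
  rw [extDeriv, extDeriv, fderiv_congr_over hW h hu]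

theorem p_congr_over {η η' : Form N m k q} (h : Set.EqOn η η' (jetsOver k W)) (l : ℕ) :
    Set.EqOn (p l η) (p l η') (jetsOver (k + 1) W) := fun u hu => by
  rw [p, p, h (jproj_mem_jetsOver hu)]

theorem contr_congr_over {η η' : Form N m k (q + 1)} (h : Set.EqOn η η' (jetsOver k W))
    (ξ : Jet N m k' → Jet N m k) :
    Set.EqOn (contr ξ η) (contr ξ η') (jetsOver k' W) := fun u hu => by
  rw [contr, contr, h (jproj_mem_jetsOver hu)]

theorem lie_congr_over (hW : IsOpen W) {η η' : Form N m k q} (h : Set.EqOn η η' (jetsOver k W))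
    (ξ : Jet N m k' → Jet N m k) :
    Set.EqOn (lie ξ η) (lie ξ η') (jetsOver k' W) := fun u hu => by
  rw [lie, lie, h (jproj_mem_jetsOver hu), fderiv_congr_over hW h (jproj_mem_jetsOver hu)]

theorem Psi_congr_over {η η' : Form N m k (q + 1)} (h : Set.EqOn η η' (jetsOver k W)) (σ : Fin m)
    (I : Fin N → ℕ) : Set.EqOn (Psi η σ I) (Psi η' σ I) (jetsOver (k + 1) W) :=
  contr_congr_over (p_congr_over h 1) _

end Locality

/-! ### Formal derivatives along sections -/

section Sections

variable {W : Set (Vec N × Vec m)} {k k' q : ℕ} {s : Vec N → Vec m}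

/-- The points of the base at which the section `s` takes values in `W`. -/
def secDom (W : Set (Vec N × Vec m)) (s : Vec N → Vec m) : Set (Vec N) := {x | (x, s x) ∈ W}

theorem isOpen_secDom (hW : IsOpen W) (hs : ContDiff ℝ ∞ s) : IsOpen (secDom W s) :=
  hW.preimage (continuous_id.prodMk hs.continuous)

theorem jetOf_mem_of_secDom {x : Vec N} (hx : x ∈ secDom W s) : jetOf k s x ∈ jetsOver k W :=
  jetOf_mem.2 hx

theorem contDiffOn_comp_jetOf (hs : ContDiff ℝ ∞ s) {G : Type*} [NormedAddCommGroup G]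
    [NormedSpace ℝ G] {f : Jet N m k → G} (hf : ContDiffOn ℝ ∞ f (jetsOver k W)) :
    ContDiffOn ℝ ∞ (fun x => f (jetOf k s x)) (secDom W s) :=
  hf.comp (contDiff_jetOf k hs).contDiffOn fun _ hx => jetOf_mem_of_secDom hx

theorem pder_comp_jetOf (hW : IsOpen W) (hs : ContDiff ℝ ∞ s) {G : Type*} [NormedAddCommGroup G]
    [NormedSpace ℝ G] {f : Jet N m k → G} (hf : ContDiffOn ℝ ∞ f (jetsOver k W)) (i : Fin N)
    {x : Vec N} (hx : x ∈ secDom W s) :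
    pder i (fun x => f (jetOf k s x)) x
      = fderiv ℝ f (jetOf k s x) (formalD k i (jetOf (k + 1) s x)) := by
  have h1 : DifferentiableAt ℝ f (jetOf k s x) :=
    differentiableAt_of_contDiffOn (isOpen_jetsOver hW k) hf (jetOf_mem_of_secDom hx)
  have h2 : DifferentiableAt ℝ (jetOf k s) x :=
    (contDiff_jetOf k hs).differentiable (by simp) x
  rw [← pder_jetOf k hs, pder, pder,
    show (fun x => f (jetOf k s x)) = f ∘ jetOf k s from rfl, fderiv_comp x h1 h2]
  rfl

/-- The value of a form along the jet prolongation of a section, on given vector fields. -/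
def alongSec (η : Form N m k q) (s : Vec N → Vec m) (c : Fin q → Vec N)
    (χ : Fin q → Vec N → Vec m) (x : Vec N) : ℝ :=
  η (jetOf k s x) fun a => jfield k (c a) (χ a) x

theorem pder_apply_along (hW : IsOpen W) (hs : ContDiff ℝ ∞ s) {η : Form N m k q}
    (hη : SmoothOver W η) {w : Fin q → Vec N → Jet N m k} {x : Vec N} (hx : x ∈ secDom W s)
    (hw : ∀ a, ContDiffOn ℝ ∞ (w a) (secDom W s)) (i : Fin N) :
    pder i (fun x => η (jetOf k s x) fun a => w a x) x
      = fderiv ℝ η (jetOf k s x) (formalD k i (jetOf (k + 1) s x)) (fun a => w a x)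
        + ∑ a, η (jetOf k s x) (Function.update (fun b => w b x) a (pder i (w a) x)) := by
  have hU := isOpen_secDom hW hs
  have h1 : DifferentiableAt ℝ (fun x => η (jetOf k s x)) x :=
    differentiableAt_of_contDiffOn hU (contDiffOn_comp_jetOf hs hη) hx
  have h2 : ∀ a, DifferentiableAt ℝ (w a) x := fun a => differentiableAt_of_contDiffOn hU (hw a) hx
  rw [pder, fderiv_continuousAlternatingMap_apply_apply h1 h2, ← pder_comp_jetOf hW hs hη i hx]
  rfl

/-- The Leibniz rule for `x ↦ η(j^k s)(…)` gives the derivative of `η` along `d_i` plus the terms in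
which one argument field is differentiated. By `fderiv_formalD_jfield` the latter are exactly the
correction terms in the Lie derivative along `d_i`. -/
theorem formD_jfield (hW : IsOpen W) (hs : ContDiff ℝ ∞ s) {η : Form N m k q}
    (hη : SmoothOver W η) (c : Fin q → Vec N) {χ : Fin q → Vec N → Vec m}
    (hχ : ∀ a, ContDiffOn ℝ ∞ (χ a) (secDom W s)) (i : Fin N) :
    Set.EqOn (alongSec (formD i η) s c χ) (pder i (alongSec η s c χ)) (secDom W s) :=
  fun x hx => by
    have hU := isOpen_secDom hW hs
    have h := pder_apply_along hW hs hη hx (w := fun a => jfield k (c a) (χ a))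
      (fun a => contDiffOn_jfield k hU (c a) (hχ a)) i
    change _ = pder i (fun x => η (jetOf k s x) fun a => jfield k (c a) (χ a) x) x
    rw [h, alongSec, formD, lie_apply, jproj_jetOf (Nat.le_succ k)]
    simp only [jproj_jfield (Nat.le_succ k)]
    refine congrArg₂ _ rfl (Finset.sum_congr rfl fun a _ => ?_)
    rw [fderiv_formalD_jfield k hU (c a) (hχ a) i hx]

theorem formDL_jfield (hW : IsOpen W) (hs : ContDiff ℝ ∞ s) {η : Form N m k q}
    (hη : SmoothOver W η) (c : Fin q → Vec N) {χ : Fin q → Vec N → Vec m}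
    (hχ : ∀ a, ContDiffOn ℝ ∞ (χ a) (secDom W s)) : ∀ L : List (Fin N),
    Set.EqOn (alongSec (formDL L η) s c χ) (pderL L (alongSec η s c χ)) (secDom W s)
  | [] => fun _ _ => rfl
  | i :: L => (formD_jfield hW hs (hη.formDL hW L) c hχ i).trans
      (pder_eqOn (isOpen_secDom hW hs) (formDL_jfield hW hs hη c hχ L) i)

theorem pull_jfield (η : Form N m k q) (h : k ≤ k') (c : Fin q → Vec N)
    (χ : Fin q → Vec N → Vec m) : alongSec (pull k' η) s c χ = alongSec η s c χ := by
  funext x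
  rw [alongSec, pull_apply, jproj_jetOf h]
  simp only [jproj_jfield h]
  rfl

theorem dI_jfield (hW : IsOpen W) (hs : ContDiff ℝ ∞ s) {η : Form N m k q}
    (hη : SmoothOver W η) (c : Fin q → Vec N) {χ : Fin q → Vec N → Vec m}
    (hχ : ∀ a, ContDiffOn ℝ ∞ (χ a) (secDom W s)) {I : Fin N → ℕ} (hI : k + len I ≤ k') :
    Set.EqOn (alongSec (dI k' I η) s c χ) (pd I (alongSec η s c χ)) (secDom W s) := by
  rw [dI, pull_jfield _ (by rw [length_toL]; exact hI)]
  exact formDL_jfield hW hs hη c hχ _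

end Sections

/-! ### Lagrangians -/

section Lagrangians

variable {W : Set (Vec N × Vec m)} {k k' q : ℕ} {s : Vec N → Vec m}

/-- The coefficient of a horizontal form of top degree. -/
def cf (κ : Form N m k N) (u : Jet N m k) : ℝ := κ u fun i => ddx k i

/-- Smooth Lagrangians over `W`: smooth horizontal forms of top degree. -/
structure Lag (W : Set (Vec N × Vec m)) (κ : Form N m k N) : Prop where
  smooth : SmoothOver W κ
  apply_eq : ∀ u ∈ jetsOver k W, ∀ v, κ u v = cf κ u * vol N fun a => (v a).1

/-- The coefficient of a Lagrangian along the jet prolongation of a section. -/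
def sec (s : Vec N → Vec m) (κ : Form N m k N) (x : Vec N) : ℝ := cf κ (jetOf k s x)

/-- A form that sees only base components is a top-degree alternating form on `ℝ^N`, hence a
multiple of `vol`. -/
theorem Lag.of_fst {κ : Form N m k N} (hκ : SmoothOver W κ)
    (h : ∀ u ∈ jetsOver k W, ∀ v v' : Fin N → Jet N m k, (∀ a, (v a).1 = (v' a).1) →
      κ u v = κ u v') : Lag W κ := by
  refine ⟨hκ, fun u hu v => ?_⟩
  let g := (κ u).compContinuousLinearMap
    (ContinuousLinearMap.inl ℝ (Vec N) (MI N k → Vec m))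
  have h1 : κ u v = g fun a => (v a).1 := h u hu _ _ fun a => rfl
  rw [h1, alternating_eq_vol g]
  rfl

theorem Lag.contDiffOn_cf {κ : Form N m k N} (hκ : Lag W κ) :
    ContDiffOn ℝ ∞ (cf κ) (jetsOver k W) :=
  contDiffOn_alternating_apply hκ.smooth fun _ => contDiffOn_const

theorem Lag.contDiffOn_sec {κ : Form N m k N} (hκ : Lag W κ) (hs : ContDiff ℝ ∞ s) :
    ContDiffOn ℝ ∞ (sec s κ) (secDom W s) :=
  contDiffOn_comp_jetOf hs hκ.contDiffOn_cf

theorem Lag.congr {κ κ' : Form N m k N} (hκ : Lag W κ) (h : Set.EqOn κ κ' (jetsOver k W)) :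
    Lag W κ' :=
  ⟨hκ.smooth.congr h, fun u hu v => by
    rw [cf, ← h hu]
    exact hκ.apply_eq u hu v⟩

theorem sec_congr {κ κ' : Form N m k N} (h : Set.EqOn κ κ' (jetsOver k W)) :
    Set.EqOn (sec s κ) (sec s κ') (secDom W s) := fun x hx => by
  rw [sec, sec, cf, cf, h (jetOf_mem_of_secDom hx)]

/-- The bridge from functions back to forms: each point over `W` lies on the prolongation of a
section, and the coefficient there determines the form. -/
theorem Lag.eqOn_of_sec {κ κ' : Form N m k N} (hκ : Lag W κ) (hκ' : Lag W κ')
    (h : ∀ s, ContDiff ℝ ∞ s → Set.EqOn (sec s κ) (sec s κ') (secDom W s)) :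
    Set.EqOn κ κ' (jetsOver k W) := fun u hu => by
  obtain ⟨s, hs, hsu⟩ := exists_section u
  have hx : u.1 ∈ secDom W s := by
    rw [← hsu, jetOf_mem] at hu
    exact hu
  have h1 := h s hs hx
  rw [sec, sec, hsu] at h1
  refine ContinuousAlternatingMap.ext fun v => ?_
  rw [hκ.apply_eq u hu, hκ'.apply_eq u hu, h1]

theorem Lag.add {κ κ' : Form N m k N} (hκ : Lag W κ) (hκ' : Lag W κ') : Lag W (κ + κ') :=
  ⟨hκ.smooth.add hκ'.smooth, fun u hu v => by
    change κ u v + κ' u v = (cf κ u + cf κ' u) * _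
    rw [hκ.apply_eq u hu, hκ'.apply_eq u hu, add_mul]⟩

theorem Lag.const_smul {κ : Form N m k N} (hκ : Lag W κ) (c : ℝ) : Lag W (c • κ) :=
  ⟨hκ.smooth.const_smul c, fun u hu v => by
    change c * κ u v = (c * cf κ u) * _
    rw [hκ.apply_eq u hu, mul_assoc]⟩

theorem cf_sum {ι : Type*} (t : Finset ι) (κ : ι → Form N m k N) (u : Jet N m k) :
    cf (∑ a ∈ t, κ a) u = ∑ a ∈ t, cf (κ a) u := by
  simp [cf, Finset.sum_apply]

theorem Lag.sum {ι : Type*} {t : Finset ι} {κ : ι → Form N m k N}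
    (hκ : ∀ a ∈ t, Lag W (κ a)) : Lag W (∑ a ∈ t, κ a) :=
  ⟨SmoothOver.sum fun a ha => (hκ a ha).smooth, fun u hu v => by
    rw [cf_sum, Finset.sum_mul, Finset.sum_apply, ContinuousAlternatingMap.sum_apply]
    exact Finset.sum_congr rfl fun a ha => (hκ a ha).apply_eq u hu v⟩

theorem Lag.fun_smul {κ : Form N m k N} (hκ : Lag W κ) {f : Jet N m k → ℝ}
    (hf : ContDiffOn ℝ ∞ f (jetsOver k W)) : Lag W (fun u => f u • κ u) :=
  ⟨ContDiffOn.smul hf hκ.smooth, fun u hu v => by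
    change f u * κ u v = (f u * cf κ u) * _
    rw [hκ.apply_eq u hu, mul_assoc]⟩

theorem sec_sum {ι : Type*} (t : Finset ι) (κ : ι → Form N m k N) (x : Vec N) :
    sec s (∑ a ∈ t, κ a) x = ∑ a ∈ t, sec s (κ a) x := cf_sum t κ _

theorem sec_const_smul (c : ℝ) (κ : Form N m k N) (x : Vec N) :
    sec s (c • κ) x = c * sec s κ x := rfl

theorem Lag.pull {κ : Form N m k N} (hκ : Lag W κ) (k' : ℕ) : Lag W (pull k' κ) :=
  Lag.of_fst (hκ.smooth.pull k') fun u hu v v' h => by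
    rw [pull_apply, pull_apply, hκ.apply_eq _ (jproj_mem_jetsOver hu),
      hκ.apply_eq _ (jproj_mem_jetsOver hu)]
    simp only [jproj_fst, h]

theorem jproj_ddx (k k' : ℕ) (i : Fin N) : jproj k k' (ddx (m := m) k i) = ddx k' i := by
  refine Prod.ext rfl (funext fun I => ?_)
  change crd k I.1 (ddx k i) = 0
  by_cases h : len I.1 ≤ k
  · rw [crd_of_le h]; rfl
  · rw [crd_of_lt (not_le.1 h)]; rfl

theorem cf_pull (κ : Form N m k N) (u : Jet N m k') : cf (pull k' κ) u = cf κ (jproj k' k u) := by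
  rw [cf, pull_apply]
  simp only [jproj_ddx]
  rfl

theorem sec_pull (h : k ≤ k') (κ : Form N m k N) : sec s (pull k' κ) = sec s κ := by
  funext x
  rw [sec, cf_pull, jproj_jetOf h]
  rfl

theorem horL_ddx (i : Fin N) (u : Jet N m (k + 1)) : horL u (ddx (k + 1) i) = formalD k i u := by
  rw [horL_apply, Finset.sum_eq_single i]
  · simp [ddx]
  · intro j _ hj
    simp [ddx, hj]
  · simp

theorem horL_eq_of_fst {u v v' : Jet N m (k + 1)} (h : v.1 = v'.1) : horL u v = horL u v' := by
  rw [horL_apply, horL_apply, h]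

theorem horL_eq_zero {u v : Jet N m (k + 1)} (h : v.1 = 0) : horL u v = 0 := by
  rw [horL_apply, h]
  simp

theorem Lag.p_zero {ρ : Form N m k N} (hρ : SmoothOver W ρ) : Lag W (p 0 ρ) :=
  Lag.of_fst (hρ.p 0) fun u _ v v' h => by
    rw [p_zero_apply, p_zero_apply]
    exact congrArg _ (funext fun a => horL_eq_of_fst (h a))

theorem cf_p_zero (ρ : Form N m k N) (u : Jet N m (k + 1)) :
    cf (p 0 ρ) u = ρ (jproj (k + 1) k u) fun i => formalD k i u := by
  rw [cf, p_zero_apply]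
  simp only [horL_ddx]

theorem Lag.fderiv_apply (hW : IsOpen W) {κ : Form N m k N} (hκ : Lag W κ) {u : Jet N m k}
    (hu : u ∈ jetsOver k W) (w : Jet N m k) (v : Fin N → Jet N m k) :
    fderiv ℝ κ u w v = fderiv ℝ (cf κ) u w * vol N fun a => (v a).1 := by
  have h1 : DifferentiableAt ℝ κ u :=
    differentiableAt_of_contDiffOn (isOpen_jetsOver hW k) hκ.smooth hu
  have h2 : fderiv ℝ (fun u => κ u v) u w = fderiv ℝ κ u w v := by
    rw [fderiv_continuousAlternatingMap_apply_apply h1 fun _ => differentiableAt_const _]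
    simp
  have h3 : Set.EqOn (fun u => κ u v) (fun u => cf κ u * vol N fun a => (v a).1) (jetsOver k W) :=
    fun u hu => hκ.apply_eq u hu v
  rw [← h2, fderiv_congr_over hW h3 hu, fderiv_mul_const
    (differentiableAt_of_contDiffOn (isOpen_jetsOver hW k) hκ.contDiffOn_cf hu)]
  simp [mul_comm]

theorem Lag.apply_update_eq_zero {κ : Form N m k N} (hκ : Lag W κ) {u : Jet N m k}
    (hu : u ∈ jetsOver k W) (v : Fin N → Jet N m k) (a : Fin N) {w : Jet N m k} (hw : w.1 = 0) :
    κ u (Function.update v a w) = 0 := by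
  rw [hκ.apply_eq u hu]
  have : (fun b => (Function.update v a w b).1) = Function.update (fun b => (v b).1) a 0 := by
    funext b
    by_cases h : b = a
    · subst h; simp [hw]
    · simp [h]
  rw [this, (vol N).map_coord_zero a (by simp), mul_zero]

/-- The correction terms of the Lie derivative insert the vertical vector `D_v d_i`, which a
horizontal form annihilates. What remains is the total derivative of the coefficient. -/
theorem Lag.formD_apply (hW : IsOpen W) {κ : Form N m k N} (hκ : Lag W κ) (i : Fin N)
    {u : Jet N m (k + 1)} (hu : u ∈ jetsOver (k + 1) W) (v : Fin N → Jet N m (k + 1)) :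
    formD i κ u v
      = fderiv ℝ (cf κ) (jproj (k + 1) k u) (formalD k i u) * vol N fun a => (v a).1 := by
  have hu' : jproj (k + 1) k u ∈ jetsOver k W := jproj_mem_jetsOver hu
  rw [formD, lie_apply, hκ.fderiv_apply hW hu', Finset.sum_eq_zero, add_zero]
  · rfl
  · intro a _
    refine hκ.apply_update_eq_zero hu' _ a ?_
    rw [fderiv_formalD]

theorem Lag.formD (hW : IsOpen W) {κ : Form N m k N} (hκ : Lag W κ) (i : Fin N) :
    Lag W (formD i κ) :=
  Lag.of_fst (hκ.smooth.formD hW i) fun u hu v v' h => by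
    rw [hκ.formD_apply hW i hu, hκ.formD_apply hW i hu]
    simp only [h]

theorem Lag.formDL (hW : IsOpen W) {κ : Form N m k N} (hκ : Lag W κ) :
    ∀ L : List (Fin N), Lag W (formDL L κ)
  | [] => hκ
  | i :: L => (Lag.formDL hW hκ L).formD hW i

theorem Lag.dI (hW : IsOpen W) {κ : Form N m k N} (hκ : Lag W κ) (k' : ℕ) (I : Fin N → ℕ) :
    Lag W (JetVar.dI k' I κ) :=
  (hκ.formDL hW (toL I)).pull k'

theorem Lag.alongSec_eq {κ : Form N m k N} (hκ : Lag W κ) (c : Fin N → Vec N)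
    (χ : Fin N → Vec N → Vec m) :
    Set.EqOn (alongSec κ s c χ) (fun x => sec s κ x * vol N c) (secDom W s) := fun _ hx =>
  hκ.apply_eq _ (jetOf_mem_of_secDom hx) _

theorem Lag.sec_eq_alongSec {κ : Form N m k N} (hκ : Lag W κ) (χ : Fin N → Vec N → Vec m) :
    Set.EqOn (sec s κ) (alongSec κ s (stdVec N) χ) (secDom W s) := fun x hx => by
  rw [hκ.alongSec_eq (stdVec N) χ hx]
  simp only [vol_stdVec, mul_one]

theorem Lag.sec_dI (hW : IsOpen W) (hs : ContDiff ℝ ∞ s) {κ : Form N m k N} (hκ : Lag W κ)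
    {I : Fin N → ℕ} (hI : k + len I ≤ k') :
    Set.EqOn (sec s (JetVar.dI k' I κ)) (pd I (sec s κ)) (secDom W s) :=
  ((hκ.dI hW k' I).sec_eq_alongSec fun _ => s).trans <|
    (dI_jfield hW hs hκ.smooth (stdVec N) (fun _ => hs.contDiffOn) hI).trans <|
      pd_eqOn (isOpen_secDom hW hs) (hκ.sec_eq_alongSec fun _ => s).symm I

/-! ### Source forms -/

theorem conL_ddy (σ : Fin m) (I : Fin N → ℕ) (u : Jet N m (k + 1)) :
    conL u (ddy (k + 1) σ I) = ddy k σ I := by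
  have h : horL u (ddy (k + 1) σ I) = 0 := horL_eq_zero rfl
  change jproj (k + 1) k (ddy (k + 1) σ I) - horL u (ddy (k + 1) σ I) = _
  rw [h, sub_zero]
  refine Prod.ext rfl (funext fun J => ?_)
  exact crd_of_le (J.2.trans (Nat.le_succ k)) _

/-- In `p 1` one slot takes the contact part and the others the horizontal part. The vertical vector
`∂/∂y^σ_I` has zero horizontal part, so the contact slot must be its own. -/
theorem Psi_apply (η : Form N m k (q + 1)) (σ : Fin m) (I : Fin N → ℕ) (u : Jet N m (k + 1))
    (v : Fin q → Jet N m (k + 1)) :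
    Psi η σ I u v
      = η (jproj (k + 1) k u) (Fin.cons (ddy k σ I) fun a => horL u (v a)) := by
  rw [Psi, contr_apply, p_one_apply, Fin.sum_univ_succ, Finset.sum_eq_zero, add_zero]
  · simp only [jproj_self]
    refine congrArg _ (funext fun a => ?_)
    refine Fin.cases ?_ (fun b => ?_) a
    · simp [conL_ddy]
    · simp
  · intro a _
    refine (η _).map_coord_zero 0 ?_
    rw [Function.update_of_ne (Fin.succ_ne_zero a).symm]
    exact horL_eq_zero rfl

theorem Lag.Psi {η : Form N m k (N + 1)} (hη : SmoothOver W η) (σ : Fin m) (I : Fin N → ℕ) :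
    Lag W (Psi η σ I) :=
  Lag.of_fst (hη.Psi σ I) fun u _ v v' h => by
    rw [Psi_apply, Psi_apply]
    simp only [fun a => horL_eq_of_fst (u := u) (h a)]

theorem cf_Psi (η : Form N m k (N + 1)) (σ : Fin m) (I : Fin N → ℕ) (u : Jet N m (k + 1)) :
    cf (Psi η σ I) u
      = η (jproj (k + 1) k u) (Fin.cons (ddy k σ I) fun i => formalD k i u) := by
  rw [cf, Psi_apply]
  simp only [horL_ddx]

/-- The other summands of the exterior derivative leave the vertical vector among the arguments of
`vol` and vanish. Each symmetric multi-index labels a single coordinate, so no combinatorial factor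
appears. -/
theorem Lag.cf_Psi_extDeriv (hW : IsOpen W) {κ : Form N m k N} (hκ : Lag W κ) (σ : Fin m)
    (I : Fin N → ℕ) {u : Jet N m (k + 1)} (hu : u ∈ jetsOver (k + 1) W) :
    cf (JetVar.Psi (extDeriv κ) σ I) u = fderiv ℝ (cf κ) (jproj (k + 1) k u) (ddy k σ I) := by
  have hu' : jproj (k + 1) k u ∈ jetsOver k W := jproj_mem_jetsOver hu
  rw [cf_Psi, extDeriv_apply', Fin.sum_univ_succ, Finset.sum_eq_zero, add_zero,
    hκ.fderiv_apply hW hu']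
  · have h : vol N (fun a => ((Fin.removeNth (0 : Fin (N + 1)) (Fin.cons (ddy k σ I) fun i =>
        formalD k i u : Fin (N + 1) → Jet N m k)) a).1) = 1 := vol_stdVec
    rw [h]
    simp
  · intro a _
    obtain ⟨M, rfl⟩ : ∃ M, N = M + 1 := ⟨N - 1, by have := a.2; omega⟩
    rw [hκ.fderiv_apply hW hu', (vol (M + 1)).map_coord_zero 0, mul_zero, mul_zero]
    simp [Fin.removeNth, ddy]

/-- The Euler–Lagrange expression of the source form of `η` along a section. -/
def EL (s : Vec N → Vec m) (η : Form N m k (N + 1)) (σ : Fin m) (x : Vec N) : ℝ :=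
  ∑ I : MI N k, (-1 : ℝ) ^ len I.1 * pd I.1 (sec s (Psi η σ I.1)) x

theorem EL_congr (hW : IsOpen W) (hs : ContDiff ℝ ∞ s) {η η' : Form N m k (N + 1)}
    (h : Set.EqOn η η' (jetsOver k W)) (σ : Fin m) :
    Set.EqOn (EL s η σ) (EL s η' σ) (secDom W s) := fun x hx =>
  Finset.sum_congr rfl fun I _ => by
    rw [pd_eqOn (isOpen_secDom hW hs) (sec_congr (Psi_congr_over h σ I.1)) I.1 hx]

end Lagrangians

/-! ### Prolongations along sections -/

section Prolongation

variable {W : Set (Vec N × Vec m)} {k k' q : ℕ} {s : Vec N → Vec m}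
  {ψ : Vec N × Vec m → Vec N × Vec m}

theorem contDiffOn_fun_smul {E G : Type*} [NormedAddCommGroup E] [NormedSpace ℝ E]
    [NormedAddCommGroup G] [NormedSpace ℝ G] {S : Set E} {f : E → ℝ} {g : E → G}
    (hf : ContDiffOn ℝ ∞ f S) (hg : ContDiffOn ℝ ∞ g S) :
    ContDiffOn ℝ ∞ (fun x => f x • g x) S :=
  hf.smul hg

theorem contDiffOn_comp_base {G : Type*} [NormedAddCommGroup G] [NormedSpace ℝ G]
    {f : Vec N × Vec m → G} (hf : ContDiffOn ℝ ∞ f W) (k : ℕ) :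
    ContDiffOn ℝ ∞ (fun u : Jet N m k => f (base u)) (jetsOver k W) :=
  hf.comp (contDiff_base k).contDiffOn fun _ hu => hu

theorem contDiffOn_totalD (hW : IsOpen W) {G : Type*} [NormedAddCommGroup G] [NormedSpace ℝ G]
    {f : Jet N m k → G} (hf : ContDiffOn ℝ ∞ f (jetsOver k W)) (i : Fin N) :
    ContDiffOn ℝ ∞ (totalD i f) (jetsOver (k + 1) W) :=
  contDiffOn_fderiv_comp_jproj hW hf (contDiff_formalD k i).contDiffOn

theorem totalD_jetOf (hW : IsOpen W) (hs : ContDiff ℝ ∞ s) {G : Type*} [NormedAddCommGroup G]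
    [NormedSpace ℝ G] {f : Jet N m k → G} (hf : ContDiffOn ℝ ∞ f (jetsOver k W)) (i : Fin N)
    {x : Vec N} (hx : x ∈ secDom W s) :
    totalD i f (jetOf (k + 1) s x) = pder i (fun x => f (jetOf k s x)) x := by
  rw [pder_comp_jetOf hW hs hf i hx, totalD, jproj_jetOf (Nat.le_succ k)]

theorem contDiffOn_psi_fst (hψ : ContDiffOn ℝ ∞ ψ W) (j : Fin N) :
    ContDiffOn ℝ ∞ (fun z => (ψ z).1 j) W :=
  contDiffOn_pi.1 (contDiff_fst.comp_contDiffOn hψ) j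

theorem contDiffOn_prolCoeff (hW : IsOpen W) (hψ : ContDiffOn ℝ ∞ ψ W) : ∀ L : List (Fin N),
    ContDiffOn ℝ ∞ (prolCoeff ψ L) (jetsOver L.length W)
  | [] => contDiff_snd.comp_contDiffOn (contDiffOn_comp_base hψ 0)
  | i :: L => by
    refine (contDiffOn_totalD hW (contDiffOn_prolCoeff hW hψ L) i).sub
      (ContDiffOn.sum fun j _ => contDiffOn_fun_smul ?_ (crd _ _).contDiff.contDiffOn)
    exact contDiffOn_comp_jproj (contDiffOn_totalD hW
      (contDiffOn_comp_base (contDiffOn_psi_fst hψ j) 0) i) (L.length + 1)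

theorem contDiffOn_prol (hW : IsOpen W) (hψ : ContDiffOn ℝ ∞ ψ W) (k : ℕ) :
    ContDiffOn ℝ ∞ (prol k ψ) (jetsOver k W) :=
  (contDiff_fst.comp_contDiffOn (contDiffOn_comp_base hψ k)).prodMk
    (contDiffOn_pi.2 fun I => contDiffOn_comp_jproj (contDiffOn_prolCoeff hW hψ (toL I.1)) k)

/-- The characteristic `ψ^σ - y^σ_i ψ^i` of a projectable vector field along a section. -/
def charSec (ψ : Vec N × Vec m → Vec N × Vec m) (s : Vec N → Vec m) (x : Vec N) : Vec m :=
  (ψ (x, s x)).2 - ∑ j, (ψ (x, s x)).1 j • pder j s x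

theorem contDiffOn_comp_sec (hs : ContDiff ℝ ∞ s) {G : Type*} [NormedAddCommGroup G]
    [NormedSpace ℝ G] {f : Vec N × Vec m → G} (hf : ContDiffOn ℝ ∞ f W) :
    ContDiffOn ℝ ∞ (fun x => f (x, s x)) (secDom W s) :=
  hf.comp (contDiff_id.prodMk hs).contDiffOn fun _ hx => hx

theorem contDiff_pder (hs : ContDiff ℝ ∞ s) (j : Fin N) : ContDiff ℝ ∞ (pder j s) :=
  contDiffOn_univ.1 (contDiffOn_pder isOpen_univ hs.contDiffOn j)

theorem contDiffOn_charSec (hs : ContDiff ℝ ∞ s) (hψ : ContDiffOn ℝ ∞ ψ W) :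
    ContDiffOn ℝ ∞ (charSec ψ s) (secDom W s) :=
  (contDiff_snd.comp_contDiffOn (contDiffOn_comp_sec hs hψ)).sub (ContDiffOn.sum fun j _ =>
    (contDiffOn_comp_sec hs (contDiffOn_psi_fst hψ j)).smul (contDiff_pder hs j).contDiffOn)

theorem pder_smul {U : Set (Vec N)} (hU : IsOpen U) {f : Vec N → ℝ} {g : Vec N → Vec m}
    (hf : ContDiffOn ℝ ∞ f U) (hg : ContDiffOn ℝ ∞ g U) (i : Fin N) :
    Set.EqOn (pder i fun x => f x • g x) (fun x => f x • pder i g x + pder i f x • g x) U :=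
  fun x hx => by
    rw [pder, fderiv_fun_smul (differentiableAt_of_contDiffOn hU hf hx)
      (differentiableAt_of_contDiffOn hU hg hx)]
    simp [pder]

theorem pder_add {G : Type*} [NormedAddCommGroup G] [NormedSpace ℝ G] {U : Set (Vec N)}
    (hU : IsOpen U) {f g : Vec N → G} (hf : ContDiffOn ℝ ∞ f U) (hg : ContDiffOn ℝ ∞ g U)
    (i : Fin N) :
    Set.EqOn (pder i fun x => f x + g x) (fun x => pder i f x + pder i g x) U :=
  fun x hx => by
    rw [pder, fderiv_fun_add (differentiableAt_of_contDiffOn hU hf hx)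
      (differentiableAt_of_contDiffOn hU hg hx)]
    simp [pder]

/-- The classical formula `ψ_I = ∂_I χ + ψ^j y_{Ij}`, with `χ` the characteristic. Applying `∂_i` to
`ψ^j y_{Ij}` gives `ψ^j y_{Iij}` and the extra term `(∂_i ψ^j) y_{Ij}`, which the recursion for the
prolongation subtracts. -/
theorem prolCoeff_jetOf (hW : IsOpen W) (hs : ContDiff ℝ ∞ s) (hψ : ContDiffOn ℝ ∞ ψ W) :
    ∀ L : List (Fin N), Set.EqOn (fun x => prolCoeff ψ L (jetOf L.length s x))
      (fun x => pderL L (charSec ψ s) x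
        + ∑ j, (ψ (x, s x)).1 j • pd (ofL L + ix j) s x) (secDom W s)
  | [] => fun x _ => by
    have h : ∀ j : Fin N, pd (ofL [] + ix j) s x = pder j s x := by
      intro j
      have h0 : ofL ([] : List (Fin N)) = 0 := by funext i; simp [ofL]
      rw [h0, pd_add_ix isOpen_univ hs.contDiffOn 0 j (Set.mem_univ x), pd_zero]
    simp only [h, pderL_nil, charSec, sub_add_cancel]
    change (ψ (base (jetOf 0 s x))).2 = _
    rw [base_jetOf]
  | i :: L => fun x hx => by
    have hU := isOpen_secDom hW hs
    have hj : ∀ j : Fin N, ContDiffOn ℝ ∞ (fun x => (ψ (x, s x)).1 j) (secDom W s) := fun j =>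
      contDiffOn_comp_sec hs (contDiffOn_psi_fst hψ j)
    have hS : ∀ J : Fin N → ℕ, ContDiffOn ℝ ∞ (pd J s) (secDom W s) := fun J =>
      (contDiff_pd hs J).contDiffOn
    have h1 : totalD i (prolCoeff ψ L) (jetOf (L.length + 1) s x) = pder i (pderL L (charSec ψ s)) x
        + ∑ j, ((ψ (x, s x)).1 j • pd (ofL L + ix j + ix i) s x
          + pder i (fun x => (ψ (x, s x)).1 j) x • pd (ofL L + ix j) s x) := by
      rw [totalD_jetOf hW hs (contDiffOn_prolCoeff hW hψ L) i hx,
        pder_eqOn hU (prolCoeff_jetOf hW hs hψ L) i hx,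
        pder_add hU (contDiffOn_pderL hU (contDiffOn_charSec hs hψ) L)
          (ContDiffOn.sum fun j _ => contDiffOn_fun_smul (hj j) (hS _)) i hx]
      simp only
      rw [pder_sum hU _ (fun j _ => contDiffOn_fun_smul (hj j) (hS _)) i hx]
      refine congrArg _ (Finset.sum_congr rfl fun j _ => ?_)
      rw [pder_smul hU (hj j) (hS _) i hx,
        pd_add_ix isOpen_univ hs.contDiffOn _ i (Set.mem_univ x)]
    have h2 : ∀ j : Fin N, totalD (k := 0) i (fun w => (ψ (base w)).1 j)
          (jproj (L.length + 1) 1 (jetOf (L.length + 1) s x))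
        = pder i (fun x => (ψ (x, s x)).1 j) x := by
      intro j
      rw [jproj_jetOf (by omega), totalD_jetOf hW hs
        (contDiffOn_comp_base (contDiffOn_psi_fst hψ j) 0) i hx]
      simp only [base_jetOf]
    have h3 : ∀ j : Fin N, crd (L.length + 1) (ofL L + ix j) (jetOf (L.length + 1) s x)
        = pd (ofL L + ix j) s x := fun j =>
      crd_jetOf (by rw [len_add_ix, len_ofL]) s x
    change totalD i (prolCoeff ψ L) (jetOf (L.length + 1) s x)
      - ∑ j, totalD (k := 0) i (fun w => (ψ (base w)).1 j)
          (jproj (L.length + 1) 1 (jetOf (L.length + 1) s x)) •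
            crd (L.length + 1) (ofL L + ix j) (jetOf (L.length + 1) s x) = _
    simp only [h1, h2, h3, Finset.sum_add_distrib, pderL_cons, ofL_cons, add_right_comm _ (ix i)]
    abel

theorem prol_jetOf (hW : IsOpen W) (hs : ContDiff ℝ ∞ s) (hψ : ContDiffOn ℝ ∞ ψ W) {x : Vec N}
    (hx : x ∈ secDom W s) :
    prol k ψ (jetOf k s x) = jfield k 0 (charSec ψ s) x
      + ∑ j, (ψ (x, s x)).1 j • formalD k j (jetOf (k + 1) s x) := by
  refine Prod.ext ?_ (funext fun I => ?_)
  · change (ψ (base (jetOf k s x))).1 = _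
    rw [base_jetOf, Prod.fst_add, Prod.fst_sum]
    ext j
    simp [Finset.sum_apply, Pi.single_apply]
  · change prolCoeff ψ (toL I.1) (jproj k (toL I.1).length (jetOf k s x)) = _
    rw [jproj_jetOf (by rw [length_toL]; exact I.2)]
    have h := prolCoeff_jetOf hW hs hψ (toL I.1) hx
    simp only [ofL_toL] at h
    rw [h, Prod.snd_add, Prod.snd_sum, Pi.add_apply, Finset.sum_apply]
    refine congrArg _ (Finset.sum_congr rfl fun j _ => ?_)
    change _ = (ψ (x, s x)).1 j • crd (k + 1) (I.1 + ix j) (jetOf (k + 1) s x)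
    rw [crd_jetOf (by rw [len_add_ix]; exact Nat.succ_le_succ I.2)]

theorem prolH_jetOf (u : Jet N m (k + 1)) :
    prolH k ψ u = ∑ j, (ψ (base u)).1 j • formalD k j u :=
  horL_apply u _

/-- Along a section the prolongation has the same expression in every order, in terms of `charSec`
and `formalD`; as every jet lies on a section, this is enough. -/
theorem jproj_prol (hW : IsOpen W) (hψ : ContDiffOn ℝ ∞ ψ W) (h : k ≤ k') {u : Jet N m k'}
    (hu : u ∈ jetsOver k' W) : jproj k' k (prol k' ψ u) = prol k ψ (jproj k' k u) := by
  obtain ⟨s, hs, hsu⟩ := exists_section u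
  have hx : u.1 ∈ secDom W s := by
    rw [← hsu, jetOf_mem] at hu
    exact hu
  rw [← hsu, jproj_jetOf h, prol_jetOf hW hs hψ hx, prol_jetOf hW hs hψ hx, map_add,
    jproj_jfield h, map_sum]
  refine congrArg _ (Finset.sum_congr rfl fun j _ => ?_)
  rw [map_smul, jproj_formalD h, jproj_jetOf (Nat.succ_le_succ h)]

/-- The horizontal part accounts exactly for the `formalD` summands in `prol_jetOf`, leaving the
derivatives of the characteristic. -/
theorem prolV_jetOf (hW : IsOpen W) (hs : ContDiff ℝ ∞ s) (hψ : ContDiffOn ℝ ∞ ψ W) {x : Vec N}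
    (hx : x ∈ secDom W s) :
    prolV k ψ (jetOf (k + 1) s x) = jfield k 0 (charSec ψ s) x := by
  change jproj (k + 1) k (prol (k + 1) ψ (jetOf (k + 1) s x)) - prolH k ψ (jetOf (k + 1) s x) = _
  rw [jproj_prol hW hψ (Nat.le_succ k) (jetOf_mem_of_secDom hx), jproj_jetOf (Nat.le_succ k),
    prol_jetOf hW hs hψ hx, prolH_jetOf, base_jetOf, add_sub_cancel_right]

theorem contDiffOn_prolH (hψ : ContDiffOn ℝ ∞ ψ W) (k : ℕ) :
    ContDiffOn ℝ ∞ (prolH k ψ) (jetsOver (k + 1) W) := by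
  have h : prolH k ψ = fun u => ∑ j, (ψ (base u)).1 j • formalD k j u :=
    funext fun u => prolH_jetOf u
  rw [h]
  exact ContDiffOn.sum fun j _ => (contDiffOn_comp_base (contDiffOn_psi_fst hψ j) (k + 1)).smul
    (contDiff_formalD k j).contDiffOn

theorem contDiffOn_prolV (hW : IsOpen W) (hψ : ContDiffOn ℝ ∞ ψ W) (k : ℕ) :
    ContDiffOn ℝ ∞ (prolV k ψ) (jetsOver (k + 1) W) :=
  ((jproj (k + 1) k).contDiff.comp_contDiffOn (contDiffOn_prol hW hψ (k + 1))).sub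
    (contDiffOn_prolH hψ k)

end Prolongation

/-! ### Sums over multi-indices -/

section Sums

/-- The inclusion of the multi-indices of length at most `k` into all multi-indices. -/
def miEmb (N k : ℕ) : MI N k ↪ (Fin N → ℕ) := ⟨fun I => I.1, fun _ _ h => Subtype.ext h⟩

/-- The finite set of multi-indices of length at most `k`. -/
def miSet (N k : ℕ) : Finset (Fin N → ℕ) := Finset.univ.map (miEmb N k)

theorem mem_miSet {k : ℕ} {I : Fin N → ℕ} : I ∈ miSet N k ↔ len I ≤ k := by
  rw [miSet, Finset.mem_map]
  constructor
  · rintro ⟨a, _, rfl⟩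
    exact a.2
  · exact fun h => ⟨⟨I, h⟩, Finset.mem_univ _, rfl⟩

theorem sum_MI {M : Type*} [AddCommMonoid M] (k : ℕ) (f : (Fin N → ℕ) → M) :
    ∑ I : MI N k, f I.1 = ∑ I ∈ miSet N k, f I := by
  rw [miSet, Finset.sum_map]
  rfl

theorem miSet_subset {k k' : ℕ} (h : k ≤ k') : miSet N k ⊆ miSet N k' := fun _ hI =>
  mem_miSet.2 ((mem_miSet.1 hI).trans h)

theorem sum_miSet_of_le {M : Type*} [AddCommMonoid M] {k k' : ℕ} (h : k ≤ k')
    {f : (Fin N → ℕ) → M} (hf : ∀ I, k < len I → f I = 0) :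
    ∑ I ∈ miSet N k', f I = ∑ I ∈ miSet N k, f I :=
  (Finset.sum_subset (miSet_subset h) fun I _ hI =>
    hf I (not_le.1 fun h' => hI (mem_miSet.2 h'))).symm

/-- Multi-indices with positive `i`-th entry are exactly those of the form `J + ix i`, with length
raised by one. This is the index shift behind the telescoping sums. -/
theorem sum_miSet_succ {M : Type*} [AddCommMonoid M] (k : ℕ) (i : Fin N)
    {f : (Fin N → ℕ) → M} (hf : ∀ I, I i = 0 → f I = 0) :
    ∑ I ∈ miSet N (k + 1), f I = ∑ J ∈ miSet N k, f (J + ix i) := by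
  have h : ∑ J ∈ miSet N k, f (J + ix i)
      = ∑ I ∈ (miSet N k).map (addRightEmbedding (ix i)), f I := by
    rw [Finset.sum_map]
    rfl
  rw [h]
  refine (Finset.sum_subset ?_ fun I hI hI' => hf I ?_).symm
  · intro I hI
    obtain ⟨J, hJ, rfl⟩ := Finset.mem_map.1 hI
    refine mem_miSet.2 ?_
    change len (J + ix i) ≤ k + 1
    rw [len_add_ix]
    exact Nat.succ_le_succ (mem_miSet.1 hJ)
  · by_contra h0
    refine hI' (Finset.mem_map.2 ⟨I - ix i, mem_miSet.2 ?_, ?_⟩)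
    · have h1 : I - ix i + ix i = I := tsub_add_cancel_of_le (by
        intro j
        rw [ix, Pi.single_apply]
        split_ifs with hj
        · subst hj; exact Nat.one_le_iff_ne_zero.2 h0
        · exact Nat.zero_le _)
      have h2 := mem_miSet.1 hI
      rw [← h1, len_add_ix] at h2
      omega
    · change I - ix i + ix i = I
      refine tsub_add_cancel_of_le ?_
      intro j
      rw [ix, Pi.single_apply]
      split_ifs with hj
      · subst hj; exact Nat.one_le_iff_ne_zero.2 h0
      · exact Nat.zero_le _

end Sums

/-! ### Lie derivatives of Lagrangians -/

section LieDerivative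

variable {W : Set (Vec N × Vec m)} {k k' q : ℕ} {s : Vec N → Vec m}
  {ψ : Vec N × Vec m → Vec N × Vec m}

/-- The base components of the vector field `ψ` on `W` are functions on the base. -/
def BaseOn (W : Set (Vec N × Vec m)) (ψ : Vec N × Vec m → Vec N × Vec m) : Prop :=
  ∀ z ∈ W, ∀ z' ∈ W, z.1 = z'.1 → (ψ z).1 = (ψ z').1

theorem fderiv_base_vertical (hW : IsOpen W) (hψ : ContDiffOn ℝ ∞ ψ W) (hb : BaseOn W ψ)
    {u w : Jet N m k} (hu : u ∈ jetsOver k W) (hw : w.1 = 0) (j : Fin N) :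
    fderiv ℝ (fun u : Jet N m k => (ψ (base u)).1 j) u w = 0 := by
  have hd := differentiableAt_of_contDiffOn (isOpen_jetsOver hW k)
    (contDiffOn_comp_base (contDiffOn_psi_fst hψ j) k) hu
  rw [← hd.lineDeriv_eq_fderiv, lineDeriv]
  have hc : Filter.Tendsto (fun t : ℝ => u + t • w) (𝓝 0) (𝓝 u) := by
    have : Continuous fun t : ℝ => u + t • w := by fun_prop
    simpa using this.tendsto 0
  -- Moving vertically keeps the base point fixed. For small `t` the point stays over `W`, where the
  -- base components are functions of the base point.
  have h : (fun t : ℝ => (ψ (base (u + t • w))).1 j) =ᶠ[𝓝 0] fun _ => (ψ (base u)).1 j := by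
    filter_upwards [hc (jetsOver_mem_nhds hW hu)] with t ht
    rw [hb (base (u + t • w)) ht (base u) hu]
    simp [base, hw]
  rw [h.deriv_eq, deriv_const]

theorem fderiv_prol_fst (hW : IsOpen W) (hψ : ContDiffOn ℝ ∞ ψ W) {u : Jet N m k}
    (hu : u ∈ jetsOver k W) (w : Jet N m k) (j : Fin N) :
    (fderiv ℝ (prol k ψ) u w).1 j = fderiv ℝ (fun u : Jet N m k => (ψ (base u)).1 j) u w := by
  have hd := differentiableAt_of_contDiffOn (isOpen_jetsOver hW k) (contDiffOn_prol hW hψ k) hu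
  let A : Jet N m k →L[ℝ] ℝ := (ContinuousLinearMap.proj (R := ℝ) (φ := fun _ : Fin N => ℝ) j).comp
    (ContinuousLinearMap.fst ℝ (Vec N) (MI N k → Vec m))
  have h := (A.hasFDerivAt.comp u hd.hasFDerivAt).fderiv
  change _ = fderiv ℝ (A ∘ prol k ψ) u w
  rw [h]
  rfl

theorem fderiv_prol_fst_congr (hW : IsOpen W) (hψ : ContDiffOn ℝ ∞ ψ W) (hb : BaseOn W ψ)
    {u : Jet N m k} (hu : u ∈ jetsOver k W) {w w' : Jet N m k} (h : w.1 = w'.1) :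
    (fderiv ℝ (prol k ψ) u w).1 = (fderiv ℝ (prol k ψ) u w').1 := by
  funext j
  rw [fderiv_prol_fst hW hψ hu, fderiv_prol_fst hW hψ hu, ← sub_eq_zero, ← map_sub]
  exact fderiv_base_vertical hW hψ hb hu (by simp [h]) j

theorem fst_update {v : Fin N → Jet N m k} (a : Fin N) (w : Jet N m k) :
    (fun b => (Function.update v a w b).1) = Function.update (fun b => (v b).1) a w.1 := by
  funext b
  by_cases h : b = a
  · subst h; simp
  · simp [h]

theorem lie_self_apply (ξ : Jet N m k → Jet N m k) (η : Form N m k q) (u : Jet N m k)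
    (v : Fin q → Jet N m k) :
    lie ξ η u v = fderiv ℝ η u (ξ u) v
      + ∑ a, η u (Function.update v a (fderiv ℝ ξ u (v a))) := by
  simp only [lie_apply, jproj_self]

/-- Projectability enters here: the base component of the derivative of the prolongation depends
only on the base component of the direction, so the Lie derivative stays horizontal. -/
theorem Lag.lie (hW : IsOpen W) (hψ : ContDiffOn ℝ ∞ ψ W) (hb : BaseOn W ψ) {κ : Form N m k N}
    (hκ : Lag W κ) : Lag W (lie (prol k ψ) κ) :=
  Lag.of_fst (hκ.smooth.lie hW (contDiffOn_prol hW hψ k)) fun u hu v v' h => by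
    simp only [lie_self_apply, hκ.fderiv_apply hW hu, hκ.apply_eq _ hu, fst_update, h,
      fderiv_prol_fst_congr hW hψ hb hu (h _)]

/-- The derivative of the coefficient of a Lagrangian in the direction of a variation `χ` of the
section. -/
def varSec (s : Vec N → Vec m) (κ : Form N m k N) (χ : Vec N → Vec m) (x : Vec N) : ℝ :=
  fderiv ℝ (cf κ) (jetOf k s x) (jfield k 0 χ x)

/-- The prolongation splits into the variation by the characteristic and the tangential part `ψ^j
d_j`. The terms with differentiated arguments contribute the trace of the derivative of `(ψ^j)`, so
the final sum is the divergence of `ψ^j` times the coefficient. -/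
theorem Lag.sec_lie (hW : IsOpen W) (hs : ContDiff ℝ ∞ s) (hψ : ContDiffOn ℝ ∞ ψ W)
    (hb : BaseOn W ψ) {κ : Form N m k N} (hκ : Lag W κ) {x : Vec N} (hx : x ∈ secDom W s) :
    sec s (JetVar.lie (prol k ψ) κ) x = varSec s κ (charSec ψ s) x
      + ∑ j, ((ψ (x, s x)).1 j * pder j (sec s κ) x
        + pder j (fun x => (ψ (x, s x)).1 j) x * sec s κ x) := by
  have hu : jetOf k s x ∈ jetsOver k W := jetOf_mem_of_secDom hx
  have hv : (fun a => (ddx (m := m) k a).1) = stdVec N := rfl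
  rw [sec, cf, lie_self_apply, hκ.fderiv_apply hW hu]
  simp only [hκ.apply_eq _ hu, fst_update, hv, vol_stdVec,
    vol_update_stdVec, mul_one, prol_jetOf hW hs hψ hx, map_add, map_sum, map_smul, smul_eq_mul,
    ← pder_comp_jetOf hW hs hκ.contDiffOn_cf _ hx, Finset.sum_add_distrib, add_assoc]
  refine congrArg (_ + ·) (congrArg (_ + ·) (Finset.sum_congr rfl fun j _ => ?_))
  -- `∂/∂x^j` and `d_j` differ by a vertical vector, which does not affect the base component. The
  -- second is tangent to the prolonged section.
  have h1 : (fderiv ℝ (prol k ψ) (jetOf k s x) (ddx k j)).1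
      = (fderiv ℝ (prol k ψ) (jetOf k s x) (formalD k j (jetOf (k + 1) s x))).1 :=
    fderiv_prol_fst_congr hW hψ hb hu rfl
  rw [h1, fderiv_prol_fst hW hψ hu, ← pder_comp_jetOf hW hs
    (contDiffOn_comp_base (contDiffOn_psi_fst hψ j) k) j hx, mul_comm]
  simp only [base_jetOf]
  rfl

theorem jfield_eq_sum_ddy (k : ℕ) (χ : Vec N → Vec m) (x : Vec N) :
    jfield k 0 χ x = ∑ σ, ∑ I : MI N k, pd I.1 χ x σ • ddy k σ I.1 := by
  refine Prod.ext ?_ (funext fun J => funext fun τ => ?_)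
  · simp [Prod.fst_sum, ddy]
  · simp only [Prod.snd_sum, Finset.sum_apply]
    rw [Finset.sum_eq_single τ, Finset.sum_eq_single J]
    · simp [ddy, jfield]
    · intro I _ hI
      have : J.1 ≠ I.1 := fun h => hI (Subtype.ext h.symm)
      simp [ddy, this]
    · simp
    · intro σ _ hσ
      refine Finset.sum_eq_zero fun I _ => ?_
      simp only [ddy, Prod.smul_mk, Pi.smul_apply]
      split_ifs <;> simp [hσ.symm]
    · simp

theorem Lag.sec_Psi_extDeriv (hW : IsOpen W) {κ : Form N m k N} (hκ : Lag W κ) (σ : Fin m)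
    (I : Fin N → ℕ) {x : Vec N} (hx : x ∈ secDom W s) :
    sec s (JetVar.Psi (extDeriv κ) σ I) x = fderiv ℝ (cf κ) (jetOf k s x) (ddy k σ I) := by
  rw [sec, hκ.cf_Psi_extDeriv hW σ I (jetOf_mem_of_secDom hx), jproj_jetOf (Nat.le_succ k)]

theorem Lag.varSec_eq (hW : IsOpen W) {κ : Form N m k N} (hκ : Lag W κ) (χ : Vec N → Vec m)
    {x : Vec N} (hx : x ∈ secDom W s) :
    varSec s κ χ x
      = ∑ σ, ∑ I : MI N k, pd I.1 χ x σ * sec s (JetVar.Psi (extDeriv κ) σ I.1) x := by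
  simp only [varSec, jfield_eq_sum_ddy, map_sum, map_smul, hκ.sec_Psi_extDeriv hW _ _ hx,
    smul_eq_mul]

theorem fderiv_cf_pull (hW : IsOpen W) {κ : Form N m k N} (hκ : Lag W κ) {u : Jet N m k'}
    (hu : u ∈ jetsOver k' W) (w : Jet N m k') :
    fderiv ℝ (cf (pull k' κ)) u w = fderiv ℝ (cf κ) (jproj k' k u) (jproj k' k w) := by
  have h : cf (pull k' κ) = cf κ ∘ jproj k' k := funext fun u => cf_pull κ u
  have hd := differentiableAt_of_contDiffOn (isOpen_jetsOver hW k) hκ.contDiffOn_cf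
    (jproj_mem_jetsOver (k' := k) hu)
  rw [h, (hd.hasFDerivAt.comp u (jproj k' k).hasFDerivAt).fderiv]
  rfl

/-- No ingredient of the formula `Lag.sec_lie` changes under pull-back. This allows Lie derivatives
taken on jet spaces of different orders to be compared. -/
theorem Lag.sec_lie_pull (hW : IsOpen W) (hs : ContDiff ℝ ∞ s) (hψ : ContDiffOn ℝ ∞ ψ W)
    (hb : BaseOn W ψ) {κ : Form N m k N} (hκ : Lag W κ) (h : k ≤ k') {x : Vec N}
    (hx : x ∈ secDom W s) :
    sec s (JetVar.lie (prol k' ψ) (JetVar.pull k' κ)) x = sec s (JetVar.lie (prol k ψ) κ) x := by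
  rw [hκ.sec_lie hW hs hψ hb hx, (hκ.pull k').sec_lie hW hs hψ hb hx, sec_pull h, varSec, varSec,
    fderiv_cf_pull hW hκ (jetOf_mem_of_secDom hx), jproj_jetOf h, jproj_jfield h]

theorem jproj_ddy (h : k ≤ k') (σ : Fin m) (I : Fin N → ℕ) :
    jproj k' k (ddy k' σ I) = ddy k σ I :=
  Prod.ext rfl (funext fun J => crd_of_le (J.2.trans h) _)

theorem ddy_of_lt {σ : Fin m} {I : Fin N → ℕ} (h : k < len I) : ddy k σ I = 0 := by
  refine Prod.ext rfl (funext fun J => if_neg ?_)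
  intro hJ
  have := J.2
  rw [hJ] at this
  omega

theorem pd_zero_fun (I : Fin N → ℕ) : pd I (fun _ : Vec N => (0 : ℝ)) = fun _ => 0 := by
  have h : ∀ L : List (Fin N), pderL L (fun _ : Vec N => (0 : ℝ)) = fun _ => 0 := by
    intro L
    induction L with
    | nil => rfl
    | cons i L ih =>
      rw [pderL_cons, ih]
      funext x
      simp [pder]
  exact h _

theorem pd_eq_zero_of_eqOn {U : Set (Vec N)} (hU : IsOpen U) {f : Vec N → ℝ}
    (hf : Set.EqOn f (fun _ => 0) U) (I : Fin N → ℕ) {x : Vec N} (hx : x ∈ U) : pd I f x = 0 := by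
  rw [pd_eqOn hU hf I hx, pd_zero_fun]

/-- A pulled-back Lagrangian does not depend on the added coordinates, so the extra summands vanish.
-/
theorem Lag.EL_pull (hW : IsOpen W) (hs : ContDiff ℝ ∞ s) {κ : Form N m k N} (hκ : Lag W κ)
    (h : k ≤ k') (σ : Fin m) {x : Vec N} (hx : x ∈ secDom W s) :
    EL s (extDeriv (JetVar.pull k' κ)) σ x = EL s (extDeriv κ) σ x := by
  have hU := isOpen_secDom hW hs
  have h1 : ∀ I, Set.EqOn (sec s (JetVar.Psi (extDeriv (JetVar.pull k' κ)) σ I))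
      (sec s (JetVar.Psi (extDeriv κ) σ I)) (secDom W s) := fun I y hy => by
    rw [(hκ.pull k').sec_Psi_extDeriv hW σ I hy, hκ.sec_Psi_extDeriv hW σ I hy,
      fderiv_cf_pull hW hκ (jetOf_mem_of_secDom hy), jproj_jetOf h, jproj_ddy h]
  rw [EL, EL, sum_MI k' fun I => (-1 : ℝ) ^ len I *
      pd I (sec s (JetVar.Psi (extDeriv (JetVar.pull k' κ)) σ I)) x,
    sum_MI k fun I => (-1 : ℝ) ^ len I * pd I (sec s (JetVar.Psi (extDeriv κ) σ I)) x,
    sum_miSet_of_le h]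
  · refine Finset.sum_congr rfl fun I _ => ?_
    rw [pd_eqOn hU (h1 I) I hx]
  · intro I hI
    rw [pd_eqOn hU (h1 I) I hx, pd_eq_zero_of_eqOn hU (fun y hy => ?_) I hx, mul_zero]
    rw [hκ.sec_Psi_extDeriv hW σ I hy, ddy_of_lt hI, map_zero]

end LieDerivative

/-! ### The interior Euler operator along sections -/

section InteriorEuler

variable {W : Set (Vec N × Vec m)} {k k' q : ℕ} {s : Vec N → Vec m}
  {ψ : Vec N × Vec m → Vec N × Vec m}

/-- In all other terms of the wedge product the vertical vector is fed to the horizontal form `β`.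
-/
theorem wedge_cons_vertical {α : Jet N m k → Jet N m k →L[ℝ] ℝ} {β : Form N m k N}
    (hβ : Lag W β) {u : Jet N m k} (hu : u ∈ jetsOver k W) {ξ : Jet N m k} (hξ : ξ.1 = 0)
    (v : Fin N → Jet N m k) : wedge α β u (Fin.cons ξ v) = α u ξ * β u v := by
  rw [wedge_apply, Fin.sum_univ_succ, Finset.sum_eq_zero, add_zero]
  · simp
  · intro a _
    obtain ⟨M, rfl⟩ : ∃ M, N = M + 1 := ⟨N - 1, by have := a.2; omega⟩
    rw [hβ.apply_eq u hu, (vol (M + 1)).map_coord_zero 0, mul_zero, mul_zero, mul_zero]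
    simpa [Fin.removeNth] using hξ

theorem pd_ix (hs : ContDiff ℝ ∞ s) (i : Fin N) (x : Vec N) : pd (ix i) s x = pder i s x := by
  have h := pd_add_ix isOpen_univ hs.contDiffOn 0 i (Set.mem_univ x)
  rwa [zero_add, pd_zero] at h

theorem crd_ix_jetOf (hk : 1 ≤ k) (hs : ContDiff ℝ ∞ s) (i : Fin N) (x : Vec N) :
    crd k (ix i) (jetOf k s x) = pder i s x := by
  rw [crd_jetOf ((len_ix i).trans_le hk), pd_ix hs]

theorem contactForm_jfield (hk : 1 ≤ k) (hs : ContDiff ℝ ∞ s) (σ : Fin m) (c : Vec N)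
    (χ : Vec N → Vec m) (x : Vec N) :
    contactForm k σ (jetOf k s x) (jfield k c χ x) = χ x σ - ∑ i, pder i s x σ * c i := by
  rw [contactForm_apply, crd_jfield (by simp [len_zero]), pd_zero, jfield_fst]
  simp only [crd_ix_jetOf hk hs]

/-- The characteristic of a projectable vector field as a function on the jet space of
order `k ≥ 1`. -/
def charJ (k : ℕ) (ψ : Vec N × Vec m → Vec N × Vec m) (u : Jet N m k) : Vec m :=
  (ψ (base u)).2 - ∑ j, (ψ (base u)).1 j • crd k (ix j) u

theorem charJ_jetOf (hk : 1 ≤ k) (hs : ContDiff ℝ ∞ s) (x : Vec N) :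
    charJ k ψ (jetOf k s x) = charSec ψ s x := by
  simp only [charJ, charSec, base_jetOf,
    crd_ix_jetOf hk hs]

theorem contDiffOn_charJ (hψ : ContDiffOn ℝ ∞ ψ W) (k : ℕ) :
    ContDiffOn ℝ ∞ (charJ k ψ) (jetsOver k W) :=
  (contDiff_snd.comp_contDiffOn (contDiffOn_comp_base hψ k)).sub (ContDiffOn.sum fun j _ =>
    contDiffOn_fun_smul (contDiffOn_comp_base (contDiffOn_psi_fst hψ j) k)
      (crd k (ix j)).contDiff.contDiffOn)

/-- The Euler–Lagrange expressions of a source form as horizontal forms. -/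
def eulerForm (η : Form N m k (N + 1)) (σ : Fin m) : Form N m (2 * k + 1) N :=
  ∑ I : MI N k, (-1 : ℝ) ^ len I.1 • dI (2 * k + 1) I.1 (Psi η σ I.1)

/-- The contraction of the interior Euler operator with the vertical part of `ψ`, as a form on
the jet space of its proper order. -/
def eulerL (ψ : Vec N × Vec m → Vec N × Vec m) (η : Form N m k (N + 1)) :
    Form N m (2 * k + 1) N :=
  ∑ σ, fun u => charJ (2 * k + 1) ψ u σ • eulerForm η σ u

theorem Lag.eulerForm (hW : IsOpen W) {η : Form N m k (N + 1)} (hη : SmoothOver W η) (σ : Fin m) :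
    Lag W (eulerForm η σ) :=
  Lag.sum fun I _ => ((Lag.Psi hη σ I.1).dI hW _ I.1).const_smul _

theorem sec_eulerForm (hW : IsOpen W) (hs : ContDiff ℝ ∞ s) {η : Form N m k (N + 1)}
    (hη : SmoothOver W η) (σ : Fin m) :
    Set.EqOn (sec s (eulerForm η σ)) (EL s η σ) (secDom W s) := fun x hx => by
  rw [eulerForm, sec_sum, EL]
  refine Finset.sum_congr rfl fun I _ => ?_
  rw [sec_const_smul, (Lag.Psi hη σ I.1).sec_dI hW hs (by have := I.2; omega) hx]

theorem Lag.eulerL (hW : IsOpen W) (hψ : ContDiffOn ℝ ∞ ψ W) {η : Form N m k (N + 1)}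
    (hη : SmoothOver W η) : Lag W (eulerL ψ η) :=
  Lag.sum fun σ _ => (Lag.eulerForm hW hη σ).fun_smul
    (contDiffOn_pi.1 (contDiffOn_charJ hψ _) σ)

theorem sec_eulerL (hW : IsOpen W) (hs : ContDiff ℝ ∞ s) {η : Form N m k (N + 1)}
    (hη : SmoothOver W η) :
    Set.EqOn (sec s (eulerL ψ η)) (fun x => ∑ σ, charSec ψ s x σ * EL s η σ x)
      (secDom W s) := fun x hx => by
  rw [eulerL, sec_sum]
  refine Finset.sum_congr rfl fun σ _ => ?_
  rw [← sec_eulerForm hW hs hη σ hx, ← charJ_jetOf (k := 2 * k + 1) (by omega) hs x]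
  rfl

/-- The vertical part of the prolongation enters only through `ω^σ`, whose value on it is the
characteristic. This has order `1`, so the contraction descends from order `2k+2` to `2k+1`. -/
theorem contr_intEuler {n : ℕ} {W : Set (Vec (n + 1) × Vec m)} (hW : IsOpen W)
    {ψ : Vec (n + 1) × Vec m → Vec (n + 1) × Vec m}
    (hψ : ContDiffOn ℝ ∞ ψ W) {η : Form (n + 1) m k (n + 2)} (hη : SmoothOver W η) :
    Set.EqOn (contr (prolV (2 * k + 1) ψ) (intEuler η)) (pull (2 * k + 2) (eulerL ψ η))
      (jetsOver (2 * k + 2) W) := fun u hu => by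
  obtain ⟨s, hs, hsu⟩ := exists_section u
  have hx : u.1 ∈ secDom W s := by
    rw [← hsu, jetOf_mem] at hu
    exact hu
  have hu' : jetOf (2 * k + 1) s u.1 ∈ jetsOver (2 * k + 1) W := jetOf_mem_of_secDom hx
  refine ContinuousAlternatingMap.ext fun v => ?_
  rw [contr_apply, pull_apply]
  conv_lhs => rw [← hsu]
  rw [jproj_jetOf (Nat.le_succ _), prolV_jetOf hW hs hψ hx,
    show jproj (2 * k + 2) (2 * k + 1) u = jetOf (2 * k + 1) s u.1 by
      conv_lhs => rw [← hsu]
      rw [jproj_jetOf (Nat.le_succ _)],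
    intEuler, eulerL, Finset.sum_apply, Finset.sum_apply, ContinuousAlternatingMap.sum_apply,
    ContinuousAlternatingMap.sum_apply]
  refine Finset.sum_congr rfl fun σ _ => ?_
  change wedge (contactForm (2 * k + 1) σ) (eulerForm η σ) (jetOf (2 * k + 1) s u.1) _ = _
  rw [wedge_cons_vertical (Lag.eulerForm hW hη σ) hu' rfl,
    contactForm_jfield (by omega) hs]
  change _ = charJ (2 * k + 1) ψ (jetOf (2 * k + 1) s u.1) σ *
    eulerForm η σ (jetOf (2 * k + 1) s u.1) _
  rw [charJ_jetOf (by omega) hs]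
  simp

/-! ### The source form of a horizontalization -/

/-- Moving `Y` from the front into slot `a` costs the sign `(-1)^a`, against the given `(-1)^(a+1)`.
-/
theorem alternating_removeNth_succ {E : Type*} [NormedAddCommGroup E] [NormedSpace ℝ E]
    (f : E [⋀^Fin N]→L[ℝ] ℝ) (a : Fin N) (Y : E) (d : Fin N → E) :
    (-1 : ℝ) ^ ((a.succ : Fin (N + 1)) : ℕ) *
        f ((a.succ : Fin (N + 1)).removeNth (Fin.cons Y d : Fin (N + 1) → E))
      = - f (Function.update d a Y) := by
  obtain ⟨M, rfl⟩ : ∃ M, N = M + 1 := ⟨N - 1, by have := a.2; omega⟩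
  have h1 : (a.succ).removeNth (Fin.cons Y d : Fin (M + 2) → E) = Fin.cons Y (a.removeNth d) := by
    funext b
    refine Fin.cases ?_ (fun c => ?_) b
    · simp [Fin.removeNth]
    · simp [Fin.removeNth]
  have h2 := f.neg_one_pow_smul_map_insertNth a Y (a.removeNth d)
  have h3 : a.insertNth Y (a.removeNth d) = Function.update d a Y := by
    rw [Fin.insertNth_removeNth]
  change _ = f (Fin.cons Y (a.removeNth d)) at h2
  rw [h1, ← h2, h3, Fin.val_succ, pow_succ]
  have h4 : ((-1 : ℝ) ^ (a : ℕ)) * (-1 : ℝ) ^ (a : ℕ) = 1 := by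
    rw [← mul_pow]; simp
  simp only [zsmul_eq_mul]
  push_cast
  linear_combination (-f (Function.update d a Y)) * h4

/-- Exchanging the roles of `i` and `a` transposes two arguments and hence changes the sign, while
the symmetric `H` is unaffected; the double sum equals its own negative. -/
theorem sum_update_update_eq_zero {E : Type*} [NormedAddCommGroup E] [NormedSpace ℝ E]
    (f : E [⋀^Fin N]→L[ℝ] ℝ) (Y : E) (d : Fin N → E) (H : Fin N → Fin N → E)
    (hH : ∀ i j, H i j = H j i) :
    ∑ i, ∑ a, (if a = i then 0 else f (Function.update (Function.update d i Y) a (H i a))) = 0 := by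
  have key : ∀ i a, (if a = i then 0 else f (Function.update (Function.update d i Y) a (H i a)))
      = - (if i = a then 0 else f (Function.update (Function.update d a Y) i (H a i))) := by
    intro i a
    by_cases h : a = i
    · simp [h]
    · rw [if_neg h, if_neg (Ne.symm h)]
      have h1 : f _ = - f _ := f.map_swap (Function.update (Function.update d i Y) a (H i a)) h
      have h2 : Function.update (Function.update d i Y) a (H i a) ∘ Equiv.swap a i
          = Function.update (Function.update d a Y) i (H a i) := by
        funext b
        rcases eq_or_ne b a with rfl | hba
        · simp [h, Ne.symm h]
        · rcases eq_or_ne b i with rfl | hbi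
          · simp [hH]
          · simp [Equiv.swap_apply_of_ne_of_ne hba hbi, hba, hbi]
      rw [← h2, h1, neg_neg]
  have hS := Finset.sum_comm (s := Finset.univ) (t := Finset.univ) (f := fun i a : Fin N =>
    (if a = i then 0 else f (Function.update (Function.update d i Y) a (H i a))))
  have h2 : ∑ a, ∑ i, (if a = i then 0 else f (Function.update (Function.update d i Y) a (H i a)))
      = - ∑ a, ∑ i, (if i = a then 0
        else f (Function.update (Function.update d a Y) i (H a i))) := by
    rw [← Finset.sum_neg_distrib]
    refine Finset.sum_congr rfl fun a _ => ?_
    rw [← Finset.sum_neg_distrib]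
    exact Finset.sum_congr rfl fun i _ => key i a
  rw [h2] at hS
  linarith

/-- The value of a form on the total derivatives along a section, one of which is replaced by a
constant vertical vector. -/
def replSec (s : Vec N → Vec m) (ρ : Form N m k N) (i : Fin N) (Y : Jet N m k) (x : Vec N) : ℝ :=
  ρ (jetOf k s x) (Function.update (fun a => formalD k a (jetOf (k + 1) s x)) i Y)

theorem contDiff_formalD_jetOf (hs : ContDiff ℝ ∞ s) (k : ℕ) (a : Fin N) :
    ContDiff ℝ ∞ fun x => formalD k a (jetOf (k + 1) s x) :=
  (contDiff_formalD k a).comp (contDiff_jetOf (k + 1) hs)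

theorem contDiff_update_formalD (hs : ContDiff ℝ ∞ s) (k : ℕ) (i : Fin N) (Y : Jet N m k)
    (a : Fin N) : ContDiff ℝ ∞ fun x =>
      Function.update (fun a => formalD k a (jetOf (k + 1) s x)) i Y a := by
  by_cases h : a = i
  · subst h
    simp only [Function.update_self]
    exact contDiff_const
  · simp only [Function.update_of_ne h]
    exact contDiff_formalD_jetOf hs k a

theorem contDiffOn_replSec (hs : ContDiff ℝ ∞ s) {ρ : Form N m k N} (hρ : SmoothOver W ρ)
    (i : Fin N) (Y : Jet N m k) : ContDiffOn ℝ ∞ (replSec s ρ i Y) (secDom W s) :=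
  contDiffOn_alternating_apply (contDiffOn_comp_jetOf hs hρ) fun a =>
    (contDiff_update_formalD hs k i Y a).contDiffOn

/-- Both sides are second partial derivatives of the map `jetOf k s`. -/
theorem pder_formalD_symm (hs : ContDiff ℝ ∞ s) (i a : Fin N) (x : Vec N) :
    pder i (fun x => formalD k a (jetOf (k + 1) s x)) x
      = pder a (fun x => formalD k i (jetOf (k + 1) s x)) x := by
  have h : ∀ a : Fin N, (fun x => formalD k a (jetOf (k + 1) s x)) = pder a (jetOf k s) := fun a =>
    funext fun x => (pder_jetOf k hs a x).symm
  rw [h, h]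
  exact pder_comm isOpen_univ (contDiff_jetOf k hs).contDiffOn i a (Set.mem_univ x)

/-- The Leibniz terms differentiating the remaining vectors `d_a` are symmetric in `i` and `a`, so
they cancel by `sum_update_update_eq_zero`. -/
theorem sum_pder_replSec (hW : IsOpen W) (hs : ContDiff ℝ ∞ s) {ρ : Form N m k N}
    (hρ : SmoothOver W ρ) (Y : Jet N m k) {x : Vec N} (hx : x ∈ secDom W s) :
    ∑ i, pder i (replSec s ρ i Y) x
      = ∑ i, fderiv ℝ ρ (jetOf k s x) (formalD k i (jetOf (k + 1) s x))
          (Function.update (fun a => formalD k a (jetOf (k + 1) s x)) i Y) := by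
  have h : ∀ i, pder i (replSec s ρ i Y) x
      = fderiv ℝ ρ (jetOf k s x) (formalD k i (jetOf (k + 1) s x))
          (Function.update (fun a => formalD k a (jetOf (k + 1) s x)) i Y)
        + ∑ a, (if a = i then 0 else ρ (jetOf k s x) (Function.update
          (Function.update (fun a => formalD k a (jetOf (k + 1) s x)) i Y) a
            (pder i (fun x => formalD k a (jetOf (k + 1) s x)) x))) := by
    intro i
    have h1 := pder_apply_along hW hs hρ hx
      (w := fun a x => Function.update (fun a => formalD k a (jetOf (k + 1) s x)) i Y a)
      (fun a => (contDiff_update_formalD hs k i Y a).contDiffOn) i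
    refine h1.trans (congrArg _ (Finset.sum_congr rfl fun a _ => ?_))
    by_cases ha : a = i
    · subst ha
      rw [if_pos rfl]
      refine (ρ _).map_coord_zero a ?_
      simp [pder]
    · rw [if_neg ha]
      simp only [Function.update_of_ne ha]
  simp only [h, Finset.sum_add_distrib]
  rw [sum_update_update_eq_zero _ _ _
    (fun i a => pder i (fun x => formalD k a (jetOf (k + 1) s x)) x)
    (fun i a => pder_formalD_symm hs i a x), add_zero]

theorem sec_Psi_extDeriv_eq (s : Vec N → Vec m) (ρ : Form N m k N) (σ : Fin m)
    (I : Fin N → ℕ) (x : Vec N) :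
    sec s (Psi (extDeriv ρ) σ I) x
      = fderiv ℝ ρ (jetOf k s x) (ddy k σ I) (fun a => formalD k a (jetOf (k + 1) s x))
        - ∑ i, fderiv ℝ ρ (jetOf k s x) (formalD k i (jetOf (k + 1) s x))
          (Function.update (fun a => formalD k a (jetOf (k + 1) s x)) i (ddy k σ I)) := by
  rw [sec, cf_Psi, extDeriv_apply', Fin.sum_univ_succ, jproj_jetOf (Nat.le_succ k), sub_eq_add_neg,
    ← Finset.sum_neg_distrib]
  refine congrArg₂ _ ?_ (Finset.sum_congr rfl fun a _ => ?_)
  · simp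
  · rw [alternating_removeNth_succ]
    simp

/-- The coefficient of `hρ` is `ρ(d_1, …, d_N)`. Its derivative by `y^σ_I` hits either `ρ` or one of
the vectors `d_i`. The first contribution differs from that of `dρ` by the divergence of `replSec`;
the second is the last sum. -/
theorem sec_Psi_extDeriv_p_zero (hW : IsOpen W) (hs : ContDiff ℝ ∞ s) {ρ : Form N m k N}
    (hρ : SmoothOver W ρ) (σ : Fin m) (I : Fin N → ℕ) {x : Vec N} (hx : x ∈ secDom W s) :
    sec s (Psi (extDeriv (p 0 ρ)) σ I) x
      = sec s (Psi (extDeriv ρ) σ I) x + ∑ i, pder i (replSec s ρ i (ddy k σ I)) x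
        + ∑ i, replSec s ρ i
          (fderiv ℝ (formalD k i) (jetOf (k + 1) s x) (ddy (k + 1) σ I)) x := by
  have hu : jetOf (k + 1) s x ∈ jetsOver (k + 1) W := jetOf_mem_of_secDom hx
  have hd : DifferentiableAt ℝ (fun u : Jet N m (k + 1) => ρ (jproj (k + 1) k u))
      (jetOf (k + 1) s x) :=
    differentiableAt_of_contDiffOn (isOpen_jetsOver hW (k + 1)) (contDiffOn_comp_jproj hρ _) hu
  have hd' : DifferentiableAt ℝ ρ (jproj (k + 1) k (jetOf (k + 1) s x)) :=
    differentiableAt_of_contDiffOn (isOpen_jetsOver hW k) hρ (jproj_mem_jetsOver hu)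
  have h1 : cf (p 0 ρ) = fun u => ρ (jproj (k + 1) k u) fun i => formalD k i u :=
    funext fun u => cf_p_zero ρ u
  have h2 : fderiv ℝ (fun u : Jet N m (k + 1) => ρ (jproj (k + 1) k u)) (jetOf (k + 1) s x)
      (ddy (k + 1) σ I) = fderiv ℝ ρ (jetOf k s x) (ddy k σ I) := by
    have := (hd'.hasFDerivAt.comp (jetOf (k + 1) s x) (jproj (k + 1) k).hasFDerivAt).fderiv
    change fderiv ℝ (ρ ∘ jproj (k + 1) k) (jetOf (k + 1) s x) (ddy (k + 1) σ I) = _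
    rw [this, jproj_jetOf (Nat.le_succ k)]
    change fderiv ℝ ρ (jetOf k s x) (jproj (k + 1) k (ddy (k + 1) σ I)) = _
    rw [jproj_ddy (Nat.le_succ k)]
  rw [(Lag.p_zero hρ).sec_Psi_extDeriv hW σ I hx, h1,
    fderiv_continuousAlternatingMap_apply_apply hd
      (fun a => (contDiff_formalD k a).differentiable (by simp) _), h2,
    sec_Psi_extDeriv_eq s, sum_pder_replSec hW hs hρ _ hx, sub_add_cancel,
    jproj_jetOf (Nat.le_succ k)]
  rfl

theorem fderiv_formalD_ddy_add (i : Fin N) (u : Jet N m (k + 1)) (σ : Fin m) (J : Fin N → ℕ) :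
    fderiv ℝ (formalD k i) u (ddy (k + 1) σ (J + ix i)) = ddy k σ J := by
  rw [fderiv_formalD]
  refine Prod.ext rfl (funext fun K => ?_)
  have hK : len (K.1 + ix i) ≤ k + 1 := by
    rw [len_add_ix]; exact Nat.succ_le_succ K.2
  change crd (k + 1) (K.1 + ix i) (ddy (k + 1) σ (J + ix i)) = _
  rw [crd_of_le hK]
  simp only [ddy, add_left_inj]

theorem fderiv_formalD_ddy_zero (i : Fin N) (u : Jet N m (k + 1)) (σ : Fin m) {I : Fin N → ℕ}
    (hI : I i = 0) : fderiv ℝ (formalD k i) u (ddy (k + 1) σ I) = 0 := by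
  rw [fderiv_formalD]
  refine Prod.ext rfl (funext fun K => ?_)
  have hK : len (K.1 + ix i) ≤ k + 1 := by
    rw [len_add_ix]; exact Nat.succ_le_succ K.2
  change crd (k + 1) (K.1 + ix i) (ddy (k + 1) σ I) = _
  rw [crd_of_le hK]
  have : K.1 + ix i ≠ I := by
    intro h
    rw [← h] at hI
    simp [ix] at hI
  simp [ddy, this]

theorem replSec_zero (ρ : Form N m k N) (i : Fin N) : replSec s ρ i 0 = fun _ => 0 :=
  funext fun _ => (ρ _).map_coord_zero i (by simp)

theorem pd_add {U : Set (Vec N)} (hU : IsOpen U) {f g : Vec N → ℝ} (hf : ContDiffOn ℝ ∞ f U)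
    (hg : ContDiffOn ℝ ∞ g U) (I : Fin N → ℕ) :
    Set.EqOn (pd I fun x => f x + g x) (fun x => pd I f x + pd I g x) U := by
  have h : ∀ L : List (Fin N), Set.EqOn (pderL L fun x => f x + g x)
      (fun x => pderL L f x + pderL L g x) U := by
    intro L
    induction L with
    | nil => exact fun _ _ => rfl
    | cons i L ih =>
      exact (pder_eqOn hU ih i).trans
        (pder_add hU (contDiffOn_pderL hU hf L) (contDiffOn_pderL hU hg L) i)
  exact h _

/-- The interior Euler operator does not distinguish between a form and its horizontalization. -/
theorem EL_extDeriv_p_zero (hW : IsOpen W) (hs : ContDiff ℝ ∞ s) {ρ : Form N m k N}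
    (hρ : SmoothOver W ρ) (σ : Fin m) {x : Vec N} (hx : x ∈ secDom W s) :
    EL s (extDeriv (p 0 ρ)) σ x = EL s (extDeriv ρ) σ x := by
  have hU := isOpen_secDom hW hs
  let A : (Fin N → ℕ) → Vec N → ℝ := fun I => sec s (Psi (extDeriv ρ) σ I)
  let g : Fin N → (Fin N → ℕ) → Vec N → ℝ := fun i J => replSec s ρ i (ddy k σ J)
  -- the derivatives of the formal derivatives do not depend on the point
  let g' : Fin N → (Fin N → ℕ) → Vec N → ℝ := fun i I =>
    replSec s ρ i (fderiv ℝ (formalD k i) 0 (ddy (k + 1) σ I))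
  have hg : ∀ i J, ContDiffOn ℝ ∞ (g i J) (secDom W s) := fun i J => contDiffOn_replSec hs hρ i _
  have hg' : ∀ i J, ContDiffOn ℝ ∞ (g' i J) (secDom W s) := fun i J => contDiffOn_replSec hs hρ i _
  have hA : ∀ I, ContDiffOn ℝ ∞ (A I) (secDom W s) := fun I =>
    (Lag.Psi (hρ.extDeriv hW) σ I).contDiffOn_sec hs
  have hdg : ∀ i J, ContDiffOn ℝ ∞ (pder i (g i J)) (secDom W s) := fun i J =>
    contDiffOn_pder hU (hg i J) i
  have h1 : ∀ I, Set.EqOn (sec s (Psi (extDeriv (p 0 ρ)) σ I))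
      (fun x => (A I x + ∑ i, pder i (g i I) x) + ∑ i, g' i I x) (secDom W s) := fun I y hy => by
    rw [sec_Psi_extDeriv_p_zero hW hs hρ σ I hy]
    refine congrArg _ (Finset.sum_congr rfl fun i _ => ?_)
    change _ = replSec s ρ i (fderiv ℝ (formalD k i) 0 (ddy (k + 1) σ I)) y
    rw [fderiv_formalD, fderiv_formalD]
  have h2 : ∀ I, pd I (sec s (Psi (extDeriv (p 0 ρ)) σ I)) x
      = pd I (A I) x + ∑ i, pd I (pder i (g i I)) x + ∑ i, pd I (g' i I) x := fun I => by
    rw [pd_eqOn hU (h1 I) I hx, pd_add hU ((hA I).add (ContDiffOn.sum fun i _ => hdg i I))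
      (ContDiffOn.sum fun i _ => hg' i I) I hx]
    simp only
    rw [pd_add hU (hA I) (ContDiffOn.sum fun i _ => hdg i I) I hx]
    simp only [pd]
    rw [pderL_sum hU _ (fun i _ => hdg i I) _ hx, pderL_sum hU _ (fun i _ => hg' i I) _ hx]
  have h0 : ∀ I, k < len I → A I = fun _ => 0 := fun I hI => by
    funext y
    change sec s (Psi (extDeriv ρ) σ I) y = 0
    rw [sec, cf_Psi, ddy_of_lt hI]
    exact (extDeriv ρ _).map_coord_zero 0 rfl
  have h3 : ∀ i I, k < len I → pd I (pder i (g i I)) x = 0 := fun i I hI => by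
    have : pder i (g i I) = fun _ => 0 := by
      change pder i (replSec s ρ i (ddy k σ I)) = _
      rw [ddy_of_lt hI, replSec_zero]
      funext y
      simp [pder]
    rw [this, pd_zero_fun]
  have h4 : ∀ i I, I i = 0 → pd I (g' i I) x = 0 := fun i I hI => by
    have : g' i I = fun _ => 0 := by
      change replSec s ρ i _ = _
      rw [fderiv_formalD_ddy_zero i 0 σ hI, replSec_zero]
    rw [this, pd_zero_fun]
  -- The derivative of `d_i` by `y^σ_{J+i}` is `∂/∂y^σ_J`, so the terms of the second kind are those
  -- of the first with the index shifted by `i`.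
  have h5 : ∀ i J, pd (J + ix i) (g' i (J + ix i)) x = pd J (pder i (g i J)) x := fun i J => by
    have : g' i (J + ix i) = g i J := by
      change replSec s ρ i _ = replSec s ρ i _
      rw [fderiv_formalD_ddy_add]
    rw [this, pd_add_ix hU (hg i J) J i hx, pder_pd_comm hU (hg i J) J i hx]
  rw [EL, EL, sum_MI (k + 1) fun I => (-1 : ℝ) ^ len I *
      pd I (sec s (Psi (extDeriv (p 0 ρ)) σ I)) x,
    sum_MI k fun I => (-1 : ℝ) ^ len I * pd I (A I) x]
  simp only [h2, mul_add, Finset.sum_add_distrib, Finset.mul_sum]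
  rw [sum_miSet_of_le (f := fun I => (-1 : ℝ) ^ len I * pd I (A I) x) (Nat.le_succ k)
    (fun I hI => by rw [h0 I hI, pd_zero_fun, mul_zero]), add_assoc, add_eq_left,
    Finset.sum_comm, Finset.sum_comm (s := miSet N (k + 1)), ← Finset.sum_add_distrib]
  refine Finset.sum_eq_zero fun i _ => ?_
  -- The divergence terms vanish for `|I| > k` and the other terms vanish when `I_i = 0`. After the
  -- shift `I = J + ix i` both sums run over `|J| ≤ k` and cancel termwise, by the sign of the extra
  -- index.
  rw [sum_miSet_of_le (f := fun I => (-1 : ℝ) ^ len I * pd I (pder i (g i I)) x) (Nat.le_succ k)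
      (fun I hI => by rw [h3 i I hI, mul_zero]),
    sum_miSet_succ k i (f := fun I => (-1 : ℝ) ^ len I * pd I (g' i I) x)
      (fun I hI => by rw [h4 i I hI, mul_zero]), ← Finset.sum_add_distrib]
  refine Finset.sum_eq_zero fun J _ => ?_
  rw [h5, len_add_ix, pow_succ]
  ring

end InteriorEuler

/-! ### Integration by parts -/

section Parts

variable {U : Set (Vec N)} {φ f : Vec N → ℝ}

theorem pd_const_mul (hU : IsOpen U) (hf : ContDiffOn ℝ ∞ f U) (c : ℝ) (I : Fin N → ℕ) :
    Set.EqOn (pd I fun x => c * f x) (fun x => c * pd I f x) U :=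
  pd_clm_comp (c • ContinuousLinearMap.id ℝ ℝ) hU hf I

theorem pd_sum (hU : IsOpen U) {ι : Type*} (t : Finset ι) {F : ι → Vec N → ℝ}
    (hF : ∀ a ∈ t, ContDiffOn ℝ ∞ (F a) U) (I : Fin N → ℕ) :
    Set.EqOn (pd I (fun x => ∑ a ∈ t, F a x)) (fun x => ∑ a ∈ t, pd I (F a) x) U :=
  pderL_sum hU t hF _

open MvPolynomial in
/-- The linear map that sends the monomial `a^I b^J` to `∂_I φ ∂_J f`. -/
def symbolMap (φ f : Vec N → ℝ) : MvPolynomial (Fin N ⊕ Fin N) ℝ →ₗ[ℝ] (Vec N → ℝ) :=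
  (basisMonomials (Fin N ⊕ Fin N) ℝ).constr ℝ fun e x =>
    pd (fun i => e (Sum.inl i)) φ x * pd (fun i => e (Sum.inr i)) f x

theorem symbolMap_monomial (e : Fin N ⊕ Fin N →₀ ℕ) (r : ℝ) (x : Vec N) :
    symbolMap φ f (MvPolynomial.monomial e r) x
      = r * (pd (fun i => e (Sum.inl i)) φ x * pd (fun i => e (Sum.inr i)) f x) := by
  have h : MvPolynomial.monomial e r
      = r • (MvPolynomial.basisMonomials (Fin N ⊕ Fin N) ℝ) e := by
    rw [MvPolynomial.coe_basisMonomials, MvPolynomial.smul_monomial, smul_eq_mul, mul_one]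
  rw [h, map_smul, symbolMap, Module.Basis.constr_basis]
  rfl

theorem contDiffOn_symbolMap (hU : IsOpen U) (hφ : ContDiffOn ℝ ∞ φ U)
    (hf : ContDiffOn ℝ ∞ f U) (P : MvPolynomial (Fin N ⊕ Fin N) ℝ) :
    ContDiffOn ℝ ∞ (symbolMap φ f P) U := by
  induction P using MvPolynomial.induction_on' with
  | monomial e r =>
    have h : symbolMap φ f (MvPolynomial.monomial e r) = _ :=
      funext fun x => symbolMap_monomial e r x
    rw [h]
    exact contDiffOn_const.mul ((contDiffOn_pd hU hφ _).mul (contDiffOn_pd hU hf _))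
  | add P Q hP hQ =>
    rw [map_add]
    exact hP.add hQ

/-- The product rule in symbol form: differentiating a product acts as multiplication by `a_i +
b_i`. -/
theorem symbolMap_mul (hU : IsOpen U) (hφ : ContDiffOn ℝ ∞ φ U) (hf : ContDiffOn ℝ ∞ f U)
    (i : Fin N) (P : MvPolynomial (Fin N ⊕ Fin N) ℝ) :
    Set.EqOn (symbolMap φ f
      ((MvPolynomial.X (Sum.inl i) + MvPolynomial.X (Sum.inr i)) * P))
      (pder i (symbolMap φ f P)) U := by
  induction P using MvPolynomial.induction_on' with
  | monomial e r =>
    intro x hx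
    have h : symbolMap φ f (MvPolynomial.monomial e r) = fun x =>
        r * (pd (fun i => e (Sum.inl i)) φ x * pd (fun i => e (Sum.inr i)) f x) :=
      funext fun x => symbolMap_monomial e r x
    have h1 := contDiffOn_pd hU hφ (fun i => e (Sum.inl i))
    have h2 := contDiffOn_pd hU hf (fun i => e (Sum.inr i))
    have hX : ∀ a : Fin N ⊕ Fin N, MvPolynomial.X a * MvPolynomial.monomial e r
        = MvPolynomial.monomial (Finsupp.single a 1 + e) r := by
      intro a
      rw [MvPolynomial.X, MvPolynomial.monomial_mul, one_mul]
    rw [add_mul, map_add, Pi.add_apply, hX, hX, symbolMap_monomial, symbolMap_monomial, h,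
      pder_mul hU contDiffOn_const (h1.mul h2) i hx]
    simp only
    rw [pder_mul hU h1 h2 i hx]
    have e1 : (fun j => (Finsupp.single (Sum.inl i) 1 + e : Fin N ⊕ Fin N →₀ ℕ) (Sum.inl j))
        = (fun j => e (Sum.inl j)) + ix i := by
      funext j
      simp [ix, Pi.single_apply, Finsupp.single_apply, add_comm, eq_comm]
    have e2 : (fun j => (Finsupp.single (Sum.inl i) 1 + e : Fin N ⊕ Fin N →₀ ℕ) (Sum.inr j))
        = fun j => e (Sum.inr j) := by
      funext j
      simp
    have e3 : (fun j => (Finsupp.single (Sum.inr i) 1 + e : Fin N ⊕ Fin N →₀ ℕ) (Sum.inr j))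
        = (fun j => e (Sum.inr j)) + ix i := by
      funext j
      simp [ix, Pi.single_apply, Finsupp.single_apply, add_comm, eq_comm]
    have e4 : (fun j => (Finsupp.single (Sum.inr i) 1 + e : Fin N ⊕ Fin N →₀ ℕ) (Sum.inl j))
        = fun j => e (Sum.inl j) := by
      funext j
      simp
    have hr : pder i (fun _ : Vec N => r) x = 0 := by simp [pder]
    rw [e1, e2, e3, e4, pd_add_ix hU hφ _ i hx, pd_add_ix hU hf _ i hx, hr]
    ring
  | add P Q hP hQ =>
    intro x hx
    rw [mul_add, map_add, map_add, Pi.add_apply, hP hx, hQ hx]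
    exact (pder_add hU (contDiffOn_symbolMap hU hφ hf P) (contDiffOn_symbolMap hU hφ hf Q) i
      hx).symm

theorem symbolMap_prod_mul (hU : IsOpen U) (hφ : ContDiffOn ℝ ∞ φ U) (hf : ContDiffOn ℝ ∞ f U)
    (P : MvPolynomial (Fin N ⊕ Fin N) ℝ) (K : Fin N → ℕ) :
    Set.EqOn (symbolMap φ f ((∏ i,
      (MvPolynomial.X (Sum.inl i) + MvPolynomial.X (Sum.inr i)) ^ K i) * P))
      (pd K (symbolMap φ f P)) U := by
  have h : ∀ L : List (Fin N), Set.EqOn (symbolMap φ f ((L.map fun i =>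
      (MvPolynomial.X (Sum.inl i) + MvPolynomial.X (Sum.inr i))).prod * P))
      (pderL L (symbolMap φ f P)) U := by
    intro L
    induction L with
    | nil => intro x _; simp
    | cons i L ih =>
      rw [List.map_cons, List.prod_cons, mul_assoc]
      exact (symbolMap_mul hU hφ hf i _).trans (pder_eqOn hU ih i)
  have h1 := h (toL K)
  rw [Finset.prod_list_map_count, Finset.prod_subset (Finset.subset_univ _)] at h1
  · simp only [count_toL] at h1
    exact h1
  · intro i _ hi
    rw [List.mem_toFinset] at hi
    rw [List.count_eq_zero_of_not_mem hi, pow_zero]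

/-- The box of multi-indices `J ≤ I`. -/
def miBox (I : Fin N → ℕ) : Finset (Fin N → ℕ) :=
  Fintype.piFinset fun i => Finset.range (I i + 1)

theorem mem_miBox {I J : Fin N → ℕ} : J ∈ miBox I ↔ J ≤ I := by
  simp [miBox, Pi.le_def]

/-- This is the image under `symbolMap` of the binomial expansion of `a^I = ((a + b) - b)^I`, where
`a + b` stands for differentiating the whole product. -/
theorem sum_pd_mul_pd (hU : IsOpen U) (hφ : ContDiffOn ℝ ∞ φ U) (hf : ContDiffOn ℝ ∞ f U)
    (I : Fin N → ℕ) {x : Vec N} (hx : x ∈ U) :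
    ∑ J ∈ miBox I, ((-1 : ℝ) ^ len J * ∏ i, ((I i).choose (J i) : ℝ)) *
      pd (I - J) (fun x => φ x * pd J f x) x = f x * pd I φ x := by
  have hpoly : (∏ i, (MvPolynomial.X (Sum.inl i) : MvPolynomial (Fin N ⊕ Fin N) ℝ) ^ I i)
      = ∑ J ∈ miBox I, ((-1 : ℝ) ^ len J * ∏ i, ((I i).choose (J i) : ℝ)) •
        ((∏ i, (MvPolynomial.X (Sum.inl i) + MvPolynomial.X (Sum.inr i)) ^ (I - J) i) *
          ∏ i, MvPolynomial.X (Sum.inr i) ^ J i) := by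
    have h1 : ∀ i : Fin N, (MvPolynomial.X (Sum.inl i) : MvPolynomial (Fin N ⊕ Fin N) ℝ) ^ I i
        = ∑ j ∈ Finset.range (I i + 1), (-MvPolynomial.X (Sum.inr i)) ^ j *
          (MvPolynomial.X (Sum.inl i) + MvPolynomial.X (Sum.inr i)) ^ (I i - j) *
            ((I i).choose j : MvPolynomial (Fin N ⊕ Fin N) ℝ) := by
      intro i
      rw [← add_pow]
      ring
    simp only [h1]
    rw [Finset.prod_univ_sum]
    refine Finset.sum_congr rfl fun J _ => ?_
    rw [Finset.prod_mul_distrib, Finset.prod_mul_distrib]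
    have h2 : ∏ i, (-MvPolynomial.X (Sum.inr i) : MvPolynomial (Fin N ⊕ Fin N) ℝ) ^ J i
        = MvPolynomial.C ((-1 : ℝ) ^ len J) * ∏ i, MvPolynomial.X (Sum.inr i) ^ J i := by
      have : ∀ i : Fin N, (-MvPolynomial.X (Sum.inr i) : MvPolynomial (Fin N ⊕ Fin N) ℝ) ^ J i
          = (-1) ^ J i * MvPolynomial.X (Sum.inr i) ^ J i := fun i => neg_pow _ _
      simp only [this]
      rw [Finset.prod_mul_distrib, Finset.prod_pow_eq_pow_sum]
      simp [len]
    have h3 : ∏ i, ((I i).choose (J i) : MvPolynomial (Fin N ⊕ Fin N) ℝ)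
        = MvPolynomial.C (∏ i, ((I i).choose (J i) : ℝ)) := by
      rw [map_prod]
      simp
    rw [h2, h3, MvPolynomial.smul_eq_C_mul, map_mul]
    simp only [Pi.sub_apply]
    ring
  have hmon : ∀ (g : Fin N → Fin N ⊕ Fin N) (J : Fin N → ℕ),
      (∏ i, (MvPolynomial.X (g i) : MvPolynomial (Fin N ⊕ Fin N) ℝ) ^ J i)
        = MvPolynomial.monomial (∑ i, Finsupp.single (g i) (J i)) 1 := by
    intro g J
    rw [MvPolynomial.monomial_sum_one]
    exact Finset.prod_congr rfl fun i _ => by rw [MvPolynomial.X_pow_eq_monomial]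
  have hl : ∀ (J : Fin N → ℕ) (x : Vec N),
      symbolMap φ f (∏ i, MvPolynomial.X (Sum.inl i) ^ J i) x = pd J φ x * f x := by
    intro J x
    rw [hmon, symbolMap_monomial, one_mul]
    have e1 : (fun j => (∑ i, Finsupp.single (Sum.inl i : Fin N ⊕ Fin N) (J i)) (Sum.inl j))
        = J := by
      funext j
      simp [Finsupp.finsetSum_apply, Finsupp.single_apply]
    have e2 : (fun j => (∑ i, Finsupp.single (Sum.inl i : Fin N ⊕ Fin N) (J i)) (Sum.inr j))
        = 0 := by
      funext j
      simp [Finsupp.finsetSum_apply]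
    rw [e1, e2, pd_zero]
  have hr : ∀ J : Fin N → ℕ,
      symbolMap φ f (∏ i, MvPolynomial.X (Sum.inr i) ^ J i) = fun x => φ x * pd J f x := by
    intro J
    funext x
    rw [hmon, symbolMap_monomial, one_mul]
    have e1 : (fun j => (∑ i, Finsupp.single (Sum.inr i : Fin N ⊕ Fin N) (J i)) (Sum.inr j))
        = J := by
      funext j
      simp [Finsupp.finsetSum_apply, Finsupp.single_apply]
    have e2 : (fun j => (∑ i, Finsupp.single (Sum.inr i : Fin N ⊕ Fin N) (J i)) (Sum.inl j))
        = 0 := by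
      funext j
      simp [Finsupp.finsetSum_apply]
    rw [e1, e2, pd_zero]
  have key := congrArg (fun P => symbolMap φ f P x) hpoly
  simp only [hl, map_sum, map_smul, Finset.sum_apply, Pi.smul_apply, smul_eq_mul] at key
  rw [mul_comm (f x), key]
  refine Finset.sum_congr rfl fun J _ => ?_
  rw [symbolMap_prod_mul hU hφ hf _ _ hx, hr]

/-- Integration by parts: `∑_K ∂_K (φ ζ^K) = ∑_I f^I ∂_I φ` with
`ζ^K = ∑_J (-1)^{|J|} binom(K+J, J) ∂_J f^{K+J}`. -/
theorem sum_pd_mul_sum (hU : IsOpen U) (hφ : ContDiffOn ℝ ∞ φ U) {F : (Fin N → ℕ) → Vec N → ℝ}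
    (hF : ∀ I, ContDiffOn ℝ ∞ (F I) U) (k : ℕ) {x : Vec N} (hx : x ∈ U) :
    ∑ K ∈ miSet N k, pd K (fun x => φ x * ∑ J ∈ miSet N (k - len K),
        ((-1 : ℝ) ^ len J * ∏ i, ((K i + J i).choose (J i) : ℝ)) * pd J (F (J + K)) x) x
      = ∑ I ∈ miSet N k, F I x * pd I φ x := by
  have hJ : ∀ J I, ContDiffOn ℝ ∞ (fun x => φ x * pd J (F I) x) U := fun J I =>
    hφ.mul (contDiffOn_pd hU (hF I) J)
  have h1 : ∀ K, pd K (fun x => φ x * ∑ J ∈ miSet N (k - len K),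
        ((-1 : ℝ) ^ len J * ∏ i, ((K i + J i).choose (J i) : ℝ)) * pd J (F (J + K)) x) x
      = ∑ J ∈ miSet N (k - len K), ((-1 : ℝ) ^ len J * ∏ i, ((K i + J i).choose (J i) : ℝ)) *
          pd K (fun x => φ x * pd J (F (J + K)) x) x := by
    intro K
    have h2 : (fun x => φ x * ∑ J ∈ miSet N (k - len K),
        ((-1 : ℝ) ^ len J * ∏ i, ((K i + J i).choose (J i) : ℝ)) * pd J (F (J + K)) x)
        = fun x => ∑ J ∈ miSet N (k - len K),
          ((-1 : ℝ) ^ len J * ∏ i, ((K i + J i).choose (J i) : ℝ)) *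
            (φ x * pd J (F (J + K)) x) := by
      funext x
      rw [Finset.mul_sum]
      exact Finset.sum_congr rfl fun J _ => by ring
    rw [h2, pd_sum hU _ (fun J _ => contDiffOn_const.mul (hJ J _)) K hx]
    refine Finset.sum_congr rfl fun J _ => ?_
    rw [pd_const_mul hU (hJ J _) _ K hx]
  rw [Finset.sum_congr rfl fun K _ => h1 K,
    ← Finset.sum_congr rfl fun I _ => sum_pd_mul_pd hU hφ (hF I) I hx,
    Finset.sum_sigma', Finset.sum_sigma']
  -- The pairs `(K, J)` with `|K| + |J| ≤ k` correspond to the pairs `(I, J)` with `J ≤ I` and `|I|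
  -- ≤ k`, through `I = K + J`.
  refine Finset.sum_nbij' (fun a => ⟨a.1 + a.2, a.2⟩) (fun a => ⟨a.1 - a.2, a.2⟩) ?_ ?_ ?_ ?_ ?_
  · rintro ⟨K, J⟩ h
    rw [Finset.mem_sigma, mem_miSet, mem_miSet] at h
    rw [Finset.mem_sigma, mem_miSet, mem_miBox]
    refine ⟨?_, le_add_self⟩
    rw [len_add]
    have h1 := h.1
    have h2 := h.2
    simp only at h1 h2
    omega
  · rintro ⟨I, J⟩ h
    rw [Finset.mem_sigma, mem_miSet, mem_miBox] at h
    rw [Finset.mem_sigma, mem_miSet, mem_miSet]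
    have h3 : len (I - J) + len J = len I := by rw [← len_add, tsub_add_cancel_of_le h.2]
    have h1 := h.1
    simp only at h1 ⊢
    omega
  · rintro ⟨K, J⟩ _
    simp
  · rintro ⟨I, J⟩ h
    rw [Finset.mem_sigma, mem_miSet, mem_miBox] at h
    simp [tsub_add_cancel_of_le h.2]
  · rintro ⟨K, J⟩ _
    simp only [Pi.add_apply, add_tsub_cancel_right, add_comm J K]

end Parts

/-! ### The Noether current along sections -/

section Noether

variable {n k q : ℕ} {W : Set (Vec (n + 1) × Vec m)} {s : Vec (n + 1) → Vec m}
  {ψ : Vec (n + 1) × Vec m → Vec (n + 1) × Vec m}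

theorem p_one_cons_vertical {N k q : ℕ} (η : Form N m k (q + 1)) (u : Jet N m (k + 1))
    {ξ : Jet N m (k + 1)} (hξ : ξ.1 = 0) (v : Fin q → Jet N m (k + 1)) :
    p 1 η u (Fin.cons ξ v)
      = η (jproj (k + 1) k u) (Fin.cons (conL u ξ) fun a => horL u (v a)) := by
  rw [p_one_apply, Fin.sum_univ_succ, Finset.sum_eq_zero, add_zero]
  · refine congrArg _ (funext fun a => ?_)
    refine Fin.cases ?_ (fun b => ?_) a
    · simp
    · simp
  · intro a _
    refine (η _).map_coord_zero 0 ?_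
    rw [Function.update_of_ne (Fin.succ_ne_zero a).symm]
    exact horL_eq_zero hξ

theorem horL_jetOf {N : ℕ} {s : Vec N → Vec m} (hs : ContDiff ℝ ∞ s) (x : Vec N)
    (v : Jet N m (k + 1)) :
    horL (jetOf (k + 1) s x) v = jfield k v.1 (fun z => ∑ i, v.1 i • pder i s z) x := by
  rw [horL_apply, ← jfield_sum k hs]
  simp only [formalD_jetOf k hs]

theorem conL_jfield (k : ℕ) (u : Jet N m (k + 1)) (χ : Vec N → Vec m) (x : Vec N) :
    conL u (jfield (k + 1) 0 χ x) = jfield k 0 χ x := by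
  change jproj (k + 1) k _ - horL u _ = _
  rw [horL_eq_zero rfl, sub_zero, jproj_jfield (Nat.le_succ k)]

theorem cons_fst {N q : ℕ} (ξ : Jet N m k) (v : Fin q → Jet N m k) :
    (fun a => ((Fin.cons ξ v : Fin (q + 1) → Jet N m k) a).1)
      = Fin.cons ξ.1 fun a => (v a).1 := by
  funext a
  refine Fin.cases ?_ (fun b => ?_) a <;> simp

/-- The coefficients of `ζ^I_σ` along a section. -/
def zetaSec (s : Vec (n + 1) → Vec m) (η : Form (n + 1) m k (n + 2)) (σ : Fin m)
    (I : Fin (n + 1) → ℕ) (x : Vec (n + 1)) : ℝ :=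
  ∑ J ∈ miSet (n + 1) (k - len I), ((-1 : ℝ) ^ len J * ∏ i, ((I i + J i).choose (J i) : ℝ)) *
    pd J (sec s (Psi η σ (J + I))) x

theorem Lag.zeta (hW : IsOpen W) {η : Form (n + 1) m k (n + 2)} (hη : SmoothOver W η) (σ : Fin m)
    (I : Fin (n + 1) → ℕ) : Lag W (zeta η σ I) :=
  Lag.sum fun J _ => ((Lag.Psi hη σ (J.1 + I)).dI hW _ J.1).const_smul _

theorem sec_zeta (hW : IsOpen W) (hs : ContDiff ℝ ∞ s) {η : Form (n + 1) m k (n + 2)}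
    (hη : SmoothOver W η) (σ : Fin m) (I : Fin (n + 1) → ℕ) :
    Set.EqOn (sec s (zeta η σ I)) (zetaSec s η σ I) (secDom W s) := fun x hx => by
  rw [JetVar.zeta, sec_sum, zetaSec, ← sum_MI (k - len I) fun J =>
    ((-1 : ℝ) ^ len J * ∏ i, ((I i + J i).choose (J i) : ℝ)) * pd J (sec s (Psi η σ (J + I))) x]
  refine Finset.sum_congr rfl fun J _ => ?_
  rw [sec_const_smul, (Lag.Psi hη σ (J.1 + I)).sec_dI hW hs (by have := J.2; omega) hx]

theorem contDiffOn_zetaSec (hW : IsOpen W) (hs : ContDiff ℝ ∞ s) {η : Form (n + 1) m k (n + 2)}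
    (hη : SmoothOver W η) (σ : Fin m) (I : Fin (n + 1) → ℕ) :
    ContDiffOn ℝ ∞ (zetaSec s η σ I) (secDom W s) :=
  ((Lag.zeta hW hη σ I).contDiffOn_sec hs).congr fun _ hx => (sec_zeta hW hs hη σ I hx).symm

/-- The form `ω^σ ∧ (∂/∂x^j ⌋ ζ^I_σ)`. -/
def momentumForm (η : Form (n + 1) m k (n + 2)) (σ : Fin m) (I : Fin (n + 1) → ℕ)
    (j : Fin (n + 1)) : Form (n + 1) m (2 * k + 1) (n + 1) :=
  wedge (contactForm (2 * k + 1) σ) (contr (fun _ => ddx (2 * k + 1) j) (zeta η σ I))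

theorem SmoothOver.momentumForm (hW : IsOpen W) {η : Form (n + 1) m k (n + 2)}
    (hη : SmoothOver W η) (σ : Fin m) (I : Fin (n + 1) → ℕ) (j : Fin (n + 1)) :
    SmoothOver W (momentumForm η σ I j) :=
  ((Lag.zeta hW hη σ I).smooth.contr contDiffOn_const).wedge fun v =>
    (contDiff_contactForm_apply _ σ v).contDiffOn

theorem SmoothOver.residual (hW : IsOpen W) {η : Form (n + 1) m k (n + 2)}
    (hη : SmoothOver W η) : SmoothOver W (residual η) :=
  SmoothOver.neg (SmoothOver.sum fun I _ => SmoothOver.sum fun j _ => SmoothOver.sum fun σ _ =>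
    ((hη.momentumForm hW σ (I.1 + ix j) j).dI hW _ I.1).const_smul _)

theorem SmoothOver.noether (hW : IsOpen W) (hψ : ContDiffOn ℝ ∞ ψ W)
    {κ : Form (n + 1) m k (n + 1)} (hκ : SmoothOver W κ) : SmoothOver W (noether ψ κ) :=
  ((((hκ.extDeriv hW).residual hW).p 1).neg.contr (contDiffOn_prolV hW hψ _)).add
    ((hκ.contr (contDiffOn_prolH hψ k)).pull _)

/-- The contact and base components of the tuple consisting of a vertical variation and of
horizontal vectors. -/
def horFields (s : Vec (n + 1) → Vec m) (χ : Vec (n + 1) → Vec m) (c : Fin n → Vec (n + 1)) :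
    Fin (n + 1) → Vec (n + 1) → Vec m :=
  Fin.cons χ fun a z => ∑ i, c a i • pder i s z

/-- Contact forms vanish on the horizontal arguments, so only the term of the wedge product pairing
`ω^σ` with the vertical first argument survives. -/
theorem alongSec_momentumForm (hW : IsOpen W) (hs : ContDiff ℝ ∞ s)
    {η : Form (n + 1) m k (n + 2)} (hη : SmoothOver W η) (σ : Fin m) (I : Fin (n + 1) → ℕ)
    (j : Fin (n + 1)) (χ : Vec (n + 1) → Vec m) (c : Fin n → Vec (n + 1)) :
    Set.EqOn (alongSec (momentumForm η σ I j) s (Fin.cons 0 c) (horFields s χ c))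
      (fun x => vol (n + 1) (Fin.cons (stdVec (n + 1) j) c) * (χ x σ * zetaSec s η σ I x))
      (secDom W s) := fun x hx => by
  have hu : jetOf (2 * k + 1) s x ∈ jetsOver (2 * k + 1) W := jetOf_mem_of_secDom hx
  rw [alongSec, momentumForm, wedge_apply, Fin.sum_univ_succ, Finset.sum_eq_zero, add_zero]
  · have h1 : (Fin.removeNth (0 : Fin (n + 1)) fun a => jfield (2 * k + 1)
        ((Fin.cons 0 c : Fin (n + 1) → Vec (n + 1)) a) (horFields s χ c a) x)
        = fun a => jfield (2 * k + 1) (c a) (fun z => ∑ i, c a i • pder i s z) x := by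
      funext a
      simp [horFields, Fin.removeNth]
    rw [h1, contr_apply, jproj_self, (Lag.zeta hW hη σ I).apply_eq _ hu, cons_fst]
    change _ * (contactForm (2 * k + 1) σ _ (jfield _ 0 χ x) * (sec s (zeta η σ I) x * _)) = _
    rw [contactForm_jfield (by omega) hs, sec_zeta hW hs hη σ I hx]
    simp only [jproj_self, jfield_fst]
    change _ * (_ * (_ * vol (n + 1) (Fin.cons (stdVec (n + 1) j) c))) = _
    simp
    ring
  · intro a _
    have h2 : contactForm (2 * k + 1) σ (jetOf (2 * k + 1) s x) (jfield (2 * k + 1)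
        ((Fin.cons 0 c : Fin (n + 1) → Vec (n + 1)) a.succ) (horFields s χ c a.succ) x) = 0 := by
      rw [contactForm_jfield (by omega) hs]
      simp [horFields, Finset.sum_apply, mul_comm]
    rw [h2, zero_mul, mul_zero]

theorem contDiffOn_horFields (hs : ContDiff ℝ ∞ s) {U : Set (Vec (n + 1))}
    {χ : Vec (n + 1) → Vec m} (hχ : ContDiffOn ℝ ∞ χ U) (c : Fin n → Vec (n + 1))
    (a : Fin (n + 1)) : ContDiffOn ℝ ∞ (horFields s χ c a) U := by
  refine Fin.cases ?_ (fun b => ?_) a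
  · exact hχ
  · change ContDiffOn ℝ ∞ (fun z => ∑ i, c b i • pder i s z) U
    exact ContDiffOn.sum fun i _ => ((contDiff_pder hs i).const_smul (c b i)).contDiffOn

/-- The momentum part of the components of the Noether current along a section. -/
def momentumSec (s : Vec (n + 1) → Vec m) (η : Form (n + 1) m k (n + 2))
    (χ : Vec (n + 1) → Vec m) (j : Fin (n + 1)) (x : Vec (n + 1)) : ℝ :=
  ∑ I : MI (n + 1) k with len I.1 < k, ∑ σ, (((I.1 j + 1 : ℕ) : ℝ) / ((len I.1 + 1 : ℕ) : ℝ)) *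
    pd I.1 (fun x => χ x σ * zetaSec s η σ (I.1 + ix j) x) x

theorem form_sum_apply {ι : Type*} {N k q : ℕ} (t : Finset ι) (F : ι → Form N m k q)
    (u : Jet N m k) (v : Fin q → Jet N m k) : (∑ a ∈ t, F a) u v = ∑ a ∈ t, F a u v := by
  rw [Finset.sum_apply, ContinuousAlternatingMap.sum_apply]

theorem alongSec_residual (hW : IsOpen W) (hs : ContDiff ℝ ∞ s)
    {η : Form (n + 1) m k (n + 2)} (hη : SmoothOver W η) {χ : Vec (n + 1) → Vec m}
    (hχ : ContDiffOn ℝ ∞ χ (secDom W s)) (c : Fin n → Vec (n + 1)) :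
    Set.EqOn (alongSec (residual η) s (Fin.cons 0 c) (horFields s χ c))
      (fun x => - ∑ j, momentumSec s η χ j x * vol (n + 1) (Fin.cons (stdVec (n + 1) j) c))
      (secDom W s) := fun x hx => by
  have hU := isOpen_secDom hW hs
  have key : ∀ (I : MI (n + 1) k) (j : Fin (n + 1)) (σ : Fin m), len I.1 < k →
      alongSec (dI (3 * k + 1) I.1 (momentumForm η σ (I.1 + ix j) j)) s
        (Fin.cons 0 c) (horFields s χ c) x
      = vol (n + 1) (Fin.cons (stdVec (n + 1) j) c) *
        pd I.1 (fun x => χ x σ * zetaSec s η σ (I.1 + ix j) x) x := by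
    intro I j σ hI
    rw [dI_jfield hW hs (hη.momentumForm hW σ _ j) _ (contDiffOn_horFields hs hχ c) (by omega) hx,
      pd_eqOn hU (alongSec_momentumForm hW hs hη σ _ j χ c) I.1 hx,
      pd_const_mul hU ((contDiffOn_pi.1 hχ σ).mul (contDiffOn_zetaSec hW hs hη σ _)) _ _ hx]
  have h1 : alongSec (residual η) s (Fin.cons 0 c) (horFields s χ c) x
      = - ∑ I : MI (n + 1) k with len I.1 < k, ∑ j, ∑ σ,
        (((I.1 j + 1 : ℕ) : ℝ) / ((len I.1 + 1 : ℕ) : ℝ)) *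
          alongSec (dI (3 * k + 1) I.1 (momentumForm η σ (I.1 + ix j) j)) s
            (Fin.cons 0 c) (horFields s χ c) x := by
    rw [alongSec, residual]
    change - ((∑ I : MI (n + 1) k with len I.1 < k, ∑ j, ∑ σ,
      (((I.1 j + 1 : ℕ) : ℝ) / ((len I.1 + 1 : ℕ) : ℝ)) •
        dI (3 * k + 1) I.1 (momentumForm η σ (I.1 + ix j) j)) (jetOf (3 * k + 1) s x) _) = _
    simp only [form_sum_apply]
    rfl
  rw [h1, neg_inj, Finset.sum_comm]
  refine Finset.sum_congr rfl fun j _ => ?_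
  rw [momentumSec, Finset.sum_mul]
  refine Finset.sum_congr rfl fun I hI => ?_
  rw [Finset.sum_mul]
  refine Finset.sum_congr rfl fun σ _ => ?_
  rw [key I j σ (Finset.mem_filter.1 hI).2]
  ring

/-- The components of the Noether current along a section. -/
def noetherSec (ψ : Vec (n + 1) × Vec m → Vec (n + 1) × Vec m) (s : Vec (n + 1) → Vec m)
    (κ : Form (n + 1) m k (n + 1)) (j : Fin (n + 1)) (x : Vec (n + 1)) : ℝ :=
  momentumSec s (extDeriv κ) (charSec ψ s) j x + (ψ (x, s x)).1 j * sec s κ x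

theorem vol_cons_eq_sum (w : Vec (n + 1)) (c : Fin n → Vec (n + 1)) :
    vol (n + 1) (Fin.cons w c) = ∑ j, w j * vol (n + 1) (Fin.cons (stdVec (n + 1) j) c) := by
  have hw : w = ∑ i, w i • stdVec (n + 1) i := by
    ext j
    simp [stdVec, Finset.sum_apply, Pi.single_apply]
  have h : ∀ w : Vec (n + 1), vol (n + 1) (Fin.cons w c)
      = ((vol (n + 1)).toContinuousMultilinearMap.toContinuousLinearMap
          (Fin.cons 0 c : Fin (n + 1) → Vec (n + 1)) 0) w := by
    intro w
    change _ = vol (n + 1) (Function.update (Fin.cons 0 c : Fin (n + 1) → Vec (n + 1)) 0 w)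
    rw [Fin.update_cons_zero]
  simp only [h]
  conv_lhs => rw [hw]
  rw [map_sum]
  simp only [map_smul, smul_eq_mul]

/-- Contracting `p 1` of the residual form with a vertical vector leaves horizontal parts in all
other slots. The current is therefore horizontal, with components `noetherSec` relative to the forms
`∂/∂x^j ⌋ vol`. -/
theorem noether_jetOf (hW : IsOpen W) (hs : ContDiff ℝ ∞ s) (hψ : ContDiffOn ℝ ∞ ψ W)
    {κ : Form (n + 1) m k (n + 1)} (hκ : Lag W κ) {x : Vec (n + 1)} (hx : x ∈ secDom W s)
    (v : Fin n → Jet (n + 1) m (3 * k + 3)) :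
    noether ψ κ (jetOf (3 * k + 3) s x) v
      = ∑ j, noetherSec ψ s κ j x *
        vol (n + 1) (Fin.cons (stdVec (n + 1) j) fun a => (v a).1) := by
  have h1 : contr (prolV (3 * k + 2) ψ) (momentum κ) (jetOf (3 * k + 3) s x) v
      = - alongSec (residual (extDeriv κ)) s (Fin.cons 0 fun a => (v a).1)
        (horFields s (charSec ψ s) fun a => (v a).1) x := by
    rw [contr_apply, jproj_jetOf (Nat.le_succ _), prolV_jetOf hW hs hψ hx]
    change - (p 1 (residual (extDeriv κ)) (jetOf (3 * k + 2) s x) _) = _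
    rw [p_one_cons_vertical _ _ rfl, conL_jfield, jproj_jetOf (Nat.le_succ _), alongSec]
    refine congrArg (fun w => - residual (extDeriv κ) (jetOf (3 * k + 1) s x) w)
      (funext fun a => ?_)
    refine Fin.cases ?_ (fun b => ?_) a
    · simp [horFields]
    · simp only [Fin.cons_succ, horFields]
      rw [horL_jetOf hs]
      rfl
  have h2 : pull (3 * k + 3) (contr (prolH k ψ) κ) (jetOf (3 * k + 3) s x) v
      = ∑ j, (ψ (x, s x)).1 j * sec s κ x *
        vol (n + 1) (Fin.cons (stdVec (n + 1) j) fun a => (v a).1) := by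
    rw [pull_apply, contr_apply, jproj_jetOf (by omega), jproj_jetOf (Nat.le_succ k),
      hκ.apply_eq _ (jetOf_mem_of_secDom hx), cons_fst]
    change sec s κ x * _ = _
    have h3 : (prolH k ψ (jetOf (k + 1) s x)).1 = (ψ (x, s x)).1 := by
      rw [prolH, horL_fst]
      change (ψ (base (jetOf (k + 1) s x))).1 = _
      rw [base_jetOf]
    rw [h3, vol_cons_eq_sum, Finset.mul_sum]
    refine Finset.sum_congr rfl fun j _ => ?_
    simp only [jproj_fst]
    ring
  change contr (prolV (3 * k + 2) ψ) (momentum κ) (jetOf (3 * k + 3) s x) v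
    + pull (3 * k + 3) (contr (prolH k ψ) κ) (jetOf (3 * k + 3) s x) v = _
  rw [h1, h2, alongSec_residual hW hs (hκ.smooth.extDeriv hW) (contDiffOn_charSec hs hψ) _ hx]
  simp only [neg_neg]
  rw [← Finset.sum_add_distrib]
  refine Finset.sum_congr rfl fun j _ => ?_
  rw [noetherSec]
  ring

/-- Horizontal forms over `W`. -/
def HorOver {N k q : ℕ} (W : Set (Vec N × Vec m)) (ν : Form N m k q) : Prop :=
  ∀ u ∈ jetsOver k W, ∀ v : Fin q → Jet N m k, (∃ a, (v a).1 = 0) → ν u v = 0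

theorem horOver_noether (hW : IsOpen W) (hψ : ContDiffOn ℝ ∞ ψ W)
    {κ : Form (n + 1) m k (n + 1)} (hκ : Lag W κ) : HorOver W (noether ψ κ) := by
  rintro u hu v ⟨a, ha⟩
  obtain ⟨s, hs, hsu⟩ := exists_section u
  have hx : u.1 ∈ secDom W s := by
    rw [← hsu, jetOf_mem] at hu
    exact hu
  rw [← hsu, noether_jetOf hW hs hψ hκ hx]
  refine Finset.sum_eq_zero fun j _ => ?_
  rw [(vol (n + 1)).map_coord_zero a.succ (by simpa using ha), mul_zero]

theorem HorOver.p_eq_zero {N k q l : ℕ} {W : Set (Vec N × Vec m)} {ν : Form N m k q}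
    (hν : HorOver W ν) (hl : 1 ≤ l) : Set.EqOn (p l ν) 0 (jetsOver (k + 1) W) := fun u hu => by
  refine ContinuousAlternatingMap.ext fun v => ?_
  rw [p_apply]
  refine Finset.sum_eq_zero fun S hS => hν _ (jproj_mem_jetsOver hu) _ ?_
  obtain ⟨a, ha⟩ : S.Nonempty := by
    rw [← Finset.card_pos, (Finset.mem_powersetCard.1 hS).2]
    exact hl
  exact ⟨a, by simp [ha]⟩

/-- A contact slot would receive a vertical vector, so `p l ν` vanishes for `l ≥ 1` and only `l = 0`
contributes to `dH`. -/
theorem HorOver.dH_eq {N k q : ℕ} {W : Set (Vec N × Vec m)} (hW : IsOpen W) {ν : Form N m k q}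
    (hν : HorOver W ν) : Set.EqOn (dH ν) (p 0 (extDeriv (p 0 ν))) (jetsOver (k + 2) W) :=
  fun u hu => by
    rw [dH, Finset.sum_apply, Finset.sum_eq_single 0]
    · intro l _ hl
      have h1 : Set.EqOn (extDeriv (p l ν)) (extDeriv 0) (jetsOver (k + 1) W) :=
        extDeriv_congr_over hW (hν.p_eq_zero (Nat.one_le_iff_ne_zero.2 hl))
      rw [p_congr_over h1 l hu]
      refine ContinuousAlternatingMap.ext fun v => ?_
      rw [p_apply]
      refine Finset.sum_eq_zero fun S _ => ?_
      rw [extDeriv_apply']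
      refine Finset.sum_eq_zero fun i _ => ?_
      simp
    · simp

theorem Lag.dH_noether (hW : IsOpen W) (hψ : ContDiffOn ℝ ∞ ψ W)
    {κ : Form (n + 1) m k (n + 1)} (hκ : Lag W κ) : Lag W (dH (noether ψ κ)) :=
  (Lag.p_zero (((hκ.smooth.noether hW hψ).p 0).extDeriv hW)).congr
    ((horOver_noether hW hψ hκ).dH_eq hW).symm

end Noether

/-! ### The first variation formula -/

section FirstVariation

variable {n k q : ℕ} {W : Set (Vec (n + 1) × Vec m)} {s : Vec (n + 1) → Vec m}
  {ψ : Vec (n + 1) × Vec m → Vec (n + 1) × Vec m}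

theorem pder_formalD_jetOf_fst {N : ℕ} {s : Vec N → Vec m} (hs : ContDiff ℝ ∞ s) (k : ℕ)
    (i b : Fin N) (x : Vec N) :
    (pder i (fun x => formalD k b (jetOf (k + 1) s x)) x).1 = 0 := by
  simp only [formalD_jetOf k hs]
  change (pder i (jfield k (Pi.single b 1) (pder b s)) x).1 = 0
  rw [pder_jfield k isOpen_univ _ (contDiff_pder hs b).contDiffOn i (Set.mem_univ x)]

/-- For a horizontal form with components `K_j`, the horizontal differential along a section is the
ordinary divergence of `K`. -/
theorem sec_p_zero_extDeriv (hW : IsOpen W) (hs : ContDiff ℝ ∞ s) {ν : Form (n + 1) m k n}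
    (hν : SmoothOver W ν) (hh : HorOver W ν) {K : Fin (n + 1) → Vec (n + 1) → ℝ}
    (hK : ∀ i, ContDiffOn ℝ ∞ (K i) (secDom W s))
    (hνK : ∀ x ∈ secDom W s, ∀ v : Fin n → Jet (n + 1) m k, ν (jetOf k s x) v
      = ∑ j, K j x * vol (n + 1) (Fin.cons (stdVec (n + 1) j) fun a => (v a).1)) :
    Set.EqOn (sec s (p 0 (extDeriv (p 0 ν)))) (fun x => ∑ i, pder i (K i) x) (secDom W s) :=
  fun x hx => by
    have hU := isOpen_secDom hW hs
    have hu : jetOf (k + 1) s x ∈ jetsOver (k + 1) W := jetOf_mem_of_secDom hx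
    rw [sec, cf_p_zero, jproj_jetOf (Nat.le_succ _), extDeriv_apply']
    refine Finset.sum_congr rfl fun i _ => ?_
    have h1 := pder_apply_along hW hs (hν.p 0) hx
      (w := fun a x => formalD (k + 1) (i.succAbove a) (jetOf (k + 2) s x))
      (fun a => (contDiff_formalD_jetOf hs (k + 1) _).contDiffOn) i
    rw [Finset.sum_eq_zero, add_zero] at h1
    -- Omitting `d_i` from the arguments selects the component `K_i` with the sign `(-1)^i`, which
    -- later cancels the same sign in the exterior derivative.
    · have h2 : Set.EqOn (fun x => p 0 ν (jetOf (k + 1) s x) fun a =>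
          formalD (k + 1) (i.succAbove a) (jetOf (k + 2) s x))
          (fun x => (-1 : ℝ) ^ (i : ℕ) * K i x) (secDom W s) := fun y hy => by
        simp only
        rw [p_zero_apply, jproj_jetOf (Nat.le_succ _), hνK y hy, Finset.sum_eq_single i]
        · simp only [horL_fst, formalD_fst]
          change K i y * vol (n + 1) (Fin.cons (stdVec (n + 1) i)
            (i.removeNth (stdVec (n + 1)))) = _
          rw [vol_cons_removeNth, mul_comm]
        · intro j _ hj
          simp only [horL_fst, formalD_fst]
          change K j y * vol (n + 1) (Fin.cons (stdVec (n + 1) j)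
            (i.removeNth (stdVec (n + 1)))) = _
          rw [vol_cons_removeNth_of_ne hj.symm, mul_zero]
        · simp
      have h3 : fderiv ℝ (p 0 ν) (jetOf (k + 1) s x)
          (formalD (k + 1) i (jetOf (k + 1 + 1) s x))
          (i.removeNth fun a => formalD (k + 1) a (jetOf (k + 1 + 1) s x))
          = (-1 : ℝ) ^ (i : ℕ) * pder i (K i) x := by
        refine h1.symm.trans ?_
        rw [pder_eqOn hU h2 i hx]
        exact pder_clm_comp (((-1 : ℝ) ^ (i : ℕ)) • ContinuousLinearMap.id ℝ ℝ) hU (hK i) i hx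
      rw [h3, ← mul_assoc, ← mul_pow]
      simp
    -- The differentiated argument is vertical, so the horizontal form vanishes on it.
    · intro a _
      rw [p_zero_apply]
      refine hh _ (jproj_mem_jetsOver hu) _ ⟨a, ?_⟩
      rw [horL_fst, Function.update_self, pder_formalD_jetOf_fst hs]

/-- The ordered index tuples of a nonzero multi-index `K` split according to their last entry. -/
theorem sum_MI_add_ix {N : ℕ} (k : ℕ) (G : (Fin N → ℕ) → ℝ) :
    ∑ j, ∑ I : MI N k with len I.1 < k,
        (((I.1 j + 1 : ℕ) : ℝ) / ((len I.1 + 1 : ℕ) : ℝ)) * G (I.1 + ix j)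
      = (∑ K ∈ miSet N k, G K) - G 0 := by
  have hlen : ∀ K : Fin N → ℕ, len K = 0 → K = 0 := fun K hK => funext fun i => by
    have := Finset.sum_eq_zero_iff.1 hK i (Finset.mem_univ i)
    exact this
  have h1 : ∀ j : Fin N, ∑ I : MI N k with len I.1 < k,
      (((I.1 j + 1 : ℕ) : ℝ) / ((len I.1 + 1 : ℕ) : ℝ)) * G (I.1 + ix j)
      = ∑ K ∈ miSet N k, ((K j : ℝ) / (len K : ℝ)) * G K := fun j => by
    rw [Finset.sum_filter, sum_MI k fun I => if len I < k then
      (((I j + 1 : ℕ) : ℝ) / ((len I + 1 : ℕ) : ℝ)) * G (I + ix j) else 0]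
    cases k with
    | zero =>
      rw [Finset.sum_eq_zero, Finset.sum_eq_zero]
      · intro K hK
        rw [hlen K (Nat.le_zero.1 (mem_miSet.1 hK))]
        simp
      · intro K _
        simp
    | succ k =>
      rw [sum_miSet_of_le (Nat.le_succ k) fun I hI => if_neg (by omega),
        sum_miSet_succ k j fun K hK => by rw [hK]; simp]
      refine Finset.sum_congr rfl fun I hI => ?_
      rw [if_pos (Nat.lt_succ_of_le (mem_miSet.1 hI)), len_add_ix]
      simp [ix]
  rw [Finset.sum_congr rfl fun j _ => h1 j, Finset.sum_comm]
  -- With `K = I + ix j` the weights are `K_j / |K|`, with sum `1` over `j` if `K ≠ 0`. For `K = 0`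
  -- division by zero gives weight `0`, whence the subtracted `G 0`.
  have h2 : ∀ K : Fin N → ℕ, ∑ j, ((K j : ℝ) / (len K : ℝ)) * G K
      = G K - if K = 0 then G 0 else 0 := fun K => by
    rw [← Finset.sum_mul, ← Finset.sum_div]
    by_cases hK : K = 0
    · subst hK
      simp
    · have h3 : (len K : ℝ) ≠ 0 := fun h => hK (hlen K (by exact_mod_cast h))
      rw [if_neg hK, sub_zero, ← Nat.cast_sum]
      change (len K : ℝ) / (len K : ℝ) * _ = _
      rw [div_self h3, one_mul]
  rw [Finset.sum_congr rfl fun K _ => h2 K, Finset.sum_sub_distrib, Finset.sum_ite_eq',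
    if_pos (mem_miSet.2 (by rw [len_zero]; exact Nat.zero_le _))]

theorem zetaSec_zero (η : Form (n + 1) m k (n + 2)) (σ : Fin m) :
    zetaSec s η σ 0 = EL s η σ := by
  funext x
  rw [zetaSec, EL, sum_MI k fun I => (-1 : ℝ) ^ len I * pd I (sec s (Psi η σ I)) x, len_zero,
    Nat.sub_zero]
  simp

theorem contDiffOn_apply_mul_zetaSec (hW : IsOpen W) (hs : ContDiff ℝ ∞ s)
    {η : Form (n + 1) m k (n + 2)} (hη : SmoothOver W η) {χ : Vec (n + 1) → Vec m}
    (hχ : ContDiffOn ℝ ∞ χ (secDom W s)) (σ : Fin m) (K : Fin (n + 1) → ℕ) :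
    ContDiffOn ℝ ∞ (fun x => χ x σ * zetaSec s η σ K x) (secDom W s) :=
  (contDiffOn_pi.1 hχ σ).mul (contDiffOn_zetaSec hW hs hη σ K)

theorem contDiffOn_momentumSec (hW : IsOpen W) (hs : ContDiff ℝ ∞ s)
    {η : Form (n + 1) m k (n + 2)} (hη : SmoothOver W η) {χ : Vec (n + 1) → Vec m}
    (hχ : ContDiffOn ℝ ∞ χ (secDom W s)) (j : Fin (n + 1)) :
    ContDiffOn ℝ ∞ (momentumSec s η χ j) (secDom W s) :=
  ContDiffOn.sum fun _ _ => ContDiffOn.sum fun σ _ => contDiffOn_const.mul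
    (contDiffOn_pd (isOpen_secDom hW hs) (contDiffOn_apply_mul_zetaSec hW hs hη hχ σ _) _)

/-- The divergence of the momentum part of the Noether current. -/
theorem sum_pder_momentumSec (hW : IsOpen W) (hs : ContDiff ℝ ∞ s)
    {η : Form (n + 1) m k (n + 2)} (hη : SmoothOver W η) {χ : Vec (n + 1) → Vec m}
    (hχ : ContDiffOn ℝ ∞ χ (secDom W s)) {x : Vec (n + 1)} (hx : x ∈ secDom W s) :
    ∑ j, pder j (momentumSec s η χ j) x
      = (∑ σ, ∑ I : MI (n + 1) k, pd I.1 χ x σ * sec s (Psi η σ I.1) x)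
        - ∑ σ, χ x σ * EL s η σ x := by
  have hU := isOpen_secDom hW hs
  have hz := contDiffOn_apply_mul_zetaSec hW hs hη hχ
  have h1 : ∀ j, pder j (momentumSec s η χ j) x = ∑ I : MI (n + 1) k with len I.1 < k,
      (((I.1 j + 1 : ℕ) : ℝ) / ((len I.1 + 1 : ℕ) : ℝ)) *
        ∑ σ, pd (I.1 + ix j) (fun x => χ x σ * zetaSec s η σ (I.1 + ix j) x) x := fun j => by
    have hc : ∀ (I : MI (n + 1) k) (σ : Fin m), ContDiffOn ℝ ∞ (fun x =>
        (((I.1 j + 1 : ℕ) : ℝ) / ((len I.1 + 1 : ℕ) : ℝ)) *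
          pd I.1 (fun x => χ x σ * zetaSec s η σ (I.1 + ix j) x) x) (secDom W s) := fun I σ =>
      contDiffOn_const.mul (contDiffOn_pd hU (hz σ _) _)
    change pder j (fun x => ∑ I : MI (n + 1) k with len I.1 < k, ∑ σ, _) x = _
    rw [pder_sum hU _ (fun I _ => ContDiffOn.sum fun σ _ => hc I σ) j hx]
    refine Finset.sum_congr rfl fun I _ => ?_
    rw [pder_sum hU _ (fun σ _ => hc I σ) j hx, Finset.mul_sum]
    refine Finset.sum_congr rfl fun σ _ => ?_
    rw [pd_add_ix hU (hz σ _) I.1 j hx]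
    exact pder_clm_comp ((((I.1 j + 1 : ℕ) : ℝ) / ((len I.1 + 1 : ℕ) : ℝ)) •
      ContinuousLinearMap.id ℝ ℝ) hU (contDiffOn_pd hU (hz σ _) _) j hx
  -- The outer derivative turns `∂_I` into `∂_{I+j}`, and the weights collect each `∂_K(χ ζ^K)` with
  -- `K ≠ 0` exactly once. The missing summand `K = 0` is the characteristic times the
  -- Euler–Lagrange expression; the full sum is evaluated by integration by parts.
  rw [Finset.sum_congr rfl fun j _ => h1 j,
    sum_MI_add_ix k fun K => ∑ σ, pd K (fun x => χ x σ * zetaSec s η σ K x) x]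
  simp only [pd_zero, zetaSec_zero]
  rw [Finset.sum_comm]
  refine congrArg (· - _) (Finset.sum_congr rfl fun σ _ => ?_)
  rw [sum_MI k fun I => pd I χ x σ * sec s (Psi η σ I) x]
  refine (sum_pd_mul_sum hU (contDiffOn_pi.1 hχ σ)
    (fun I => (Lag.Psi hη σ I).contDiffOn_sec hs) k hx).trans (Finset.sum_congr rfl fun I _ => ?_)
  have h2 := pd_clm_comp (ContinuousLinearMap.proj (R := ℝ) (φ := fun _ : Fin m => ℝ) σ) hU hχ I hx
  simp only [ContinuousLinearMap.proj_apply] at h2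
  rw [h2, mul_comm]

/-- The first variation formula. -/
theorem sec_dH_noether (hW : IsOpen W) (hs : ContDiff ℝ ∞ s) (hψ : ContDiffOn ℝ ∞ ψ W)
    (hb : BaseOn W ψ) {κ : Form (n + 1) m k (n + 1)} (hκ : Lag W κ) :
    Set.EqOn (sec s (dH (noether ψ κ))) (fun x => sec s (lie (prol k ψ) κ) x
      - ∑ σ, charSec ψ s x σ * EL s (extDeriv κ) σ x) (secDom W s) := fun x hx => by
  have hU := isOpen_secDom hW hs
  have hχ := contDiffOn_charSec hs hψ
  have hη := hκ.smooth.extDeriv hW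
  have hM := contDiffOn_momentumSec hW hs hη hχ
  have hj : ∀ j, ContDiffOn ℝ ∞ (fun x => (ψ (x, s x)).1 j) (secDom W s) := fun j =>
    contDiffOn_comp_sec hs (contDiffOn_psi_fst hψ j)
  have hκs := hκ.contDiffOn_sec hs
  rw [sec_congr ((horOver_noether hW hψ hκ).dH_eq hW) hx,
    sec_p_zero_extDeriv hW hs (hκ.smooth.noether hW hψ) (horOver_noether hW hψ hκ)
      (K := noetherSec ψ s κ) (fun j => (hM j).add ((hj j).mul hκs))
      (fun y hy v => noether_jetOf hW hs hψ hκ hy v) hx]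
  simp only
  -- The momentum divergence replaces the variation minus the Euler–Lagrange term. What remains is
  -- the product rule for `ψ^j` times the coefficient of the Lagrangian.
  rw [hκ.sec_lie hW hs hψ hb hx, hκ.varSec_eq hW _ hx, add_sub_right_comm,
    ← sum_pder_momentumSec hW hs hη hχ hx, ← Finset.sum_add_distrib]
  refine Finset.sum_congr rfl fun j _ => ?_
  change pder j (fun x => momentumSec s (extDeriv κ) (charSec ψ s) j x
    + (ψ (x, s x)).1 j * sec s κ x) x = _
  rw [pder_add hU (hM j) ((hj j).mul hκs) j hx]
  simp only
  rw [pder_mul hU (hj j) hκs j hx]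

/-- Divergences have vanishing Euler–Lagrange expressions. -/
theorem EL_dH_noether (hW : IsOpen W) (hs : ContDiff ℝ ∞ s) (hψ : ContDiffOn ℝ ∞ ψ W)
    {κ : Form (n + 1) m k (n + 1)} (hκ : Lag W κ) (σ : Fin m) {x : Vec (n + 1)}
    (hx : x ∈ secDom W s) : EL s (extDeriv (dH (noether ψ κ))) σ x = 0 := by
  have hν := (hκ.smooth.noether hW hψ).p 0
  -- Write the horizontal differential as `h d h` of the current. The outer `h` can be dropped by
  -- `EL_extDeriv_p_zero`, and then `d² = 0` applies.
  rw [EL_congr hW hs (extDeriv_congr_over hW ((horOver_noether hW hψ hκ).dH_eq hW)) σ hx,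
    EL_extDeriv_p_zero hW hs (hν.extDeriv hW) σ hx]
  have h0 : Set.EqOn (extDeriv (extDeriv (p 0 (noether ψ κ)))) 0 (jetsOver _ W) := fun u hu =>
    extDeriv_extDeriv_apply (hν.contDiffAt (jetsOver_mem_nhds hW hu))
      (by rw [minSmoothness_of_isRCLikeNormedField]; exact WithTop.coe_le_coe.2 le_top)
  rw [EL_congr hW hs h0 σ hx, EL]
  refine Finset.sum_eq_zero fun I _ => ?_
  have h1 : sec s (Psi (0 : Form (n + 1) m (3 * k + 3 + 1) (n + 2)) σ I.1) = fun _ => 0 := by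
    funext y
    rw [sec, cf_Psi]
    rfl
  rw [h1, pd_zero_fun, mul_zero]

end FirstVariation

/-! ### Components of projectable vector fields -/

section Fields

variable {X Y : Type*} [TopologicalSpace X] [ChartedSpace (Vec N) X]
  [IsManifold 𝓘(ℝ, Vec N) ∞ X]
  [TopologicalSpace Y] [ChartedSpace (Vec N × Vec m) Y]
  [IsManifold 𝓘(ℝ, Vec N × Vec m) ∞ Y] {π : Y → X}

theorem ProjField.contDiffOn_comp (ψ : ProjField (N := N) (m := m) π)
    (e : FibredChart (N := N) (m := m) π) : ContDiffOn ℝ ∞ (ψ.comp e) e.chart.target := by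
  have h1 : ContMDiffOn 𝓘(ℝ, Vec N × Vec m) (𝓘(ℝ, Vec N × Vec m)).tangent ∞
      (fun z => (⟨e.chart.symm z, ψ.field (e.chart.symm z)⟩ :
        TangentBundle 𝓘(ℝ, Vec N × Vec m) Y)) e.chart.target :=
    ψ.smooth.comp_contMDiffOn (contMDiffOn_symm_of_mem_maximalAtlas e.chart_mem)
  have h2 := (contMDiffOn_of_mem_maximalAtlas e.chart_mem).contMDiffOn_tangentMapWithin
    (m := ∞) (by simp) e.chart.open_source.uniqueMDiffOn
  have h3 := h2.comp h1 fun z hz => e.chart.map_target hz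
  have h4 := (contMDiff_snd_tangentBundle_modelSpace (n := ∞) (Vec N × Vec m)
    𝓘(ℝ, Vec N × Vec m)).comp_contMDiffOn h3
  refine (contMDiffOn_iff_contDiffOn.1 h4).congr fun z hz => ?_
  change _ = mfderivWithin _ _ e.chart e.chart.source (e.chart.symm z) _
  rw [mfderivWithin_of_isOpen e.chart.open_source (e.chart.map_target hz)]
  rfl

/-- Near the point, the first component of the chart is the base chart composed with `π`; the chain
rule is applied to both factorizations. -/
theorem ProjField.comp_fst (hπ : ContMDiff 𝓘(ℝ, Vec N × Vec m) 𝓘(ℝ, Vec N) ∞ π)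
    (ψ : ProjField (N := N) (m := m) π)
    (e : FibredChart (N := N) (m := m) π) {z : Vec N × Vec m} (hz : z ∈ e.chart.target) :
    (ψ.comp e z).1 = mfderiv 𝓘(ℝ, Vec N) 𝓘(ℝ, Vec N) e.baseChart (π (e.chart.symm z))
      (mfderiv 𝓘(ℝ, Vec N × Vec m) 𝓘(ℝ, Vec N) π (e.chart.symm z)
        (ψ.field (e.chart.symm z))) := by
  set y := e.chart.symm z with hy
  have hys : y ∈ e.chart.source := e.chart.map_target hz
  have hE : MDifferentiableAt 𝓘(ℝ, Vec N × Vec m) 𝓘(ℝ, Vec N × Vec m) e.chart y :=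
    (contMDiffAt_of_mem_maximalAtlas e.chart_mem hys).mdifferentiableAt (by simp)
  have hB : MDifferentiableAt 𝓘(ℝ, Vec N) 𝓘(ℝ, Vec N) e.baseChart (π y) :=
    (contMDiffAt_of_mem_maximalAtlas e.baseChart_mem (e.mapsTo y hys)).mdifferentiableAt (by simp)
  have hP : MDifferentiableAt 𝓘(ℝ, Vec N × Vec m) 𝓘(ℝ, Vec N) π y :=
    (hπ y).mdifferentiableAt (by simp)
  have hF : MDifferentiableAt 𝓘(ℝ, Vec N × Vec m) 𝓘(ℝ, Vec N)
      (ContinuousLinearMap.fst ℝ (Vec N) (Vec m)) (e.chart y) :=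
    (ContinuousLinearMap.fst ℝ (Vec N) (Vec m)).differentiableAt.mdifferentiableAt
  have hEq : (ContinuousLinearMap.fst ℝ (Vec N) (Vec m)) ∘ e.chart =ᶠ[𝓝 y] e.baseChart ∘ π := by
    filter_upwards [e.chart.open_source.mem_nhds hys] with w hw
    exact e.fst_eq w hw
  have h := hEq.mfderiv_eq (I := 𝓘(ℝ, Vec N × Vec m)) (I' := 𝓘(ℝ, Vec N))
  rw [mfderiv_comp y hB hP, mfderiv_comp y hF hE, mfderiv_eq_fderiv,
    ContinuousLinearMap.fderiv] at h
  exact congrArg (fun A => A (ψ.field y)) h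

/-- Equal base coordinates give equal points of `X`, as the base chart is injective, and there the
projected vector is the same by projectability. -/
theorem ProjField.baseOn_comp (hπ : ContMDiff 𝓘(ℝ, Vec N × Vec m) 𝓘(ℝ, Vec N) ∞ π)
    (ψ : ProjField (N := N) (m := m) π)
    (e : FibredChart (N := N) (m := m) π) : BaseOn e.chart.target (ψ.comp e) := by
  intro z hz z' hz' h
  obtain ⟨f, hf⟩ := ψ.projectable
  have h1 : ∀ z ∈ e.chart.target, e.baseChart (π (e.chart.symm z)) = z.1 := fun z hz => by
    rw [← e.fst_eq _ (e.chart.map_target hz), e.chart.right_inv hz]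
  have h2 : π (e.chart.symm z) = π (e.chart.symm z') :=
    e.baseChart.injOn (e.mapsTo _ (e.chart.map_target hz)) (e.mapsTo _ (e.chart.map_target hz'))
      (by rw [h1 z hz, h1 z' hz', h])
  rw [ψ.comp_fst hπ e hz, ψ.comp_fst hπ e hz', hf, hf, h2]

end Fields

/-! ### Terms of the iterated variation -/

section Variation

variable {n r k : ℕ} {W : Set (Vec (n + 1) × Vec m)}

theorem eqOn_eulerContr (hW : IsOpen W) {ψ : Vec (n + 1) × Vec m → Vec (n + 1) × Vec m}
    (hψ : ContDiffOn ℝ ∞ ψ W) {κ : Form (n + 1) m k (n + 1)} (hκ : Lag W κ) :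
    Set.EqOn (eulerContr ψ κ) (pull (2 * k + 2) (eulerL ψ (extDeriv κ)))
      (jetsOver (2 * k + 2) W) :=
  contr_intEuler hW hψ (hκ.smooth.extDeriv hW)

theorem Lag.eulerContr (hW : IsOpen W) {ψ : Vec (n + 1) × Vec m → Vec (n + 1) × Vec m}
    (hψ : ContDiffOn ℝ ∞ ψ W) {κ : Form (n + 1) m k (n + 1)} (hκ : Lag W κ) :
    Lag W (eulerContr ψ κ) :=
  ((Lag.eulerL hW hψ (hκ.smooth.extDeriv hW)).pull _).congr (eqOn_eulerContr hW hψ hκ).symm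

theorem sec_eulerContr (hW : IsOpen W) {ψ : Vec (n + 1) × Vec m → Vec (n + 1) × Vec m}
    (hψ : ContDiffOn ℝ ∞ ψ W) {κ : Form (n + 1) m k (n + 1)} (hκ : Lag W κ)
    {s : Vec (n + 1) → Vec m} (hs : ContDiff ℝ ∞ s) :
    Set.EqOn (sec s (eulerContr ψ κ)) (fun x => ∑ σ, charSec ψ s x σ * EL s (extDeriv κ) σ x)
      (secDom W s) := fun x hx => by
  rw [sec_congr (eqOn_eulerContr hW hψ hκ) hx, sec_pull (Nat.le_succ _),
    sec_eulerL hW hs (hκ.smooth.extDeriv hW) hx]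

theorem lie_sum {N k k' q : ℕ} {W : Set (Vec N × Vec m)} (hW : IsOpen W) {ι : Type*}
    (t : Finset ι) {κ : ι → Form N m k q} (hκ : ∀ a ∈ t, SmoothOver W (κ a))
    (ξ : Jet N m k' → Jet N m k) :
    Set.EqOn (lie ξ (∑ a ∈ t, κ a)) (∑ a ∈ t, lie ξ (κ a)) (jetsOver k' W) := fun u hu => by
  refine ContinuousAlternatingMap.ext fun v => ?_
  have h : fderiv ℝ (∑ a ∈ t, κ a) (jproj k' k u) = ∑ a ∈ t, fderiv ℝ (κ a) (jproj k' k u) :=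
    fderiv_sum fun a ha => differentiableAt_of_contDiffOn (isOpen_jetsOver hW k) (hκ a ha)
      (jproj_mem_jetsOver hu)
  rw [lie_apply, h]
  simp only [form_sum_apply, lie_apply, sum_apply,
    ContinuousAlternatingMap.sum_apply, Finset.sum_add_distrib]
  rw [Finset.sum_comm]

variable {ψ : ℕ → Vec (n + 1) × Vec m → Vec (n + 1) × Vec m} {lam : Form (n + 1) m k (n + 1)}

theorem varTerm_succ_of_le {j l : ℕ} (h : l + 1 ≤ j) :
    varTerm ψ lam j (l + 1)
      = pull (3 * bigOrder k l + 5) (eulerContr (ψ (l + 1)) (varTerm ψ lam j l)) := if_pos h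

theorem varTerm_succ_of_lt {j l : ℕ} (h : j < l + 1) :
    varTerm ψ lam j (l + 1) = dH (noether (ψ (l + 1)) (varTerm ψ lam j l)) := if_neg (not_le.2 h)

/-- The terms `A_l` do not depend on the index `j ≥ l` used to write them. -/
theorem varTerm_eq_of_le {j j' : ℕ} : ∀ {l : ℕ}, l ≤ j → l ≤ j' →
    varTerm ψ lam j l = varTerm ψ lam j' l
  | 0, _, _ => rfl
  | l + 1, h, h' => by
    rw [varTerm_succ_of_le h, varTerm_succ_of_le h',
      varTerm_eq_of_le ((Nat.le_succ l).trans h) ((Nat.le_succ l).trans h')]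

theorem le_bigOrder (s : ℕ) : ∀ l, s ≤ bigOrder s l
  | 0 => le_rfl
  | l + 1 => (le_bigOrder s l).trans (by change _ ≤ 3 * bigOrder s l + 5; omega)

theorem Lag.varTerm (hW : IsOpen W) (hψ : ∀ i, ContDiffOn ℝ ∞ (ψ i) W) (hlam : Lag W lam)
    (j : ℕ) : ∀ l, Lag W (varTerm ψ lam j l)
  | 0 => hlam
  | l + 1 => by
    rcases le_or_gt (l + 1) j with h | h
    · rw [varTerm_succ_of_le h]
      exact ((Lag.varTerm hW hψ hlam j l).eulerContr hW (hψ _)).pull _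
    · rw [varTerm_succ_of_lt h]
      exact (Lag.varTerm hW hψ hlam j l).dH_noether hW (hψ _)

theorem sec_varTerm_succ_of_le (hW : IsOpen W) (hψ : ∀ i, ContDiffOn ℝ ∞ (ψ i) W) (hlam : Lag W lam)
    {j l : ℕ} (h : l + 1 ≤ j) {s : Vec (n + 1) → Vec m}
    (hs : ContDiff ℝ ∞ s) :
    Set.EqOn (sec s (varTerm ψ lam j (l + 1)))
      (fun x => ∑ σ, charSec (ψ (l + 1)) s x σ * EL s (extDeriv (varTerm ψ lam j l)) σ x)
      (secDom W s) := by
  have h1 : sec s (varTerm ψ lam j (l + 1))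
      = sec s (eulerContr (ψ (l + 1)) (varTerm ψ lam j l)) := by
    rw [varTerm_succ_of_le h]
    exact sec_pull (k' := 3 * bigOrder k l + 5) (by omega) _
  rw [h1]
  exact sec_eulerContr hW (hψ _) (Lag.varTerm hW hψ hlam j l) hs

/-- For `j < l` the term is a horizontal differential. Hence the next variation produces no new
source term from it. -/
theorem EL_varTerm (hW : IsOpen W) (hψ : ∀ i, ContDiffOn ℝ ∞ (ψ i) W) (hlam : Lag W lam)
    {j l : ℕ} (h : j < l) {s : Vec (n + 1) → Vec m} (hs : ContDiff ℝ ∞ s)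
    (σ : Fin m) {x : Vec (n + 1)} (hx : x ∈ secDom W s) :
    EL s (extDeriv (varTerm ψ lam j l)) σ x = 0 := by
  obtain ⟨l, rfl⟩ : ∃ l', l = l' + 1 := ⟨l - 1, by omega⟩
  rw [varTerm_succ_of_lt h]
  exact EL_dH_noether hW hs (hψ _) (Lag.varTerm hW hψ hlam j l) σ hx

theorem sec_varTerm_succ_of_lt (hW : IsOpen W) (hψ : ∀ i, ContDiffOn ℝ ∞ (ψ i) W) (hlam : Lag W lam)
    (hb : ∀ i, BaseOn W (ψ i)) {j l : ℕ} (h : j < l + 1) {s : Vec (n + 1) → Vec m}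
    (hs : ContDiff ℝ ∞ s) :
    Set.EqOn (sec s (varTerm ψ lam j (l + 1)))
      (fun x => sec s (lie (prol (bigOrder k l) (ψ (l + 1))) (varTerm ψ lam j l)) x
        - ∑ σ, charSec (ψ (l + 1)) s x σ * EL s (extDeriv (varTerm ψ lam j l)) σ x)
      (secDom W s) := by
  rw [varTerm_succ_of_lt h]
  exact sec_dH_noether hW hs (hψ _) (hb _) (Lag.varTerm hW hψ hlam j l)

theorem Lag.iterLie (hW : IsOpen W) (hψ : ∀ i, ContDiffOn ℝ ∞ (ψ i) W) (hlam : Lag W lam)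
    (hb : ∀ i, BaseOn W (ψ i)) : ∀ l, Lag W (iterLie ψ lam l)
  | 0 => hlam
  | l + 1 => (Lag.iterLie hW hψ hlam hb l).lie hW (hψ _) (hb _)

/-- The decomposition of the iterated variation, along sections. -/
theorem sec_iterLie (hW : IsOpen W) (hψ : ∀ i, ContDiffOn ℝ ∞ (ψ i) W) (hlam : Lag W lam)
    (hb : ∀ i, BaseOn W (ψ i)) {s : Vec (n + 1) → Vec m} (hs : ContDiff ℝ ∞ s) : ∀ l,
    Set.EqOn (sec s (iterLie ψ lam l))
      (fun x => ∑ j ∈ Finset.range (l + 1), sec s (varTerm ψ lam j l) x) (secDom W s) := by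
  -- The induction hypothesis is needed for all sections at once, since it is converted into an
  -- equality of forms.
  suffices h : ∀ l, ∀ s, ContDiff ℝ ∞ s → Set.EqOn (sec s (JetVar.iterLie ψ lam l))
      (fun x => ∑ j ∈ Finset.range (l + 1), sec s (JetVar.varTerm ψ lam j l) x) (secDom W s) from
    fun l => h l s hs
  intro l
  induction l with
  | zero =>
    intro s _ x _
    exact (Finset.sum_range_one fun j => sec s (JetVar.varTerm ψ lam j 0) x).symm
  | succ l ih =>
    intro s hs x hx
    have hI := Lag.iterLie hW hψ hlam hb l
    have hV := fun j => Lag.varTerm hW hψ hlam j l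
    -- The Lie derivative involves derivatives of the form off the given prolonged section, so the
    -- decomposition at stage `l` must first hold on an open part of the jet space.
    have h1 : Set.EqOn (pull (bigOrder k l) (JetVar.iterLie ψ lam l))
        (∑ j ∈ Finset.range (l + 1), JetVar.varTerm ψ lam j l) (jetsOver (bigOrder k l) W) :=
      (hI.pull _).eqOn_of_sec (Lag.sum fun j _ => hV j) fun s hs x hx => by
        rw [sec_pull (le_bigOrder k l), sec_sum, ih s hs hx]
    change sec s (lie (prol k (ψ (l + 1))) (JetVar.iterLie ψ lam l)) x = _
    rw [← hI.sec_lie_pull hW hs (hψ _) (hb _) (le_bigOrder k l) hx,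
      sec_congr (lie_congr_over hW h1 _) hx,
      sec_congr (lie_sum hW _ (fun j _ => (hV j).smooth) _) hx, sec_sum, Finset.sum_range_succ]
    simp only
    rw [Finset.sum_range_succ, Finset.sum_range_succ, add_assoc]
    congr 1
    · refine Finset.sum_congr rfl fun j hj => ?_
      have hj' := Finset.mem_range.1 hj
      rw [sec_varTerm_succ_of_lt hW hψ hlam hb (Nat.lt_succ_of_lt hj') hs hx]
      simp only [EL_varTerm hW hψ hlam hj' hs _ hx, mul_zero, Finset.sum_const_zero, sub_zero]
    -- The term `A_l` yields the terms of index `l` and `l + 1` at the next stage; their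
    -- Euler–Lagrange parts cancel.
    · rw [sec_varTerm_succ_of_lt hW hψ hlam hb (Nat.lt_succ_self l) hs hx,
        sec_varTerm_succ_of_le hW hψ hlam le_rfl hs hx,
        varTerm_eq_of_le (Nat.le_succ l) (le_refl l)]
      ring

/-- The Lagrangian `κ` is the pull-back of a Lagrangian of order `k'`. -/
def HasOrder {N k : ℕ} (W : Set (Vec N × Vec m)) (k' : ℕ) (κ : Form N m k N) : Prop :=
  ∃ κ' : Form N m k' N, Lag W κ' ∧
    ∀ s, ContDiff ℝ ∞ s → Set.EqOn (sec s κ') (sec s κ) (secDom W s)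

theorem HasOrder.exists_pull_eqOn {N k k' : ℕ} {W : Set (Vec N × Vec m)} {κ : Form N m k N}
    (h : HasOrder W k' κ) (hκ : Lag W κ) (hk : k' ≤ k) :
    ∃ κ' : Form N m k' N, Lag W κ' ∧ Set.EqOn (pull k κ') κ (jetsOver k W) := by
  obtain ⟨κ', hκ', hsec⟩ := h
  refine ⟨κ', hκ', (hκ'.pull k).eqOn_of_sec hκ fun s hs => ?_⟩
  rw [sec_pull hk]
  exact hsec s hs

/-- The source form `η` is left free, subject only to having the right Euler–Lagrange expressions,
so that one of lower order than the differential of the term can be used. -/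
theorem hasOrder_varTerm_succ (hW : IsOpen W) (hψ : ∀ i, ContDiffOn ℝ ∞ (ψ i) W)
    (hb : ∀ i, BaseOn W (ψ i)) (hlam : Lag W lam) {j l k' K : ℕ}
    (h : HasOrder W k' (varTerm ψ lam j l)) (hk : k' ≤ bigOrder k l) (hK : k' ≤ 2 * K + 1)
    {η : Form (n + 1) m K (n + 2)} (hη : SmoothOver W η)
    (hEL : ∀ s, ContDiff ℝ ∞ s → ∀ σ, Set.EqOn (EL s η σ)
      (EL s (extDeriv (varTerm ψ lam j l)) σ) (secDom W s)) :
    HasOrder W (2 * K + 1) (varTerm ψ lam j (l + 1)) := by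
  have hE := Lag.eulerL hW (hψ (l + 1)) hη
  rcases le_or_gt (l + 1) j with hj | hj
  · refine ⟨_, hE, fun s hs x hx => ?_⟩
    rw [sec_varTerm_succ_of_le hW hψ hlam hj hs hx, sec_eulerL hW hs hη hx]
    simp only [hEL s hs _ hx]
  · obtain ⟨κ, hκ, hpull⟩ := h.exists_pull_eqOn (Lag.varTerm hW hψ hlam j l) hk
    -- By the first variation formula `d_H ε` is the Lie derivative, of the order of the term, minus
    -- the Euler contraction, of order `2K+1`.
    refine ⟨pull (2 * K + 1) (lie (prol k' (ψ (l + 1))) κ) + (-1 : ℝ) • eulerL (ψ (l + 1)) η,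
      ((hκ.lie hW (hψ _) (hb _)).pull _).add (hE.const_smul _), fun s hs x hx => ?_⟩
    rw [sec_varTerm_succ_of_lt hW hψ hlam hb hj hs hx]
    change sec s (pull (2 * K + 1) (lie (prol k' (ψ (l + 1))) κ)) x
      + (-1 : ℝ) * sec s (eulerL (ψ (l + 1)) η) x = _
    simp only
    rw [sec_pull hK, sec_eulerL hW hs hη hx, ← sec_congr (lie_congr_over hW hpull _) hx,
      hκ.sec_lie_pull hW hs (hψ _) (hb _) hk hx]
    simp only [hEL s hs _ hx]
    ring

theorem ord_le_bigOrder (r : ℕ) : ∀ l, ord r l ≤ bigOrder (r + 1) l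
  | 0 => Nat.le_succ r
  | l + 1 => by
    have := ord_le_bigOrder r l
    change 2 * ord r l + 1 ≤ 3 * bigOrder (r + 1) l + 5
    omega

theorem le_ord (r : ℕ) : ∀ l, r ≤ ord r l
  | 0 => le_rfl
  | l + 1 => (le_ord r l).trans (by change _ ≤ 2 * ord r l + 1; omega)

theorem hasOrder_varTerm (hW : IsOpen W) (hψ : ∀ i, ContDiffOn ℝ ∞ (ψ i) W)
    (hb : ∀ i, BaseOn W (ψ i)) {ρ : Form (n + 1) m r (n + 1)} (hρ : SmoothOver W ρ) (j : ℕ) :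
    ∀ l, HasOrder W (ord r (l + 1)) (varTerm ψ (p 0 ρ) j (l + 1))
  -- Although `hρ` has order `r + 1`, the source form `dρ` of order `r` has the same Euler–Lagrange
  -- expressions. The order `r + 1` of the Lie derivative fits into `2r + 1` even for `r = 0`.
  | 0 => hasOrder_varTerm_succ hW hψ hb (Lag.p_zero hρ) (k' := r + 1)
      ⟨p 0 ρ, Lag.p_zero hρ, fun _ _ _ _ => rfl⟩ le_rfl
      (by change r + 1 ≤ 2 * r + 1; omega) (hρ.extDeriv hW)
      fun _ hs σ _ hx => (EL_extDeriv_p_zero hW hs hρ σ hx).symm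
  | l + 1 => by
    have h := hasOrder_varTerm hW hψ hb hρ j l
    have hk := ord_le_bigOrder r (l + 1)
    obtain ⟨κ, hκ, hpull⟩ := h.exists_pull_eqOn
      (Lag.varTerm hW hψ (Lag.p_zero hρ) j (l + 1)) hk
    -- The source form is now the differential of the representative `κ` of order `r_{l+1}`; pulling
    -- back to the large jet space leaves the Euler–Lagrange expressions unchanged.
    refine hasOrder_varTerm_succ hW hψ hb (Lag.p_zero hρ) h hk (by omega)
      (hκ.smooth.extDeriv hW) fun s hs σ x hx => ?_
    rw [← EL_congr hW hs (extDeriv_congr_over hW hpull) σ hx, hκ.EL_pull hW hs hk σ hx]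

/-- The decomposition of the iterated variation over a coordinate domain. -/
theorem exists_variation_terms (hW : IsOpen W) (hψ : ∀ i, ContDiffOn ℝ ∞ (ψ i) W)
    (hb : ∀ i, BaseOn W (ψ i)) {ρ : Form (n + 1) m r (n + 1)} (hρ : SmoothOver W ρ) {l : ℕ}
    (hl : 1 ≤ l) :
    ∃ T : ℕ → Form (n + 1) m (ord r l) (n + 1),
      (∀ j ≤ l, SmoothOver W (T j) ∧ ∀ u ∈ jetsOver (bigOrder (r + 1) l) W,
        pull (bigOrder (r + 1) l) (T j) u = varTerm ψ (p 0 ρ) j l u) ∧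
      ∀ u ∈ jetsOver (ord r l) W,
        pull (ord r l) (iterLie ψ (p 0 ρ) l) u = ∑ j ∈ Finset.range (l + 1), T j u := by
  obtain ⟨l, rfl⟩ : ∃ l', l = l' + 1 := ⟨l - 1, by omega⟩
  have hlam := Lag.p_zero hρ
  have hk := ord_le_bigOrder r (l + 1)
  have hV := fun j => Lag.varTerm hW hψ hlam j (l + 1)
  choose T hT hpull using fun j =>
    (hasOrder_varTerm hW hψ hb hρ j l).exists_pull_eqOn (hV j) hk
  have hsec : ∀ j s, Set.EqOn (sec s (T j)) (sec s (varTerm ψ (p 0 ρ) j (l + 1))) (secDom W s) :=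
    fun j s => by
      rw [← sec_pull hk (T j)]
      exact sec_congr (hpull j)
  refine ⟨T, fun j _ => ⟨(hT j).smooth, hpull j⟩, fun u hu => ?_⟩
  have hr : r + 1 ≤ ord r (l + 1) := by
    have := le_ord r l
    change r + 1 ≤ 2 * ord r l + 1
    omega
  -- Both sides are Lagrangians of order `r_l`, so the decomposition along sections gives the
  -- identity of forms already on the `r_l`-jets.
  rw [((Lag.iterLie hW hψ hlam hb (l + 1)).pull _).eqOn_of_sec
    (Lag.sum fun j _ => hT j) (fun s hs x hx => ?_) hu, Finset.sum_apply]
  rw [sec_pull hr, sec_iterLie hW hψ hlam hb hs _ hx, sec_sum]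
  exact Finset.sum_congr rfl fun j _ => (hsec j s hx).symm

end Variation

end JetVar

end

open JetVar Manifold ContDiff in
theorem theorem3p4 {n m : ℕ} {X Y : Type*}
    [TopologicalSpace X] [ChartedSpace (Vec (n + 1)) X]
    [IsManifold 𝓘(ℝ, Vec (n + 1)) ∞ X]
    [TopologicalSpace Y] [ChartedSpace (Vec (n + 1) × Vec m) Y]
    [IsManifold 𝓘(ℝ, Vec (n + 1) × Vec m) ∞ Y]
    (π : Y → X) (hπ_surj : Function.Surjective π)
    (hπ : IsSubmersion 𝓘(ℝ, Vec (n + 1) × Vec m) 𝓘(ℝ, Vec (n + 1)) ∞ π)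
    (r : ℕ) (ρ : JetForm (N := n + 1) (m := m) π r (n + 1))
    (l : ℕ) (hl : 1 ≤ l) (ψ : ℕ → ProjField (N := n + 1) (m := m) π)
    (e : FibredChart (N := n + 1) (m := m) π) :
    ∃ T : ℕ → Form (n + 1) m (ord r l) (n + 1),
      (∀ j ≤ l, SmoothOver e.chart.target (T j) ∧
        ∀ u ∈ jetsOver (bigOrder (r + 1) l) e.chart.target,
          pull (bigOrder (r + 1) l) (T j) u =
            varTerm (fun i => (ψ i).comp e) (p 0 (ρ.form e)) j l u) ∧
      ∀ u ∈ jetsOver (ord r l) e.chart.target,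
        pull (ord r l) (iterLie (fun i => (ψ i).comp e) (p 0 (ρ.form e)) l) u =
          ∑ j ∈ Finset.range (l + 1), T j u :=
  exists_variation_terms e.chart.open_target (fun i => (ψ i).contDiffOn_comp e)
    (fun i => (ψ i).baseOn_comp hπ.contMDiff e) (ρ.smooth e) hl
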